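/- A partition $\lambda=(\lambda_1\ge\lambda_2\ge\dots)$ is extended by zeros. Let $\Lambda^*$ be the algebra of shifted symmetric functions over $\mathbb{C}$: the projective limit, as filtered algebras, of the algebras $\Lambda^*(n)$ of polynomials in $\lambda_1,\dots,\lambda_n$ that are symmetric in the variables $\lambda_i-i$, filtered by degree, along the maps $\lambda_n\mapsto 0$. Its elements are regarded as functions on partitions. For $i\ge 1$ let $p_i\in\Lambda^*$ be $$p_i(\lambda)=\sum_{j\ge 1}\left[(\lambda_j-j+\tfrac12)^i-(-j+\tfrac12)^i\right]+(1-2^{-i})\,\zeta(-i).$$ For a partition $\mu=1^{\varkappa_1}2^{\varkappa_2}3^{\varkappa_3}\cdots$ with $\ell(\mu)$ parts put $p_\mu=\prod_j p_{\mu_j}$, $\varkappa!=\prod_i\varkappa_i!$ and $\mathrm{wt}(\mu)=|\mu|+\ell(\mu)$. An element of $\Lambda^*$ is said to have weight at most $m$ if it is a linear combination of the $p_\mu$ with $\mathrm{wt}(\mu)\le m$. For $k\ge 2$ let $f_k$ be the following function on partitions: $f_k(\lambda)=\#C\,\chi^\lambda(C)/\dim\lambda$, where $C$ is the conjugacy class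 of a $k$-cycle in the symmetric group $S(|\lambda|)$, $\chi^\lambda$ is the character of the irreducible representation of $S(|\lambda|)$ corresponding to $\lambda$ and $\dim\lambda=\chi^\lambda(1)$; and $f_k(\lambda)=0$ if $|\lambda|<k$. **Theorem.** For every $k\ge 2$ we have $f_k\in\Lambda^*$ and $$f_k=\frac1k\sum_{\mathrm{wt}(\mu)=k+1}\frac{(-k)^{\ell(\mu)-1}}{\varkappa!}\,p_\mu+\dots,$$ where the sum is over all partitions $\mu=1^{\varkappa_1}2^{\varkappa_2}3^{\varkappa_3}\cdots$ of weight $k+1$ and the dots stand for an element of $\Lambda^*$ of weight at most $k-1$. Equivalently, $$f_k=-\frac1{k^{2}}\,[z^{k+1}]\,P(z)^k+\dots,\qquad P(z)=\exp\Big(-\sum_{i\ge1}z^{i+1}p_i\Big),$$ where $[z^{k+1}]$ denotes the coefficient of $z^{k+1}$ and the dots again stand for an element of weight at most $k-1$. -/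

import Mathlib

namespace ShiftedSym

noncomputable section

/-! ### Irreducible characters of the symmetric group and the central characters `f_k`

Partitions `λ` are Young diagrams: `λ.rowLen i` is the `(i+1)`-st part. The symmetric group
`S(d)`, `d = |λ|`, is realised as the permutations of the `d` boxes of `λ`. -/

/-- The symmetric group on the boxes of `lam`. -/
abbrev BoxPerm (lam : YoungDiagram) : Type := Equiv.Perm {c : ℕ × ℕ // c ∈ lam.cells}

/-- The permutations of the boxes that preserve every row. -/
def rowPerms (lam : YoungDiagram) : Finset (BoxPerm lam) :=
  Finset.univ.filter fun s => ∀ c, (s c).1.1 = c.1.1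

/-- The permutations of the boxes that preserve every column. -/
def colPerms (lam : YoungDiagram) : Finset (BoxPerm lam) :=
  Finset.univ.filter fun s => ∀ c, (s c).1.2 = c.1.2

/-- The Young symmetrizer `(∑_{p ∈ rows} p) (∑_{q ∈ columns} sgn(q) q)` in `ℂ[S(d)]`. -/
def youngSymmetrizer (lam : YoungDiagram) : MonoidAlgebra ℂ (BoxPerm lam) :=
  (∑ p ∈ rowPerms lam, MonoidAlgebra.single p (1 : ℂ)) *
    ∑ q ∈ colPerms lam, MonoidAlgebra.single q (((Equiv.Perm.sign q : ℤ) : ℂ))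

/-- The Specht module: the left ideal of `ℂ[S(d)]` generated by the Young symmetrizer. -/
abbrev Specht (lam : YoungDiagram) : Submodule (MonoidAlgebra ℂ (BoxPerm lam))
    (MonoidAlgebra ℂ (BoxPerm lam)) :=
  Submodule.span (MonoidAlgebra ℂ (BoxPerm lam)) {youngSymmetrizer lam}

/-- The irreducible representation of `S(d)` corresponding to `lam`: left multiplication
on the Specht module. -/
def spechtRep (lam : YoungDiagram) : Representation ℂ (BoxPerm lam) (Specht lam) :=
  (Algebra.lsmul ℂ (A := MonoidAlgebra ℂ (BoxPerm lam)) ℂ (Specht lam)).toMonoidHom.comp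
    (MonoidAlgebra.of ℂ (BoxPerm lam))

/-- The irreducible character `χ^λ`. -/
def chi (lam : YoungDiagram) (g : BoxPerm lam) : ℂ := (spechtRep lam).character g

/-- `f_C(λ) = #C · χ^λ(C) / dim λ` for a conjugacy class `C` of `S(d)`, where `χ^λ(C)` is the
value at any element of `C` and `dim λ = χ^λ(1)`. -/
def centralCharacter (lam : YoungDiagram) (C : ConjClasses (BoxPerm lam)) : ℂ :=
  (Nat.card C.carrier : ℂ) * chi lam (Quotient.out C) / chi lam 1

open Classical in
/-- `f_k(λ) = f_C(λ)`, where `C` is the class of a `k`-cycle in `S(|λ|)`, for `k ≥ 2`; this is `0`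
when there are no `k`-cycles, that is, when `|λ| < k`. -/
def fCycle (k : ℕ) (lam : YoungDiagram) : ℂ :=
  if h : ∃ g : BoxPerm lam, g.cycleType = {k} then
    centralCharacter lam (ConjClasses.mk h.choose)
  else 0

/-! ### The algebra of shifted symmetric functions -/

/-- `F` is shifted symmetric of degree at most `d`: for every `n`, on the partitions with at most
`n` parts, `F` is given by a polynomial of degree at most `d` in `λ₁, …, λ_n` that is symmetric in
the variables `λ_i - i`, that is, by a symmetric polynomial `Q` evaluated at the `λ_i - i`. -/
def IsShiftedSymmetric (d : ℕ) (F : YoungDiagram → ℂ) : Prop :=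
  ∀ n : ℕ, ∃ Q : MvPolynomial (Fin n) ℂ, Q.IsSymmetric ∧ Q.totalDegree ≤ d ∧
    ∀ lam : YoungDiagram, lam.colLen 0 ≤ n →
      F lam = MvPolynomial.eval (fun i : Fin n => (lam.rowLen i : ℂ) - ((i : ℕ) + 1)) Q

theorem IsShiftedSymmetric.mul {d e : ℕ} {F G : YoungDiagram → ℂ}
    (hF : IsShiftedSymmetric d F) (hG : IsShiftedSymmetric e G) :
    IsShiftedSymmetric (d + e) (F * G) := by
  intro n
  obtain ⟨Q, hQ, hQd, hQe⟩ := hF n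
  obtain ⟨R, hR, hRd, hRe⟩ := hG n
  refine ⟨Q * R, hQ.mul hR, (MvPolynomial.totalDegree_mul _ _).trans (by omega), ?_⟩
  intro lam hl
  simp [hQe lam hl, hRe lam hl]

theorem IsShiftedSymmetric.add {d e : ℕ} {F G : YoungDiagram → ℂ}
    (hF : IsShiftedSymmetric d F) (hG : IsShiftedSymmetric e G) :
    IsShiftedSymmetric (max d e) (F + G) := by
  intro n
  obtain ⟨Q, hQ, hQd, hQe⟩ := hF n
  obtain ⟨R, hR, hRd, hRe⟩ := hG n
  refine ⟨Q + R, hQ.add hR, (MvPolynomial.totalDegree_add _ _).trans (by omega), ?_⟩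
  intro lam hl
  simp [hQe lam hl, hRe lam hl]

theorem IsShiftedSymmetric.const (a : ℂ) : IsShiftedSymmetric 0 (fun _ => a) := by
  intro n
  exact ⟨MvPolynomial.C a, MvPolynomial.IsSymmetric.C a, by simp, by simp⟩

/-- The algebra `Λ*` of shifted symmetric functions, the limit of the filtered algebras `Λ*(n)`
of shifted symmetric polynomials in `n` variables along the maps `λ_n ↦ 0`. An element of the limit
is identified with the function on partitions that it defines (a polynomial in `λ₁, …, λ_n` is
determined by its values at partitions with at most `n` parts); the degrees of the components of
an element are bounded. -/
def Lam : Subalgebra ℂ (YoungDiagram → ℂ) where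
  carrier := {F | ∃ d, IsShiftedSymmetric d F}
  mul_mem' := by
    rintro F G ⟨d, hF⟩ ⟨e, hG⟩
    exact ⟨d + e, hF.mul hG⟩
  add_mem' := by
    rintro F G ⟨d, hF⟩ ⟨e, hG⟩
    exact ⟨max d e, hF.add hG⟩
  algebraMap_mem' := fun a => ⟨0, IsShiftedSymmetric.const a⟩

/-! ### The generators `p_k`, the weight filtration and the generating function `P(z)` -/

/-- `p_k(λ) = ∑_{i ≥ 1} [(λ_i - i + 1/2)^k - (-i + 1/2)^k] + (1 - 2^{-k}) ζ(-k)`. The summands with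
`i` greater than the number `λ.colLen 0` of parts of `λ` vanish and are left out. -/
def pFun (k : ℕ) (lam : YoungDiagram) : ℂ :=
  ∑ i ∈ Finset.range (lam.colLen 0),
      (((lam.rowLen i : ℂ) - (i + 1) + 1 / 2) ^ k - (-((i : ℂ) + 1) + 1 / 2) ^ k) +
    (1 - (2 ^ k)⁻¹) * riemannZeta (-(k : ℂ))

theorem rowLen_eq_zero {lam : YoungDiagram} {i : ℕ} (h : lam.colLen 0 ≤ i) :
    lam.rowLen i = 0 := by
  by_contra hne
  have h1 : (i, 0) ∈ lam := YoungDiagram.mem_iff_lt_rowLen.2 (Nat.pos_of_ne_zero hne)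
  have h2 := YoungDiagram.mem_iff_lt_colLen.1 h1
  omega

theorem pFun_mem (k : ℕ) : pFun k ∈ Lam := by
  refine ⟨k, fun n => ?_⟩
  let a : ℂ := -(∑ i ∈ Finset.range n, (-((i : ℂ) + 1) + 1 / 2) ^ k) +
    (1 - (2 ^ k)⁻¹) * riemannZeta (-(k : ℂ))
  refine ⟨(∑ i : Fin n, (MvPolynomial.X i + MvPolynomial.C (1 / 2 : ℂ)) ^ k) +
    MvPolynomial.C a, ?_, ?_, ?_⟩
  · intro e
    simp only [map_add, map_sum, map_pow, MvPolynomial.rename_X, MvPolynomial.rename_C]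
    congr 1
    exact Equiv.sum_comp e
      (fun i => (MvPolynomial.X i + MvPolynomial.C (1 / 2 : ℂ)) ^ k)
  · refine (MvPolynomial.totalDegree_add _ _).trans (max_le ?_ (by simp))
    refine MvPolynomial.totalDegree_finsetSum_le fun i _ => ?_
    refine (MvPolynomial.totalDegree_pow _ _).trans ?_
    have : (MvPolynomial.X i + MvPolynomial.C (1 / 2 : ℂ) :
        MvPolynomial (Fin n) ℂ).totalDegree ≤ 1 :=
      (MvPolynomial.totalDegree_add _ _).trans (by simp)
    nlinarith
  · intro lam hl
    have hext : ∑ i ∈ Finset.range (lam.colLen 0),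
        (((lam.rowLen i : ℂ) - (i + 1) + 1 / 2) ^ k - (-((i : ℂ) + 1) + 1 / 2) ^ k) =
        ∑ i ∈ Finset.range n,
        (((lam.rowLen i : ℂ) - (i + 1) + 1 / 2) ^ k - (-((i : ℂ) + 1) + 1 / 2) ^ k) := by
      refine Finset.sum_subset (Finset.range_subset_range.2 hl) fun i _ hi => ?_
      rw [rowLen_eq_zero (by simpa using hi)]
      simp
    simp only [pFun, hext, map_add, map_sum, map_pow, MvPolynomial.eval_X, MvPolynomial.eval_C,
      Finset.sum_sub_distrib, a]
    rw [Fin.sum_univ_eq_sum_range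
      (fun i : ℕ => ((lam.rowLen i : ℂ) - ((i : ℂ) + 1) + 1 / 2) ^ k) n]
    ring

/-- `p_k` as an element of `Λ*`. -/
def p (k : ℕ) : Lam := ⟨pFun k, pFun_mem k⟩

/-- `p_μ = ∏ p_{μ_i}` for a partition `μ` (of some `n`). -/
def pPart {n : ℕ} (mu : n.Partition) : Lam := (mu.parts.map p).prod

/-- The weight `wt(μ) = |μ| + ℓ(μ)`. -/
def wt {n : ℕ} (mu : n.Partition) : ℕ := n + mu.parts.card

/-- `ϰ! = ∏ ϰ_i!` for `μ = 1^{ϰ_1} 2^{ϰ_2} ⋯`. -/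
def kappaFactorial {n : ℕ} (mu : n.Partition) : ℕ :=
  ∏ i ∈ mu.parts.toFinset, (mu.parts.count i).factorial

/-- The `m`-th subspace of the weight filtration of `Λ*`: the combinations of the `p_μ` with
`wt(μ) ≤ m`. -/
def weightFiltration (m : ℕ) : Submodule ℂ Lam :=
  Submodule.span ℂ {F | ∃ (n : ℕ) (mu : n.Partition), wt mu ≤ m ∧ F = pPart mu}

/-- `k⁻¹ ∑_{wt(μ) = k+1} (-k)^{ℓ(μ)-1} / ϰ! · p_μ`. A partition of weight `k+1` is a partition of
some `n ≤ k+1`, and it has at least one part. -/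
def topTerm (k : ℕ) : Lam :=
  (k : ℂ)⁻¹ • ∑ n ∈ Finset.range (k + 2),
    ∑ mu ∈ (Finset.univ : Finset n.Partition).filter (fun mu => wt mu = k + 1),
      ((-(k : ℂ)) ^ (mu.parts.card - 1) / (kappaFactorial mu : ℂ)) • pPart mu

/-- `P(z) = exp(-∑_{i ≥ 1} z^{i+1} p_i)`, a power series in `z` with coefficients in `Λ*`. -/
def genP : PowerSeries Lam :=
  (PowerSeries.exp ℂ).subst
    (-PowerSeries.mk (fun j => if 2 ≤ j then p (j - 1) else 0) : PowerSeries Lam)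

end

end ShiftedSym

namespace ShiftedSym

set_option linter.unusedSectionVars false

noncomputable section

/-! ### Group algebras of finite groups -/

section GroupAlgebra

variable {G : Type*} [Group G] [Fintype G]

/-! The theorem is Frobenius's formula for the central character of a `k`-cycle, rewritten as a
coefficient of a power series and followed by a weight count.

Representation theory. `f_k(λ)` is the scalar by which the sum of all `k`-cycles acts on the Specht
module (`fCycle_eq_diagCyc`). A Young symmetrizer has coefficient `1` at the identity, so such a
scalar can be read off as a coefficient. The Jucys–Murphy element acts by the content of the removed
box, hence it separates the pieces of a restricted or induced module. This gives lower bounds for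
the dimensions of these modules, and the exchange identity `sum_outers_corners` forces equality:
this is the branching rule `diagDim_branching`. Since all `k`-cycles are conjugate, taking traces
gives a recursion for `f_k(λ) dim λ` over the corners of `λ` (`diagCyc_branching`). It starts at
`|λ| = k`, where `k`-cycles are full cycles and their sum acts by the product of the contents of the
boxes other than the first (`diagCyc_card`).

Frobenius formula. For `N` at least the number of rows, let `l` be the sequence of shifted row
lengths and `D(l) = det (1 / (l_i - j)!)`. The identity `sum_detInvFact_lower` is a branching
recursion for `D`, so `dim λ` is proportional to `|λ|! D(l)`. The sum of the `D(l - k e_i)` over `i`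
satisfies the recursion of the `k`-cycles, and for `|λ| = k` a direct evaluation on hooks agrees
with the contents. Hence `k f_k(λ) D(l) = ∑ D(l - k e_i)` (`diagCyc_mul_detInvFact`).

Generating series. `D` is a Vandermonde determinant up to factorials, so after division by `D(l)`
the sum becomes a divided difference of a product of linear factors, that is, a coefficient of a
quotient of products of factors `1 - a z` (`sum_prod_div_eq_coeff`). Taking logarithms and comparing
with the empty diagram removes `N` and leaves `-k² f_k = [z^(k+1)] c(z) exp (L(z))`, where `c` has
constant coefficients and `L` is linear in the power sums (`diagCyc_eq_coeff`). As this holds at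
every `λ`, it also shows that `f_k` is shifted symmetric.

Weights. Give `z^n` the allowance `n`. Then `L` agrees with `k log P`, and `c` with `1`, up to terms
of weight two below the allowance: the terms one below vanish because the half-integer shift makes
everything symmetric under `k ↦ -k` or under negation of the roots. So replacing `c exp L` by `P^k`
changes `[z^(k+1)]` only by weight at most `k - 1` (`cycleFun_sub_mem`). Expanding the exponential
over partitions gives the explicit sum (`topTerm_eq`). -/

instance : Module.Finite ℂ (MonoidAlgebra ℂ G) :=
  Module.Finite.of_basis (MonoidAlgebra.basis G ℂ)

/-- In the basis of group elements every diagonal entry of left multiplication by `w` is the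
coefficient of `w` at `1`. -/
theorem trace_mulLeft (w : MonoidAlgebra ℂ G) :
    LinearMap.trace ℂ _ (LinearMap.mulLeft ℂ w) = Fintype.card G * w.coeff 1 := by
  classical
  rw [LinearMap.trace_eq_matrix_trace ℂ (MonoidAlgebra.basis G ℂ), Matrix.trace]
  have : ∀ g : G, (LinearMap.toMatrix (MonoidAlgebra.basis G ℂ) (MonoidAlgebra.basis G ℂ)
      (LinearMap.mulLeft ℂ w)).diag g = w.coeff 1 := by
    intro g
    rw [Matrix.diag_apply, LinearMap.toMatrix_apply]
    simp only [MonoidAlgebra.basis_apply, LinearMap.mulLeft_apply]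
    change (w * MonoidAlgebra.single g 1).coeff g = _
    simp
  simp only [this, Finset.sum_const, Finset.card_univ, nsmul_eq_mul]

/-- A nilpotent operator has trace zero. This stands in for the semisimplicity of the group algebra
in what follows. -/
theorem coeff_one_eq_zero_of_isNilpotent {w : MonoidAlgebra ℂ G} (hw : IsNilpotent w) :
    w.coeff 1 = 0 := by
  have h1 : IsNilpotent (LinearMap.mulLeft ℂ w) := by
    obtain ⟨n, hn⟩ := hw
    exact ⟨n, by rw [LinearMap.pow_mulLeft, hn]; simp⟩
  have h2 := (LinearMap.isNilpotent_trace_of_isNilpotent h1).eq_zero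
  rw [trace_mulLeft] at h2
  simpa using h2

theorem eq_zero_of_forall_coeff_one {v : MonoidAlgebra ℂ G}
    (h : ∀ y : MonoidAlgebra ℂ G, (y * v).coeff 1 = 0) : v = 0 := by
  ext g
  have := h (MonoidAlgebra.single g⁻¹ 1)
  simpa using this

/-- The left ideal generated by `e`, as a complex vector space. -/
def leftIdeal (e : MonoidAlgebra ℂ G) : Submodule ℂ (MonoidAlgebra ℂ G) :=
  LinearMap.range (LinearMap.mulRight ℂ e)

theorem mem_leftIdeal {e v : MonoidAlgebra ℂ G} : v ∈ leftIdeal e ↔ ∃ x, x * e = v := Iff.rfl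

theorem mul_mem_leftIdeal {e v : MonoidAlgebra ℂ G} (y : MonoidAlgebra ℂ G)
    (hv : v ∈ leftIdeal e) : y * v ∈ leftIdeal e := by
  obtain ⟨x, rfl⟩ := hv
  exact ⟨y * x, by simp [mul_assoc]⟩

/-- Left multiplication by `y` on the left ideal generated by `e`. -/
def leftAction (e y : MonoidAlgebra ℂ G) : leftIdeal e →ₗ[ℂ] leftIdeal e :=
  (LinearMap.mulLeft ℂ y).restrict fun _ hv => mul_mem_leftIdeal y hv

@[simp]
theorem coe_leftAction (e y : MonoidAlgebra ℂ G) (v : leftIdeal e) :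
    (leftAction e y v : MonoidAlgebra ℂ G) = y * v := rfl

/-- The trace of `y` on the left ideal generated by `e`. -/
def idealTrace (e : MonoidAlgebra ℂ G) : MonoidAlgebra ℂ G →ₗ[ℂ] ℂ where
  toFun y := LinearMap.trace ℂ _ (leftAction e y)
  map_add' y z := by
    rw [← map_add]
    congr 1
    ext v
    simp [add_mul]
  map_smul' c y := by
    rw [RingHom.id_apply, ← map_smul]
    congr 1
    ext v
    simp

theorem idealTrace_mul_comm (e y z : MonoidAlgebra ℂ G) :
    idealTrace e (y * z) = idealTrace e (z * y) := by
  have h : ∀ y z, leftAction e (y * z) = leftAction e y * leftAction e z := by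
    intro y z
    ext v
    simp [mul_assoc]
  change LinearMap.trace ℂ _ _ = LinearMap.trace ℂ _ _
  rw [h, h, LinearMap.trace_mul_comm]

theorem idealTrace_conj (e : MonoidAlgebra ℂ G) {g h : G} (hgh : IsConj g h) :
    idealTrace e (MonoidAlgebra.single g 1) = idealTrace e (MonoidAlgebra.single h 1) := by
  obtain ⟨c, rfl⟩ := isConj_iff.1 hgh
  have : (MonoidAlgebra.single (c * g * c⁻¹) 1 : MonoidAlgebra ℂ G) =
      MonoidAlgebra.single (c * g) 1 * MonoidAlgebra.single c⁻¹ 1 := by simp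
  rw [this, idealTrace_mul_comm]
  simp

/-- As `z` is central, `z (x e) = x (z e) = c (x e)`, so `z` is the scalar `c` on the whole left
ideal. -/
theorem idealTrace_of_scalar {e z : MonoidAlgebra ℂ G} {c : ℂ} (hz : ∀ x, z * x = x * z)
    (h : z * e = c • e) : idealTrace e z = c * Module.finrank ℂ (leftIdeal e) := by
  have : leftAction e z = c • LinearMap.id := by
    ext ⟨v, x, rfl⟩ : 2
    simp only [coe_leftAction, LinearMap.mulRight_apply, LinearMap.smul_apply, LinearMap.id_apply,
      Submodule.coe_smul]
    rw [← mul_assoc, hz, mul_assoc, h, mul_smul_comm]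
  change LinearMap.trace ℂ _ (leftAction e z) = _
  rw [this, map_smul, LinearMap.trace_id, smul_eq_mul]

/-- Right multiplication is injective on a minimal left ideal, unless it is zero. -/
theorem eq_zero_of_mul_eq_zero {e u v : MonoidAlgebra ℂ G}
    (he : ∀ x, ∃ c : ℂ, e * x * e = c • e) (hu : e * u ≠ 0) (hv : v ∈ leftIdeal e)
    (hvu : v * u = 0) : v = 0 := by
  obtain ⟨x, rfl⟩ := hv
  rw [LinearMap.mulRight_apply] at hvu ⊢
  refine eq_zero_of_forall_coeff_one fun y => coeff_one_eq_zero_of_isNilpotent ⟨2, ?_⟩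
  obtain ⟨c, hc⟩ := he (y * x)
  -- If `c ≠ 0`, then `c (e u) = e y (x e u) = 0` contradicts `hu`. With `c = 0` the element `y x e`
  -- has square zero for every `y`.
  have hc0 : c = 0 := by
    by_contra hne
    refine hu ?_
    have h1 : c • (e * u) = e * y * (x * e * u) := by
      rw [← smul_mul_assoc, ← hc]
      simp only [mul_assoc]
    rw [hvu, mul_zero] at h1
    exact (smul_eq_zero.1 h1).resolve_left hne
  rw [hc0, zero_smul] at hc
  calc (y * (x * e)) ^ 2 = y * x * (e * (y * x) * e) := by rw [sq]; simp only [mul_assoc]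
    _ = 0 := by rw [hc, mul_zero]

end GroupAlgebra

end

noncomputable section

/-! ### Young symmetrizers of tableaux -/

open Equiv (Perm)

section Tableau

variable {α : Type} [Fintype α] [DecidableEq α]

/-- `T` is a bijective filling of `lam` by the labels in `α`, given by the positions of the
labels. -/
structure IsTableau (lam : YoungDiagram) (T : α → ℕ × ℕ) : Prop where
  injective : Function.Injective T
  mem_iff : ∀ c, c ∈ lam ↔ ∃ a, T a = c

theorem IsTableau.mem {lam : YoungDiagram} {T : α → ℕ × ℕ} (hT : IsTableau lam T) (a : α) :
    T a ∈ lam := (hT.mem_iff _).2 ⟨a, rfl⟩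

/-- The permutations of the labels that preserve every row. -/
def rowStab (T : α → ℕ × ℕ) : Finset (Perm α) :=
  Finset.univ.filter fun s => ∀ a, (T (s a)).1 = (T a).1

/-- The permutations of the labels that preserve every column. -/
def colStab (T : α → ℕ × ℕ) : Finset (Perm α) :=
  Finset.univ.filter fun s => ∀ a, (T (s a)).2 = (T a).2

@[simp]
theorem mem_rowStab {T : α → ℕ × ℕ} {s : Perm α} :
    s ∈ rowStab T ↔ ∀ a, (T (s a)).1 = (T a).1 := by simp [rowStab]

@[simp]
theorem mem_colStab {T : α → ℕ × ℕ} {s : Perm α} :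
    s ∈ colStab T ↔ ∀ a, (T (s a)).2 = (T a).2 := by simp [colStab]

/-- The sign of a permutation as a complex number. -/
def csign (s : Perm α) : ℂ := ((Equiv.Perm.sign s : ℤ) : ℂ)

@[simp] theorem csign_one : csign (1 : Perm α) = 1 := by simp [csign]

theorem csign_mul (s t : Perm α) : csign (s * t) = csign s * csign t := by simp [csign]

theorem csign_mul_self (s : Perm α) : csign s * csign s = 1 := by
  rw [csign, ← Int.cast_mul, ← Units.val_mul, Int.units_mul_self]
  simp

theorem csign_swap {a b : α} (h : a ≠ b) : csign (Equiv.swap a b) = -1 := by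
  simp [csign, Equiv.Perm.sign_swap h]

/-- The row symmetrizer of a tableau. -/
def rowSymm (T : α → ℕ × ℕ) : MonoidAlgebra ℂ (Perm α) :=
  ∑ p ∈ rowStab T, MonoidAlgebra.single p (1 : ℂ)

/-- The column antisymmetrizer of a tableau. -/
def colSymm (T : α → ℕ × ℕ) : MonoidAlgebra ℂ (Perm α) :=
  ∑ q ∈ colStab T, MonoidAlgebra.single q (csign q)

/-- The Young symmetrizer of a tableau. -/
def tabSymm (T : α → ℕ × ℕ) : MonoidAlgebra ℂ (Perm α) := rowSymm T * colSymm T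

theorem coeff_tabSymm (T : α → ℕ × ℕ) (g : Perm α) :
    (tabSymm T).coeff g =
      ∑ x ∈ rowStab T ×ˢ colStab T, if x.1 * x.2 = g then csign x.2 else 0 := by
  simp [tabSymm, rowSymm, colSymm, Finset.sum_mul_sum, Finset.sum_product,
    MonoidAlgebra.coeff_sum, MonoidAlgebra.single_mul_single, MonoidAlgebra.coeff_single,
    Finsupp.single_apply]

theorem single_mul_rowSymm {T : α → ℕ × ℕ} {p : Perm α} (hp : p ∈ rowStab T) :
    MonoidAlgebra.single p 1 * rowSymm T = rowSymm T := by
  rw [rowSymm, Finset.mul_sum]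
  simp only [MonoidAlgebra.single_mul_single, mul_one]
  rw [mem_rowStab] at hp
  refine Finset.sum_nbij' (fun s => p * s) (fun s => p⁻¹ * s) ?_ ?_ (by simp) (by simp) (by simp)
  · intro s hs
    rw [mem_rowStab] at hs ⊢
    intro a
    rw [Perm.mul_apply, hp, hs]
  · intro s hs
    rw [mem_rowStab] at hs ⊢
    intro a
    rw [Perm.mul_apply, ← hp, ← Perm.mul_apply, mul_inv_cancel, Perm.one_apply, hs]

theorem colSymm_mul_single {T : α → ℕ × ℕ} {q : Perm α} (hq : q ∈ colStab T) :
    colSymm T * MonoidAlgebra.single q 1 = csign q • colSymm T := by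
  rw [colSymm, Finset.sum_mul, Finset.smul_sum]
  simp only [MonoidAlgebra.single_mul_single, mul_one]
  rw [mem_colStab] at hq
  refine Finset.sum_nbij' (fun s => s * q) (fun s => s * q⁻¹) ?_ ?_ (by simp) (by simp) ?_
  · intro s hs
    rw [mem_colStab] at hs ⊢
    intro a
    rw [Perm.mul_apply, hs, hq]
  · intro s hs
    rw [mem_colStab] at hs ⊢
    intro a
    rw [Perm.mul_apply, hs, ← hq, ← Perm.mul_apply, mul_inv_cancel, Perm.one_apply]
  · intro s _
    simp only [MonoidAlgebra.smul_single, smul_eq_mul, csign_mul]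
    rw [mul_left_comm, csign_mul_self, mul_one]

theorem single_mul_tabSymm {T : α → ℕ × ℕ} {p : Perm α} (hp : p ∈ rowStab T) :
    MonoidAlgebra.single p 1 * tabSymm T = tabSymm T := by
  rw [tabSymm, ← mul_assoc, single_mul_rowSymm hp]

theorem tabSymm_mul_single {T : α → ℕ × ℕ} {q : Perm α} (hq : q ∈ colStab T) :
    tabSymm T * MonoidAlgebra.single q 1 = csign q • tabSymm T := by
  rw [tabSymm, mul_assoc, colSymm_mul_single hq, mul_smul_comm]

/-- If a row and a column permutation cancel at a label then both fix it. -/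
theorem fixed_of_mul_apply_eq {T : α → ℕ × ℕ} (hT : Function.Injective T) {p q : Perm α}
    (hp : p ∈ rowStab T) (hq : q ∈ colStab T) {a : α} (h : p (q a) = a) :
    q a = a ∧ p a = a := by
  rw [mem_rowStab] at hp
  rw [mem_colStab] at hq
  have h1 : q a = a := by
    refine hT (Prod.ext ?_ (hq a))
    rw [← hp (q a), h]
  exact ⟨h1, by rwa [h1] at h⟩

/-- Only `p = q = 1` contributes: if `p q = 1` then `p` and `q` cancel at every label, so both fix
every label. -/
theorem coeff_tabSymm_one {T : α → ℕ × ℕ} (hT : Function.Injective T) :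
    (tabSymm T).coeff 1 = 1 := by
  rw [coeff_tabSymm, Finset.sum_eq_single (1, 1)]
  · simp
  · rintro ⟨p, q⟩ hx hne
    rw [if_neg]
    intro h
    rw [Finset.mem_product] at hx
    refine hne ?_
    have := fun a => fixed_of_mul_apply_eq hT hx.1 hx.2
      (a := a) (by rw [← Perm.mul_apply, h, Perm.one_apply])
    ext a
    · simp [(this a).2]
    · simp [(this a).1]
  · simp

/-- Passing from the initial segment of length `n` to `R` trades elements below `n` for equally many
that are at least `n`. -/
theorem sum_range_lt_sum {R : Finset ℕ} (h : R ≠ Finset.range R.card) :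
    ∑ i ∈ Finset.range R.card, i < ∑ i ∈ R, i := by
  set n := R.card with hn
  have hc : (R \ Finset.range n).card = (Finset.range n \ R).card := by
    have h1 := Finset.card_sdiff_add_card_inter R (Finset.range n)
    have h2 := Finset.card_sdiff_add_card_inter (Finset.range n) R
    rw [Finset.inter_comm, Finset.card_range] at h2
    omega
  have hne : (R \ Finset.range n).Nonempty := by
    rw [Finset.nonempty_iff_ne_empty]
    intro he
    exact h (Finset.eq_of_subset_of_card_le (Finset.sdiff_eq_empty_iff_subset.1 he)
      (by rw [Finset.card_range]))
  have h1 : (R \ Finset.range n).card * n ≤ ∑ i ∈ R \ Finset.range n, i := by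
    rw [← smul_eq_mul]
    exact Finset.card_nsmul_le_sum _ _ _ fun i hi => by simpa using (Finset.mem_sdiff.1 hi).2
  have h2 : ∑ i ∈ Finset.range n \ R, i < (Finset.range n \ R).card * n := by
    rw [← smul_eq_mul, ← Finset.sum_const]
    refine Finset.sum_lt_sum_of_nonempty ?_ fun i hi => by simpa using (Finset.mem_sdiff.1 hi).1
    rw [← Finset.card_pos, ← hc]
    exact hne.card_pos
  have h3 := Finset.sum_inter_add_sum_sdiff R (Finset.range n) (fun i => i)
  have h4 := Finset.sum_inter_add_sum_sdiff (Finset.range n) R (fun i => i)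
  rw [Finset.inter_comm] at h4
  rw [hc] at h1
  omega

theorem sum_range_le_sum (R : Finset ℕ) : ∑ i ∈ Finset.range R.card, i ≤ ∑ i ∈ R, i := by
  by_cases h : R = Finset.range R.card
  · rw [← h]
  · exact (sum_range_lt_sum h).le

/-- If the elements of each row of a tableau lie in distinct columns of another tableau of the
same shape, then combining the rows of the first with the columns of the second fills the
diagram. -/
theorem mk_mem_of_injective {lam : YoungDiagram} {T : α → ℕ × ℕ} (hT : IsTableau lam T)
    (g : Perm α) (hU : Function.Injective fun a => ((T a).1, (T (g a)).2)) (a : α) :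
    ((T a).1, (T (g a)).2) ∈ lam := by
  classical
  -- `S j` collects the labels in column `j` of `T ∘ g`, and `R j` the rows of `T` that they occupy.
  -- By `hU` these rows are distinct, so `R j` is as large as column `j` of `lam`; it remains to see
  -- that it is an initial segment.
  let S : ℕ → Finset α := fun j => Finset.univ.filter fun a => (T (g a)).2 = j
  let R : ℕ → Finset ℕ := fun j => (S j).image fun a => (T a).1
  have hinj : ∀ j, Set.InjOn (fun a => (T a).1) (S j) := by
    intro j a ha b hb hab
    simp only [S, Finset.coe_filter, Finset.mem_univ, true_and, Set.mem_ofPred_eq] at ha hb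
    exact hU (Prod.ext hab (ha.trans hb.symm))
  have hcard : ∀ j, (R j).card = lam.colLen j := by
    intro j
    rw [Finset.card_image_of_injOn (hinj j), YoungDiagram.colLen_eq_card]
    refine Finset.card_bij (fun a _ => T (g a)) ?_ ?_ ?_
    · intro a ha
      rw [YoungDiagram.mem_col_iff]
      exact ⟨hT.mem _, by simpa [S] using ha⟩
    · intro a _ b _ h
      exact g.injective (hT.injective h)
    · intro c hc
      rw [YoungDiagram.mem_col_iff] at hc
      obtain ⟨b, rfl⟩ := (hT.mem_iff c).1 hc.1
      exact ⟨g⁻¹ b, by simpa [S] using hc.2, by simp⟩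
  let J : Finset ℕ := Finset.univ.image fun a => (T (g a)).2
  -- The sets `R j` and the initial segments of the same sizes both sum to the total of the row
  -- indices of all boxes. Since an initial segment is the unique minimiser of the sum, every `R j`
  -- is one.
  have hsum1 : ∑ j ∈ J, ∑ i ∈ R j, i = ∑ a, (T a).1 := by
    rw [← Finset.sum_fiberwise_of_maps_to (g := fun a => (T (g a)).2) (t := J)
      (fun a _ => Finset.mem_image_of_mem _ (Finset.mem_univ a))]
    exact Finset.sum_congr rfl fun j _ => Finset.sum_image (hinj j)
  have hsum2 : ∑ j ∈ J, ∑ i ∈ Finset.range (R j).card, i = ∑ a, (T a).1 := by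
    rw [← Equiv.sum_comp g, ← Finset.sum_fiberwise_of_maps_to (g := fun a => (T (g a)).2) (t := J)
      (fun a _ => Finset.mem_image_of_mem _ (Finset.mem_univ a))]
    refine Finset.sum_congr rfl fun j _ => ?_
    rw [hcard]
    symm
    refine Finset.sum_nbij (fun a => (T (g a)).1) ?_ ?_ ?_ (fun _ _ => rfl)
    · intro a ha
      have : (T (g a)).2 = j := by simpa using ha
      rw [Finset.mem_range, ← YoungDiagram.mem_iff_lt_colLen, ← this]
      exact hT.mem _
    · intro a ha b hb hab
      have ha' : (T (g a)).2 = j := by simpa using ha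
      have hb' : (T (g b)).2 = j := by simpa using hb
      exact g.injective (hT.injective (Prod.ext hab (ha'.trans hb'.symm)))
    · intro i hi
      rw [Finset.mem_coe, Finset.mem_range, ← YoungDiagram.mem_iff_lt_colLen, hT.mem_iff] at hi
      obtain ⟨b, hb⟩ := hi
      exact ⟨g⁻¹ b, by simp [hb], by simp [hb]⟩
  have hR : ∀ j ∈ J, R j = Finset.range (R j).card := by
    by_contra! hcon
    obtain ⟨j, hj, hne⟩ := hcon
    have := Finset.sum_lt_sum (fun j _ => sum_range_le_sum (R j)) ⟨j, hj, sum_range_lt_sum hne⟩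
    omega
  rw [YoungDiagram.mem_iff_lt_colLen, ← Finset.mem_range, ← hcard,
    ← hR _ (Finset.mem_image_of_mem _ (Finset.mem_univ a))]
  exact Finset.mem_image_of_mem _ (by simp [S])

/-- A permutation is either a product of a row and a column permutation, or some transposition
in the row group is conjugated by it to the column group. -/
theorem exists_mul_or_exists_swap {lam : YoungDiagram} {T : α → ℕ × ℕ} (hT : IsTableau lam T)
    (g : Perm α) : (∃ p ∈ rowStab T, ∃ q ∈ colStab T, g = p * q) ∨
      ∃ a b, a ≠ b ∧ Equiv.swap a b ∈ rowStab T ∧ Equiv.swap (g⁻¹ a) (g⁻¹ b) ∈ colStab T := by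
  by_cases hU : Function.Injective fun a => ((T a).1, (T (g⁻¹ a)).2)
  · left
    have hmem := fun a => (hT.mem_iff _).1 (mk_mem_of_injective hT g⁻¹ hU a)
    choose f hf using hmem
    have hfi : Function.Injective f := by
      intro a b hab
      refine hU ?_
      simp only
      rw [← hf a, ← hf b, hab]
    -- `s a` is the label at the box in the row of `a` and the column of `g⁻¹ a`. So `s` preserves
    -- rows, `s g` preserves columns, and `g = s⁻¹ (s g)`.
    let s : Perm α := Equiv.ofBijective f (Finite.injective_iff_bijective.1 hfi)
    have hs : ∀ a, T (s a) = ((T a).1, (T (g⁻¹ a)).2) := hf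
    refine ⟨s⁻¹, ?_, s * g, ?_, by simp⟩
    · rw [mem_rowStab]
      intro a
      have := hs (s⁻¹ a)
      rw [← Perm.mul_apply, mul_inv_cancel, Perm.one_apply] at this
      rw [this]
    · rw [mem_colStab]
      intro a
      rw [Perm.mul_apply, hs]
      simp
  · right
    simp only [Function.Injective, not_forall] at hU
    obtain ⟨a, b, hab, hne⟩ := hU
    rw [Prod.mk.injEq] at hab
    refine ⟨a, b, hne, ?_, ?_⟩
    · rw [mem_rowStab]
      intro c
      rw [Equiv.swap_apply_def]
      split_ifs with h1 h2
      · rw [h1, hab.1]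
      · rw [h2, hab.1]
      · rfl
    · rw [mem_colStab]
      intro c
      rw [Equiv.swap_apply_def]
      split_ifs with h1 h2
      · rw [h1, hab.2]
      · rw [h2, hab.2]
      · rfl

/-- An element with the same invariance as the Young symmetrizer is a multiple of it. -/
theorem eq_smul_tabSymm {lam : YoungDiagram} {T : α → ℕ × ℕ} (hT : IsTableau lam T)
    {x : MonoidAlgebra ℂ (Perm α)} (hrow : ∀ p ∈ rowStab T, MonoidAlgebra.single p 1 * x = x)
    (hcol : ∀ q ∈ colStab T, x * MonoidAlgebra.single q 1 = csign q • x) :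
    x = x.coeff 1 • tabSymm T := by
  -- Subtracting the multiple of the symmetrizer, whose coefficient at `1` is `1`, reduces to
  -- elements with vanishing coefficient at `1`.
  suffices h : ∀ x : MonoidAlgebra ℂ (Perm α),
      (∀ p ∈ rowStab T, MonoidAlgebra.single p 1 * x = x) →
      (∀ q ∈ colStab T, x * MonoidAlgebra.single q 1 = csign q • x) → x.coeff 1 = 0 → x = 0 by
    rw [← sub_eq_zero]
    refine h _ (fun p hp => ?_) (fun q hq => ?_) ?_
    · rw [mul_sub, mul_smul_comm, hrow p hp, single_mul_tabSymm hp]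
    · rw [sub_mul, smul_mul_assoc, hcol q hq, tabSymm_mul_single hq, smul_sub, smul_comm]
    · simp [coeff_tabSymm_one hT.injective]
  clear hrow hcol x
  intro x hrow hcol h1
  have hr : ∀ p ∈ rowStab T, ∀ g, x.coeff (p⁻¹ * g) = x.coeff g := by
    intro p hp g
    have := congrArg (fun y => y.coeff g) (hrow p hp)
    simpa using this
  have hc : ∀ q ∈ colStab T, ∀ g, x.coeff (g * q⁻¹) = csign q * x.coeff g := by
    intro q hq g
    have := congrArg (fun y => y.coeff g) (hcol q hq)
    simpa using this
  ext g
  rcases exists_mul_or_exists_swap hT g with ⟨p, hp, q, hq, rfl⟩ | ⟨a, b, hab, hp, hq⟩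
  · have e1 := hr p hp (p * q)
    rw [inv_mul_cancel_left] at e1
    have e2 := hc q hq q
    rw [mul_inv_cancel, h1] at e2
    have : csign q ≠ 0 := left_ne_zero_of_mul_eq_one (csign_mul_self q)
    rw [← e1]
    simpa [this] using e2.symm
  -- With `t` the row transposition and `t' = g⁻¹ t g` the column one, `t g = g t'`; so the
  -- coefficient at `g` equals its own negative.
  · have e1 := hr _ hp g
    have e2 := hc _ hq g
    rw [Equiv.swap_inv] at e1 e2
    have hab' : g⁻¹ a ≠ g⁻¹ b := fun h => hab (g⁻¹.injective h)
    rw [csign_swap hab'] at e2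
    have : g * Equiv.swap (g⁻¹ a) (g⁻¹ b) = Equiv.swap a b * g := by
      rw [Equiv.swap_apply_apply]
      simp [mul_assoc]
    rw [this, e1] at e2
    simp only [MonoidAlgebra.coeff_zero, Finsupp.coe_zero, Pi.zero_apply]
    linear_combination (1 / 2 : ℂ) * e2

/-- The product is row-invariant on the left and column-alternating on the right, and such elements
form a line. This is the form in which minimality of the left ideal is used. -/
theorem tabSymm_mul_mul_tabSymm {lam : YoungDiagram} {T : α → ℕ × ℕ} (hT : IsTableau lam T)
    (x : MonoidAlgebra ℂ (Perm α)) :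
    tabSymm T * x * tabSymm T = (tabSymm T * x * tabSymm T).coeff 1 • tabSymm T := by
  refine eq_smul_tabSymm hT (fun p hp => ?_) (fun q hq => ?_)
  · rw [← mul_assoc, ← mul_assoc, single_mul_tabSymm hp]
  · rw [mul_assoc, tabSymm_mul_single hq, mul_smul_comm]

theorem mul_tabSymm_of_central {lam : YoungDiagram} {T : α → ℕ × ℕ} (hT : IsTableau lam T)
    {z : MonoidAlgebra ℂ (Perm α)} (hz : ∀ x, z * x = x * z) :
    z * tabSymm T = (z * tabSymm T).coeff 1 • tabSymm T := by
  refine eq_smul_tabSymm hT (fun p hp => ?_) (fun q hq => ?_)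
  · rw [← mul_assoc, ← hz, mul_assoc, single_mul_tabSymm hp]
  · rw [mul_assoc, tabSymm_mul_single hq, mul_smul_comm]

/-- Otherwise the symmetrizer would be nilpotent, against its coefficient `1` at the identity. -/
theorem tabSymm_mul_self_ne_zero {lam : YoungDiagram} {T : α → ℕ × ℕ} (hT : IsTableau lam T) :
    tabSymm T * tabSymm T ≠ 0 := by
  intro h
  have := coeff_one_eq_zero_of_isNilpotent ⟨2, (sq (tabSymm T)).trans h⟩
  rw [coeff_tabSymm_one hT.injective] at this
  exact one_ne_zero this

/-- The square of a Young symmetrizer is a nonzero multiple of it. -/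
theorem exists_tabSymm_mul_self {lam : YoungDiagram} {T : α → ℕ × ℕ} (hT : IsTableau lam T) :
    ∃ c : ℂ, c ≠ 0 ∧ tabSymm T * tabSymm T = c • tabSymm T := by
  have h := tabSymm_mul_mul_tabSymm hT 1
  rw [mul_one] at h
  refine ⟨_, fun h0 => tabSymm_mul_self_ne_zero hT ?_, h⟩
  rw [h, h0, zero_smul]

end Tableau

end

noncomputable section

open Equiv (Perm)

/-! ### Invariance under relabelling -/

section Relabel

variable {G H : Type*} [Group G] [Fintype G] [Group H] [Fintype H]

theorem finrank_leftIdeal_map (f : MonoidAlgebra ℂ G ≃ₐ[ℂ] MonoidAlgebra ℂ H)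
    (e : MonoidAlgebra ℂ G) :
    Module.finrank ℂ (leftIdeal (f e)) = Module.finrank ℂ (leftIdeal e) := by
  have : leftIdeal (f e) = (leftIdeal e).map (f.toLinearEquiv : _ →ₗ[ℂ] MonoidAlgebra ℂ H) := by
    ext v
    simp only [Submodule.mem_map, mem_leftIdeal]
    constructor
    · rintro ⟨x, rfl⟩
      exact ⟨f.symm x * e, ⟨_, rfl⟩, by simp⟩
    · rintro ⟨_, ⟨x, rfl⟩, rfl⟩
      exact ⟨f x, by simp⟩
  rw [this]
  exact LinearEquiv.finrank_map_eq f.toLinearEquiv (leftIdeal e)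

end Relabel

section Relabel

variable {α β : Type} [Fintype α] [DecidableEq α] [Fintype β] [DecidableEq β]

/-- The isomorphism of group algebras induced by a relabelling. -/
def relabel (φ : β ≃ α) : MonoidAlgebra ℂ (Perm β) ≃ₐ[ℂ] MonoidAlgebra ℂ (Perm α) :=
  MonoidAlgebra.domCongr ℂ ℂ φ.permCongrHom

@[simp]
theorem relabel_single (φ : β ≃ α) (g : Perm β) (c : ℂ) :
    relabel φ (MonoidAlgebra.single g c) = MonoidAlgebra.single (φ.permCongr g) c := by
  simp [relabel]

theorem relabel_coeff (φ : β ≃ α) (x : MonoidAlgebra ℂ (Perm β)) (g : Perm β) :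
    (relabel φ x).coeff (φ.permCongr g) = x.coeff g := by
  induction x using MonoidAlgebra.induction_linear with
  | zero => simp
  | add x y hx hy => simp [hx, hy]
  | single h c =>
    classical
    rw [relabel_single, MonoidAlgebra.coeff_single, MonoidAlgebra.coeff_single,
      Finsupp.single_apply, Finsupp.single_apply]
    simp

theorem relabel_coeff_one (φ : β ≃ α) (x : MonoidAlgebra ℂ (Perm β)) :
    (relabel φ x).coeff 1 = x.coeff 1 := by
  rw [← relabel_coeff φ]
  congr 1
  ext a
  simp [Equiv.permCongr_apply]

theorem relabel_tabSymm (φ : β ≃ α) (T : α → ℕ × ℕ) :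
    relabel φ (tabSymm (T ∘ φ)) = tabSymm T := by
  rw [tabSymm, map_mul, tabSymm]
  congr 1
  · rw [rowSymm, rowSymm, map_sum]
    simp only [relabel_single]
    refine Finset.sum_nbij' (φ.permCongr) (φ.permCongr.symm) ?_ ?_ (fun _ _ => Equiv.symm_apply_apply _ _)
      (fun _ _ => Equiv.apply_symm_apply _ _) (by simp)
    · intro s hs
      rw [mem_rowStab] at hs ⊢
      intro a
      simpa [Equiv.permCongr_apply] using hs (φ.symm a)
    · intro s hs
      rw [mem_rowStab] at hs ⊢
      intro a
      simpa [Equiv.permCongr_symm] using hs (φ a)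
  · rw [colSymm, colSymm, map_sum]
    simp only [relabel_single]
    refine Finset.sum_nbij' (φ.permCongr) (φ.permCongr.symm) ?_ ?_ (fun _ _ => Equiv.symm_apply_apply _ _)
      (fun _ _ => Equiv.apply_symm_apply _ _) ?_
    · intro s hs
      rw [mem_colStab] at hs ⊢
      intro a
      simpa [Equiv.permCongr_apply] using hs (φ.symm a)
    · intro s hs
      rw [mem_colStab] at hs ⊢
      intro a
      simpa [Equiv.permCongr_symm] using hs (φ a)
    · intro s _
      simp [csign, Equiv.Perm.sign_permCongr]

theorem relabel_perm_mul (π : Perm α) (x : MonoidAlgebra ℂ (Perm α)) :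
    relabel π x * MonoidAlgebra.single π 1 = MonoidAlgebra.single π 1 * x := by
  induction x using MonoidAlgebra.induction_linear with
  | zero => simp
  | add x y hx hy => simp [add_mul, mul_add, hx, hy]
  | single h c =>
    rw [relabel_single, MonoidAlgebra.single_mul_single, MonoidAlgebra.single_mul_single]
    congr 1
    · ext a
      simp
    · simp

/-- Tableaux that differ by a permutation of the labels have conjugate Young symmetrizers. -/
theorem tabSymm_mul_single_perm (π : Perm α) (T : α → ℕ × ℕ) :
    tabSymm T * MonoidAlgebra.single π 1 = MonoidAlgebra.single π 1 * tabSymm (T ∘ π) := by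
  rw [← relabel_perm_mul, relabel_tabSymm]

theorem cycleType_permCongr (φ : β ≃ α) (g : Perm β) :
    (φ.permCongr g).cycleType = g.cycleType := by
  have h : φ.permCongr g =
      g.extendDomain (φ.trans (Equiv.subtypeUnivEquiv fun _ => trivial : {_a : α // True} ≃ α).symm) := by
    ext a
    rw [Equiv.Perm.extendDomain_apply_subtype _ _ trivial]
    simp [Equiv.permCongr_apply, Equiv.subtypeUnivEquiv]
  rw [h, Equiv.Perm.cycleType_extendDomain]

end Relabel

/-! ### Class sums of cycles -/

section CycSum

variable {α β : Type} [Fintype α] [DecidableEq α] [Fintype β] [DecidableEq β]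

variable (α) in
/-- The permutations with a single nontrivial cycle, of length `k`. -/
def cycles (k : ℕ) : Finset (Perm α) := Finset.univ.filter fun g => g.cycleType = {k}

@[simp]
theorem mem_cycles {k : ℕ} {g : Perm α} : g ∈ cycles α k ↔ g.cycleType = {k} := by simp [cycles]

variable (α) in
/-- The sum of the `k`-cycles in the group algebra. -/
def cycSum (k : ℕ) : MonoidAlgebra ℂ (Perm α) := ∑ g ∈ cycles α k, MonoidAlgebra.single g 1

theorem cycSum_coeff (k : ℕ) (g : Perm α) :
    (cycSum α k).coeff g = if g.cycleType = {k} then 1 else 0 := by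
  classical
  simp [cycSum, MonoidAlgebra.coeff_sum, MonoidAlgebra.coeff_single, Finsupp.single_apply]

theorem cycSum_central (k : ℕ) (x : MonoidAlgebra ℂ (Perm α)) :
    cycSum α k * x = x * cycSum α k := by
  induction x using MonoidAlgebra.induction_linear with
  | zero => simp
  | add x y hx hy => simp [add_mul, mul_add, hx, hy]
  | single h c =>
    ext g
    rw [MonoidAlgebra.coeff_mul_single_apply, MonoidAlgebra.coeff_single_mul_apply, cycSum_coeff,
      cycSum_coeff]
    have : (g * h⁻¹).cycleType = (h⁻¹ * g).cycleType := by
      rw [← Equiv.Perm.cycleType_conj (σ := h⁻¹ * g) (τ := h)]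
      group
    rw [this, mul_comm]

theorem relabel_cycSum (φ : β ≃ α) (k : ℕ) : relabel φ (cycSum β k) = cycSum α k := by
  ext g
  obtain ⟨h, rfl⟩ := φ.permCongr.surjective g
  rw [relabel_coeff, cycSum_coeff, cycSum_coeff, cycleType_permCongr]

/-- The scalar by which the sum of the `k`-cycles acts on the Young symmetrizer of `T`. -/
def cycScalar (k : ℕ) (T : α → ℕ × ℕ) : ℂ := (cycSum α k * tabSymm T).coeff 1

theorem cycSum_mul_tabSymm {lam : YoungDiagram} {T : α → ℕ × ℕ} (hT : IsTableau lam T) (k : ℕ) :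
    cycSum α k * tabSymm T = cycScalar k T • tabSymm T :=
  mul_tabSymm_of_central hT (cycSum_central k)

theorem cycScalar_comp (φ : β ≃ α) (k : ℕ) (T : α → ℕ × ℕ) :
    cycScalar k (T ∘ φ) = cycScalar k T := by
  rw [cycScalar, cycScalar, ← relabel_coeff_one φ, map_mul, relabel_tabSymm, relabel_cycSum]

/-- The tableau of the boxes labelled by themselves. -/
def boxTab (lam : YoungDiagram) : {c : ℕ × ℕ // c ∈ lam.cells} → ℕ × ℕ := Subtype.val

theorem isTableau_boxTab (lam : YoungDiagram) : IsTableau lam (boxTab lam) where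
  injective := Subtype.val_injective
  mem_iff c := by simp [boxTab]

/-- The dimension of the irreducible representation corresponding to `lam`. -/
def diagDim (lam : YoungDiagram) : ℕ := Module.finrank ℂ (leftIdeal (tabSymm (boxTab lam)))

/-- The eigenvalue of the sum of the `k`-cycles. -/
def diagCyc (k : ℕ) (lam : YoungDiagram) : ℂ := cycScalar k (boxTab lam)

theorem IsTableau.exists_equiv {lam : YoungDiagram} {T : α → ℕ × ℕ} (hT : IsTableau lam T) :
    ∃ φ : α ≃ {c : ℕ × ℕ // c ∈ lam.cells}, T = boxTab lam ∘ φ := by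
  refine ⟨Equiv.ofBijective (fun a => ⟨T a, hT.mem a⟩) ⟨?_, ?_⟩, ?_⟩
  · intro a b hab
    exact hT.injective (congrArg Subtype.val hab)
  · rintro ⟨c, hc⟩
    obtain ⟨a, rfl⟩ := (hT.mem_iff c).1 hc
    exact ⟨a, rfl⟩
  · rfl

theorem IsTableau.comp_equiv {lam : YoungDiagram} {T : α → ℕ × ℕ} (hT : IsTableau lam T)
    (φ : β ≃ α) : IsTableau lam (T ∘ φ) where
  injective := hT.injective.comp φ.injective
  mem_iff c := by
    rw [hT.mem_iff, φ.surjective.exists]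
    simp

theorem IsTableau.finrank_eq {lam : YoungDiagram} {T : α → ℕ × ℕ} (hT : IsTableau lam T) :
    Module.finrank ℂ (leftIdeal (tabSymm T)) = diagDim lam := by
  obtain ⟨φ, rfl⟩ := hT.exists_equiv
  rw [diagDim, ← relabel_tabSymm φ (boxTab lam), finrank_leftIdeal_map]

theorem IsTableau.cycScalar_eq {lam : YoungDiagram} {T : α → ℕ × ℕ} (hT : IsTableau lam T)
    (k : ℕ) : cycScalar k T = diagCyc k lam := by
  obtain ⟨φ, rfl⟩ := hT.exists_equiv
  rw [diagCyc, cycScalar_comp]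

theorem IsTableau.exists_of_card {lam : YoungDiagram} (h : Fintype.card α = lam.card) :
    ∃ T : α → ℕ × ℕ, IsTableau lam T := by
  have : Fintype.card α = Fintype.card {c : ℕ × ℕ // c ∈ lam.cells} := by
    rw [h, Fintype.card_coe]
  exact ⟨_, (isTableau_boxTab lam).comp_equiv (Fintype.equivOfCardEq this)⟩

theorem diagDim_pos (lam : YoungDiagram) : 0 < diagDim lam := by
  have hT := isTableau_boxTab lam
  rw [diagDim, Module.finrank_pos_iff, nontrivial_iff]
  refine ⟨⟨tabSymm (boxTab lam), 1, by simp⟩, 0, fun h => ?_⟩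
  have h1 : tabSymm (boxTab lam) = 0 := congrArg Subtype.val h
  have h2 := coeff_tabSymm_one hT.injective
  rw [h1] at h2
  simp at h2

end CycSum

/-! ### Restriction to the stabilizer of a label -/

section Option

variable {α : Type} [Fintype α] [DecidableEq α]

/-- The permutations of `α` as the stabilizer of `none` in the permutations of `Option α`. -/
def optionHom : Perm α →* Perm (Option α) where
  toFun g := g.optionCongr
  map_one' := Equiv.optionCongr_one
  map_mul' g h := by
    ext1 a
    cases a <;> simp

theorem optionHom_injective : Function.Injective (optionHom : Perm α → Perm (Option α)) :=
  Equiv.optionCongr_injective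

@[simp] theorem optionHom_some (g : Perm α) (a : α) : optionHom g (some a) = some (g a) := rfl

@[simp] theorem optionHom_none (g : Perm α) : optionHom g none = none := rfl

theorem exists_optionHom {g : Perm (Option α)} (h : g none = none) : ∃ s, optionHom s = g := by
  refine ⟨Equiv.removeNone g, ?_⟩
  change (Equiv.removeNone g).optionCongr = g
  rw [map_equiv_removeNone, h, Equiv.swap_self]
  rfl

theorem cycleType_optionHom (g : Perm α) : (optionHom g).cycleType = g.cycleType := by
  let f : α ≃ {x : Option α // x.isSome} :=
    { toFun := fun a => ⟨some a, rfl⟩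
      invFun := fun x => x.1.get x.2
      left_inv := fun _ => rfl
      right_inv := fun x => Subtype.ext (Option.some_get x.2) }
  have h : optionHom g = g.extendDomain f := by
    ext1 a
    cases a with
    | none => rw [Equiv.Perm.extendDomain_apply_not_subtype _ _ (by simp)]; rfl
    | some a => exact (Equiv.Perm.extendDomain_apply_image g f a).symm
  rw [h, Equiv.Perm.cycleType_extendDomain]

/-- The inclusion of the group algebra of the stabilizer of `none`. -/
def optionIncl : MonoidAlgebra ℂ (Perm α) →ₐ[ℂ] MonoidAlgebra ℂ (Perm (Option α)) :=
  MonoidAlgebra.mapDomainAlgHom ℂ ℂ optionHom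

@[simp]
theorem optionIncl_single (g : Perm α) (c : ℂ) :
    optionIncl (MonoidAlgebra.single g c) = MonoidAlgebra.single (optionHom g) c := by
  simp [optionIncl]

/-- The projection to the group algebra of the stabilizer of `none`. -/
def optionProj (x : MonoidAlgebra ℂ (Perm (Option α))) : MonoidAlgebra ℂ (Perm α) :=
  MonoidAlgebra.comapDomain optionHom optionHom_injective x

@[simp]
theorem coeff_optionProj (x : MonoidAlgebra ℂ (Perm (Option α))) (g : Perm α) :
    (optionProj x).coeff g = x.coeff (optionHom g) := by
  simp [optionProj]

/-- Multiplication by the stabilizer of `none` preserves both the stabilizer and its complement.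
Together with `optionProj_mul'`, the projection is a map of bimodules over the smaller group
algebra. -/
theorem optionProj_mul (y : MonoidAlgebra ℂ (Perm α)) (x : MonoidAlgebra ℂ (Perm (Option α))) :
    optionProj (optionIncl y * x) = y * optionProj x := by
  ext g
  induction y using MonoidAlgebra.induction_linear with
  | zero => simp
  | add y z hy hz => simpa [add_mul] using congrArg₂ (· + ·) hy hz
  | single h c => simp

theorem optionProj_mul' (y : MonoidAlgebra ℂ (Perm α)) (x : MonoidAlgebra ℂ (Perm (Option α))) :
    optionProj (x * optionIncl y) = optionProj x * y := by
  ext g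
  induction y using MonoidAlgebra.induction_linear with
  | zero => simp
  | add y z hy hz => simpa [mul_add] using congrArg₂ (· + ·) hy hz
  | single h c => simp

theorem optionHom_mem_rowStab {T : Option α → ℕ × ℕ} {s : Perm α} :
    optionHom s ∈ rowStab T ↔ s ∈ rowStab (T ∘ some) := by
  simp [Option.forall]

theorem optionHom_mem_colStab {T : Option α → ℕ × ℕ} {s : Perm α} :
    optionHom s ∈ colStab T ↔ s ∈ colStab (T ∘ some) := by
  simp [Option.forall]

/-- Projecting a Young symmetrizer to the stabilizer of a label removes this label. -/
theorem optionProj_tabSymm {T : Option α → ℕ × ℕ} (hT : Function.Injective T) :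
    optionProj (tabSymm T) = tabSymm (T ∘ some) := by
  ext g
  rw [coeff_optionProj, coeff_tabSymm, coeff_tabSymm]
  symm
  refine Finset.sum_of_injOn (fun x => (optionHom x.1, optionHom x.2)) ?_ ?_ ?_ ?_
  · rintro ⟨p, q⟩ _ ⟨p', q'⟩ _ h
    simp only [Prod.mk.injEq] at h
    exact Prod.ext (optionHom_injective h.1) (optionHom_injective h.2)
  · rintro ⟨p, q⟩ h
    rw [Finset.mem_coe, Finset.mem_product] at h ⊢
    exact ⟨optionHom_mem_rowStab.2 h.1, optionHom_mem_colStab.2 h.2⟩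
  · rintro ⟨p, q⟩ h hne
    rw [if_neg]
    intro hpq
    rw [Finset.mem_product] at h
    -- If `p q` fixes `none` then both factors do, so they come from row and column permutations of
    -- the smaller tableau.
    have hfix := fixed_of_mul_apply_eq hT h.1 h.2 (a := none)
      (by rw [← Perm.mul_apply, hpq, optionHom_none])
    obtain ⟨q', rfl⟩ := exists_optionHom hfix.1
    obtain ⟨p', rfl⟩ := exists_optionHom hfix.2
    refine hne ⟨(p', q'), ?_, rfl⟩
    rw [Finset.mem_coe, Finset.mem_product]
    exact ⟨optionHom_mem_rowStab.1 h.1, optionHom_mem_colStab.1 h.2⟩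
  · rintro ⟨p, q⟩ _
    simp only [← map_mul, optionHom_injective.eq_iff]
    have : csign (optionHom q) = csign q := by
      rw [csign, csign]
      exact congrArg (fun u : ℤˣ => ((u : ℤ) : ℂ)) (Equiv.optionCongr_sign q)
    rw [this]

end Option

end

noncomputable section

open Equiv (Perm)

/-! ### Contents and the Jucys–Murphy element -/

section Content

variable {α : Type} [Fintype α] [DecidableEq α]

/-- A permutation that moves no label besides `a` and `b`. -/
theorem eq_one_or_eq_swap {g : Perm α} {a b : α} (h : ∀ c, c ≠ a → c ≠ b → g c = c) :
    g = 1 ∨ g = Equiv.swap a b := by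
  have key : ∀ c, c ≠ a → c ≠ b → g a ≠ c ∧ g b ≠ c := by
    intro c hca hcb
    refine ⟨fun e => hca ?_, fun e => hcb ?_⟩
    · exact g.injective ((h c hca hcb).trans e.symm)
    · exact g.injective ((h c hca hcb).trans e.symm)
  have ha : g a = a ∨ g a = b := by
    by_contra! hc
    exact (key _ hc.1 hc.2).1 rfl
  have hb : g b = a ∨ g b = b := by
    by_contra! hc
    exact (key _ hc.1 hc.2).2 rfl
  by_cases hab : a = b
  · subst hab
    left
    ext c
    by_cases hc : c = a
    · subst hc; simpa using ha
    · exact h c hc hc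
  rcases ha with ha | ha
  · left
    have hb' : g b = b := hb.resolve_left fun e => hab (g.injective (ha.trans e.symm))
    ext c
    by_cases hca : c = a
    · rw [hca, ha]; rfl
    by_cases hcb : c = b
    · rw [hcb, hb']; rfl
    exact h c hca hcb
  · right
    have hb' : g b = a := hb.resolve_right fun e => hab (g.injective (ha.trans e.symm))
    ext c
    by_cases hca : c = a
    · rw [hca, ha, Equiv.swap_apply_left]
    by_cases hcb : c = b
    · rw [hcb, hb', Equiv.swap_apply_right]
    rw [h c hca hcb, Equiv.swap_apply_of_ne_of_ne hca hcb]

theorem swap_mem_rowStab {T : α → ℕ × ℕ} {a b : α} :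
    Equiv.swap a b ∈ rowStab T ↔ (T a).1 = (T b).1 := by
  rw [mem_rowStab]
  constructor
  · intro h
    simpa using h b
  · intro h c
    rw [Equiv.swap_apply_def]
    split_ifs with h1 h2
    · rw [h1, h]
    · rw [h2, h]
    · rfl

theorem swap_mem_colStab {T : α → ℕ × ℕ} {a b : α} :
    Equiv.swap a b ∈ colStab T ↔ (T a).2 = (T b).2 := by
  rw [mem_colStab]
  constructor
  · intro h
    simpa using h b
  · intro h c
    rw [Equiv.swap_apply_def]
    split_ifs with h1 h2
    · rw [h1, h]
    · rw [h2, h]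
    · rfl

/-- If `p q` is the transposition, `q` fixes all other labels, so one factor is the transposition
and the other is `1`. A row transposition counts `1`, a column transposition `-1`. -/
theorem coeff_tabSymm_swap {T : α → ℕ × ℕ} (hT : Function.Injective T) {a b : α} (hab : a ≠ b) :
    (tabSymm T).coeff (Equiv.swap a b) =
      (if (T a).1 = (T b).1 then 1 else 0) - (if (T a).2 = (T b).2 then 1 else 0) := by
  set s := Equiv.swap a b with hs
  have hs1 : s ≠ 1 := by
    intro h
    have h1 : s a = a := by rw [h, Perm.one_apply]
    rw [hs, Equiv.swap_apply_left] at h1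
    exact hab h1.symm
  have hne : ((s, 1) : Perm α × Perm α) ≠ (1, s) := fun h => hs1 (congrArg Prod.fst h)
  rw [coeff_tabSymm]
  trans ∑ x ∈ ({(s, 1), (1, s)} : Finset (Perm α × Perm α)),
      if x.1 ∈ rowStab T ∧ x.2 ∈ colStab T then csign x.2 else 0
  · rw [← Finset.sum_filter, ← Finset.sum_filter]
    refine Finset.sum_congr ?_ fun _ _ => rfl
    ext ⟨p, q⟩
    simp only [Finset.mem_filter, Finset.mem_product, Finset.mem_insert, Finset.mem_singleton,
      Prod.mk.injEq]
    constructor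
    · rintro ⟨⟨hp, hq⟩, hpq⟩
      refine ⟨?_, hp, hq⟩
      have hfix : ∀ c, c ≠ a → c ≠ b → q c = c := by
        intro c hca hcb
        refine (fixed_of_mul_apply_eq hT hp hq ?_).1
        rw [← Perm.mul_apply, hpq, hs, Equiv.swap_apply_of_ne_of_ne hca hcb]
      rcases eq_one_or_eq_swap hfix with h | h
      · left
        rw [h, mul_one] at hpq
        exact ⟨hpq, h⟩
      · right
        rw [← hs] at h
        rw [h] at hpq
        exact ⟨by simpa using hpq, h⟩
    · rintro ⟨h, hp, hq⟩
      refine ⟨⟨hp, hq⟩, ?_⟩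
      rcases h with ⟨rfl, rfl⟩ | ⟨rfl, rfl⟩ <;> simp
  · have h1 : (1 : Perm α) ∈ rowStab T := by simp
    have h2 : (1 : Perm α) ∈ colStab T := by simp
    rw [Finset.sum_pair hne]
    simp only [h1, h2, true_and, and_true, csign_one]
    rw [hs, csign_swap hab]
    simp only [swap_mem_rowStab, swap_mem_colStab]
    split_ifs <;> ring

/-- The content of a box. -/
def content (c : ℕ × ℕ) : ℂ := (c.2 : ℂ) - (c.1 : ℂ)

/-- The sum of the transpositions that move `none`. -/
def starSum (α : Type) [Fintype α] [DecidableEq α] : MonoidAlgebra ℂ (Perm (Option α)) :=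
  ∑ a : α, MonoidAlgebra.single (Equiv.swap none (some a)) 1

theorem starSum_coeff (g : Perm (Option α)) :
    (starSum α).coeff g = ∑ a : α, if Equiv.swap none (some a) = g then 1 else 0 := by
  simp [starSum, MonoidAlgebra.coeff_sum, MonoidAlgebra.coeff_single, Finsupp.single_apply]

theorem mul_starSum_coeff_one (x : MonoidAlgebra ℂ (Perm (Option α))) :
    (starSum α * x).coeff 1 = ∑ a : α, x.coeff (Equiv.swap none (some a)) := by
  simp [starSum, Finset.sum_mul, MonoidAlgebra.coeff_sum]

/-- The label `none` is in a corner of `T`. -/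
theorem coeff_starSum_mul_tabSymm {lam mu : YoungDiagram} {T : Option α → ℕ × ℕ}
    (hT : IsTableau lam T) (hmu : IsTableau mu (T ∘ some)) :
    (starSum α * tabSymm T).coeff 1 = content (T none) := by
  rw [mul_starSum_coeff_one]
  have h : ∀ a : α, (tabSymm T).coeff (Equiv.swap none (some a)) =
      (if (T (some a)).1 = (T none).1 then 1 else 0) -
        (if (T (some a)).2 = (T none).2 then 1 else 0) := by
    intro a
    rw [coeff_tabSymm_swap hT.injective (by simp)]
    simp only [eq_comm]
  have hmem : ∀ c, c ∈ mu ↔ c ∈ lam ∧ c ≠ T none := by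
    intro c
    rw [hmu.mem_iff, hT.mem_iff]
    constructor
    · rintro ⟨a, rfl⟩
      exact ⟨⟨some a, rfl⟩, hT.injective.ne (by simp)⟩
    · rintro ⟨⟨_ | a, rfl⟩, h⟩
      · exact absurd rfl h
      · exact ⟨a, rfl⟩
  have hnone : T none ∈ lam := hT.mem _
  simp only [h, Finset.sum_sub_distrib, Finset.sum_boole, content]
  -- Since `none` sits in a corner, the other labels in its row are those to its left and the other
  -- labels in its column are those above it.
  congr 2
  · trans (Finset.range (T none).2).card
    · refine Finset.card_bij (fun a _ => (T (some a)).2) ?_ ?_ ?_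
      · intro a ha
        have ha' : (T (some a)).1 = (T none).1 := by simpa using ha
        rw [Finset.mem_range]
        by_contra! hle
        have h1 : T none ∈ mu := by
          refine mu.up_left_mem ha'.ge hle ?_
          exact hmu.mem a
        exact ((hmem _).1 h1).2 rfl
      · intro a ha b hb hab
        have ha' : (T (some a)).1 = (T none).1 := by simpa using ha
        have hb' : (T (some b)).1 = (T none).1 := by simpa using hb
        exact Option.some_injective _ (hT.injective (Prod.ext (ha'.trans hb'.symm) hab))
      · intro j hj
        rw [Finset.mem_range] at hj
        have h1 : ((T none).1, j) ∈ mu :=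
          (hmem _).2 ⟨lam.up_left_mem le_rfl hj.le hnone, fun e => hj.ne (congrArg Prod.snd e)⟩
        obtain ⟨a, ha⟩ := (hmu.mem_iff _).1 h1
        rw [Function.comp_apply] at ha
        exact ⟨a, by simp [ha], by simp [ha]⟩
    · simp
  · trans (Finset.range (T none).1).card
    · refine Finset.card_bij (fun a _ => (T (some a)).1) ?_ ?_ ?_
      · intro a ha
        have ha' : (T (some a)).2 = (T none).2 := by simpa using ha
        rw [Finset.mem_range]
        by_contra! hle
        have h1 : T none ∈ mu := by
          refine mu.up_left_mem hle ha'.ge ?_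
          exact hmu.mem a
        exact ((hmem _).1 h1).2 rfl
      · intro a ha b hb hab
        have ha' : (T (some a)).2 = (T none).2 := by simpa using ha
        have hb' : (T (some b)).2 = (T none).2 := by simpa using hb
        exact Option.some_injective _ (hT.injective (Prod.ext hab (ha'.trans hb'.symm)))
      · intro j hj
        rw [Finset.mem_range] at hj
        have h1 : (j, (T none).2) ∈ mu :=
          (hmem _).2 ⟨lam.up_left_mem hj.le le_rfl hnone, fun e => hj.ne (congrArg Prod.fst e)⟩
        obtain ⟨a, ha⟩ := (hmu.mem_iff _).1 h1
        rw [Function.comp_apply] at ha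
        exact ⟨a, by simp [ha], by simp [ha]⟩
    · simp

theorem optionIncl_coeff (x : MonoidAlgebra ℂ (Perm α)) (g : Perm α) :
    (optionIncl x).coeff (optionHom g) = x.coeff g := by
  have h := optionProj_mul x 1
  rw [mul_one] at h
  have h1 : optionProj (1 : MonoidAlgebra ℂ (Perm (Option α))) = 1 := by
    ext s
    rw [coeff_optionProj, MonoidAlgebra.one_def, MonoidAlgebra.one_def, MonoidAlgebra.coeff_single,
      MonoidAlgebra.coeff_single, Finsupp.single_apply, Finsupp.single_apply]
    congr 1
    rw [eq_iff_iff, ← map_one optionHom, optionHom_injective.eq_iff]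
  rw [h1, mul_one] at h
  rw [← coeff_optionProj, h]

theorem optionIncl_coeff_of_ne (x : MonoidAlgebra ℂ (Perm α)) {g : Perm (Option α)}
    (hg : g none ≠ none) : (optionIncl x).coeff g = 0 := by
  induction x using MonoidAlgebra.induction_linear with
  | zero => simp
  | add x y hx hy => simp [hx, hy]
  | single h c =>
    rw [optionIncl_single, MonoidAlgebra.coeff_single, Finsupp.single_apply, if_neg]
    rintro rfl
    exact hg rfl

/-- A transposition either fixes `none` or is a term of the Jucys–Murphy element `starSum α`. -/
theorem cycSum_two : cycSum (Option α) 2 = optionIncl (cycSum α 2) + starSum α := by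
  ext g
  rw [MonoidAlgebra.coeff_add, Finsupp.add_apply, starSum_coeff]
  by_cases hg : g none = none
  · obtain ⟨s, rfl⟩ := exists_optionHom hg
    rw [optionIncl_coeff, cycSum_coeff, cycSum_coeff, cycleType_optionHom,
      Finset.sum_eq_zero, add_zero]
    intro a _
    rw [if_neg]
    intro h
    have := congrArg (fun g : Perm (Option α) => g none) h
    simp at this
  · rw [optionIncl_coeff_of_ne _ hg, zero_add, cycSum_coeff]
    obtain ⟨b, hb⟩ := Option.ne_none_iff_exists'.1 hg
    have hsw : ∀ a, Equiv.swap none (some a) = g → a = b := by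
      rintro a rfl
      simpa using hb
    rw [Finset.sum_eq_single b]
    · congr 1
      rw [eq_iff_iff, ← Equiv.Perm.isSwap_iff_cycleType]
      constructor
      · rintro ⟨x, y, hxy, rfl⟩
        by_cases hx : none = x
        · subst hx
          rw [Equiv.swap_apply_left] at hb
          rw [hb]
        by_cases hy : none = y
        · subst hy
          rw [Equiv.swap_apply_right] at hb
          rw [hb, Equiv.swap_comm]
        · rw [Equiv.swap_apply_of_ne_of_ne hx hy] at hb
          simp at hb
      · rintro rfl
        exact ⟨none, some b, by simp, rfl⟩
    · intro a _ hab
      rw [if_neg fun h => hab (hsw a h)]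
    · simp

theorem optionIncl_mul_coeff_one (y : MonoidAlgebra ℂ (Perm α))
    (x : MonoidAlgebra ℂ (Perm (Option α))) :
    (optionIncl y * x).coeff 1 = (y * optionProj x).coeff 1 := by
  rw [← optionProj_mul, coeff_optionProj, map_one optionHom]

/-- Eigenvalues are coefficients at `1`. The part of `cycSum_two` in the stabilizer sees only the
projected symmetrizer, which is that of `mu`; the star sum contributes the content. -/
theorem diagCyc_two_eq {lam mu : YoungDiagram} {T : Option α → ℕ × ℕ}
    (hT : IsTableau lam T) (hmu : IsTableau mu (T ∘ some)) :
    diagCyc 2 lam = diagCyc 2 mu + content (T none) := by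
  rw [← hT.cycScalar_eq, ← hmu.cycScalar_eq, cycScalar, cycSum_two, add_mul,
    MonoidAlgebra.coeff_add, Finsupp.add_apply, coeff_starSum_mul_tabSymm hT hmu,
    optionIncl_mul_coeff_one, optionProj_tabSymm hT.injective, cycScalar]

end Content

end

noncomputable section

open Equiv (Perm)

/-! ### Sums of eigenspaces -/

section Eigen

variable {ι : Type*} [Fintype ι] [DecidableEq ι] {W : Type*} [AddCommGroup W] [Module ℂ W]
  [Module.Finite ℂ W] {V : ι → Type*} [∀ i, AddCommGroup (V i)] [∀ i, Module ℂ (V i)]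

theorem iSupIndep_range_of_eigen (f : Module.End ℂ W) (φ : ∀ i, V i →ₗ[ℂ] W) (a : ι → ℂ)
    (ha : Function.Injective a) (hf : ∀ i v, f (φ i v) = a i • φ i v) :
    iSupIndep fun i => LinearMap.range (φ i) := by
  refine (f.eigenspaces_iSupIndep.comp ha).mono fun i => ?_
  rintro _ ⟨v, rfl⟩
  exact Module.End.mem_eigenspace_iff.2 (hf i v)

/-- The ranges lie in eigenspaces of `f` with different eigenvalues, so they are independent. -/
theorem sum_finrank_le_of_eigen (f : Module.End ℂ W) (φ : ∀ i, V i →ₗ[ℂ] W) (a : ι → ℂ)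
    (ha : Function.Injective a) (hφ : ∀ i, Function.Injective (φ i))
    (hf : ∀ i v, f (φ i v) = a i • φ i v) :
    ∑ i, Module.finrank ℂ (V i) ≤ Module.finrank ℂ W := by
  have h := (iSupIndep_range_of_eigen f φ a ha hf).dfinsupp_lsum_injective
  have h1 := LinearMap.finrank_le_finrank_of_injective h
  change Module.finrank ℂ (DirectSum ι fun i => LinearMap.range (φ i)) ≤ _ at h1
  rw [Module.finrank_directSum] at h1
  refine le_trans (le_of_eq (Finset.sum_congr rfl fun i _ => ?_)) h1
  exact (LinearMap.finrank_range_of_inj (hφ i)).symm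

theorem trace_eq_sum_of_eigen (f : Module.End ℂ W) (φ : ∀ i, V i →ₗ[ℂ] W) (a : ι → ℂ)
    (ha : Function.Injective a) (hφ : ∀ i, Function.Injective (φ i))
    (hf : ∀ i v, f (φ i v) = a i • φ i v)
    (hdim : ∑ i, Module.finrank ℂ (V i) = Module.finrank ℂ W)
    (g : W →ₗ[ℂ] W) (g' : ∀ i, V i →ₗ[ℂ] V i) (hg : ∀ i v, g (φ i v) = φ i (g' i v)) :
    LinearMap.trace ℂ W g = ∑ i, LinearMap.trace ℂ (V i) (g' i) := by
  have h := (iSupIndep_range_of_eigen f φ a ha hf).dfinsupp_lsum_injective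
  have hrk : Module.finrank ℂ (DirectSum ι fun i => LinearMap.range (φ i)) =
      Module.finrank ℂ W := by
    rw [Module.finrank_directSum, ← hdim]
    exact Finset.sum_congr rfl fun i _ => LinearMap.finrank_range_of_inj (hφ i)
  have hint : DirectSum.IsInternal fun i => LinearMap.range (φ i) :=
    ⟨h, (LinearMap.injective_iff_surjective_of_finrank_eq_finrank hrk).1 h⟩
  have hmaps : ∀ i, Set.MapsTo g (LinearMap.range (φ i)) (LinearMap.range (φ i)) := by
    rintro i _ ⟨v, rfl⟩
    exact ⟨g' i v, (hg i v).symm⟩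
  rw [LinearMap.trace_eq_sum_trace_restrict hint hmaps]
  refine Finset.sum_congr rfl fun i _ => ?_
  rw [← LinearMap.trace_conj' (g' i) (LinearEquiv.ofInjective (φ i) (hφ i))]
  congr 1
  ext ⟨_, v, rfl⟩
  have : (LinearEquiv.ofInjective (φ i) (hφ i)).symm ⟨φ i v, ⟨v, rfl⟩⟩ = v := by
    rw [LinearEquiv.symm_apply_eq]
    rfl
  simp only [LinearEquiv.conj_apply, LinearMap.comp_apply, LinearEquiv.coe_coe]
  rw [this]
  exact hg i v

end Eigen

end

noncomputable section

open Equiv (Perm)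

/-! ### Adding and removing boxes -/

/-- The boxes of `lam` that can be removed. -/
def corners (lam : YoungDiagram) : Finset (ℕ × ℕ) :=
  lam.cells.filter fun c => (c.1 + 1, c.2) ∉ lam ∧ (c.1, c.2 + 1) ∉ lam

/-- The boxes that can be added to `lam`. -/
def outers (lam : YoungDiagram) : Finset (ℕ × ℕ) :=
  (Finset.range (lam.colLen 0 + 1) ×ˢ Finset.range (lam.rowLen 0 + 1)).filter fun c =>
    c ∉ lam ∧ (∀ i < c.1, (i, c.2) ∈ lam) ∧ ∀ j < c.2, (c.1, j) ∈ lam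

theorem mem_corners {lam : YoungDiagram} {c : ℕ × ℕ} :
    c ∈ corners lam ↔ c ∈ lam ∧ (c.1 + 1, c.2) ∉ lam ∧ (c.1, c.2 + 1) ∉ lam := by
  simp [corners]

theorem mem_outers {lam : YoungDiagram} {c : ℕ × ℕ} :
    c ∈ outers lam ↔ c ∉ lam ∧ (∀ i < c.1, (i, c.2) ∈ lam) ∧ ∀ j < c.2, (c.1, j) ∈ lam := by
  rw [outers, Finset.mem_filter, and_iff_right_iff_imp]
  rintro ⟨_, h1, h2⟩
  rw [Finset.mem_product, Finset.mem_range, Finset.mem_range]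
  constructor
  · by_contra! hc
    have h := h1 (c.1 - 1) (by omega)
    have h' := YoungDiagram.mem_iff_lt_colLen.1 (lam.up_left_mem le_rfl (Nat.zero_le _) h)
    omega
  · by_contra! hc
    have h := h2 (c.2 - 1) (by omega)
    have h' := YoungDiagram.mem_iff_lt_rowLen.1 (lam.up_left_mem (Nat.zero_le _) le_rfl h)
    omega

theorem mem_of_mem_corners {lam : YoungDiagram} {c : ℕ × ℕ} (hc : c ∈ corners lam) : c ∈ lam :=
  (mem_corners.1 hc).1

theorem eq_of_mem_corners_of_le {lam : YoungDiagram} {c d : ℕ × ℕ} (hc : c ∈ corners lam)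
    (hd : d ∈ lam) (hcd : c ≤ d) : d = c := by
  rw [mem_corners] at hc
  obtain ⟨h1, h2⟩ := hcd
  refine Prod.ext ?_ ?_
  · by_contra hne
    exact hc.2.1 (lam.up_left_mem (i2 := d.1) (j2 := d.2) (by omega) h2 hd)
  · by_contra hne
    exact hc.2.2 (lam.up_left_mem (i2 := d.1) (j2 := d.2) h1 (by omega) hd)

theorem mem_of_mem_outers_of_lt {lam : YoungDiagram} {c d : ℕ × ℕ} (hc : c ∈ outers lam)
    (hdc : d ≤ c) (hne : d ≠ c) : d ∈ lam := by
  rw [mem_outers] at hc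
  obtain ⟨h1, h2⟩ := hdc
  by_cases h : d.1 < c.1
  · exact lam.up_left_mem le_rfl h2 (hc.2.1 _ h)
  · have h3 : d.2 < c.2 := by
      by_contra h4
      exact hne (Prod.ext (by omega) (by omega))
    exact lam.up_left_mem h1 le_rfl (hc.2.2 _ h3)

open Classical in
/-- The diagram without the corner `c`. -/
def remBox (lam : YoungDiagram) (c : ℕ × ℕ) : YoungDiagram :=
  if hc : c ∈ corners lam then
    { cells := lam.cells.erase c
      isLowerSet := by
        intro d d' hle hd
        rw [Finset.mem_coe, Finset.mem_erase] at hd ⊢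
        refine ⟨?_, lam.isLowerSet hle hd.2⟩
        rintro rfl
        exact hd.1 (eq_of_mem_corners_of_le hc hd.2 hle) }
  else lam

open Classical in
/-- The diagram with the box `c` added. -/
def addBox (lam : YoungDiagram) (c : ℕ × ℕ) : YoungDiagram :=
  if hc : c ∈ outers lam then
    { cells := insert c lam.cells
      isLowerSet := by
        intro d d' hle hd
        rw [Finset.mem_coe, Finset.mem_insert] at hd ⊢
        rcases hd with rfl | hd
        · by_cases he : d' = d
          · exact Or.inl he
          · exact Or.inr (mem_of_mem_outers_of_lt hc hle he)
        · exact Or.inr (lam.isLowerSet hle hd) }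
  else lam

theorem mem_remBox {lam : YoungDiagram} {c d : ℕ × ℕ} (hc : c ∈ corners lam) :
    d ∈ remBox lam c ↔ d ≠ c ∧ d ∈ lam := by
  rw [remBox, dif_pos hc]
  exact Finset.mem_erase

theorem mem_addBox {lam : YoungDiagram} {c d : ℕ × ℕ} (hc : c ∈ outers lam) :
    d ∈ addBox lam c ↔ d = c ∨ d ∈ lam := by
  rw [addBox, dif_pos hc]
  exact Finset.mem_insert

theorem diagram_ext {lam mu : YoungDiagram} (h : ∀ c, c ∈ lam ↔ c ∈ mu) : lam = mu := by
  ext c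
  exact h c

theorem card_remBox {lam : YoungDiagram} {c : ℕ × ℕ} (hc : c ∈ corners lam) :
    (remBox lam c).card + 1 = lam.card := by
  rw [remBox, dif_pos hc]
  exact Finset.card_erase_add_one (mem_of_mem_corners hc)

theorem card_addBox {lam : YoungDiagram} {c : ℕ × ℕ} (hc : c ∈ outers lam) :
    (addBox lam c).card = lam.card + 1 := by
  rw [addBox, dif_pos hc]
  exact Finset.card_insert_of_notMem (mem_outers.1 hc).1

theorem mem_corners_addBox {lam : YoungDiagram} {c : ℕ × ℕ} (hc : c ∈ outers lam) :
    c ∈ corners (addBox lam c) := by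
  have h := (mem_outers.1 hc).1
  rw [mem_corners, mem_addBox hc, mem_addBox hc, mem_addBox hc]
  refine ⟨Or.inl rfl, ?_, ?_⟩
  · rintro (h1 | h1)
    · simpa using congrArg Prod.fst h1
    · exact h (lam.up_left_mem (Nat.le_succ _) le_rfl h1)
  · rintro (h1 | h1)
    · simpa using congrArg Prod.snd h1
    · exact h (lam.up_left_mem le_rfl (Nat.le_succ _) h1)

theorem mem_outers_remBox {lam : YoungDiagram} {c : ℕ × ℕ} (hc : c ∈ corners lam) :
    c ∈ outers (remBox lam c) := by
  have h := mem_of_mem_corners hc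
  rw [mem_outers, mem_remBox hc]
  refine ⟨fun h => h.1 rfl, fun i hi => ?_, fun j hj => ?_⟩
  · rw [mem_remBox hc]
    exact ⟨fun e => hi.ne (congrArg Prod.fst e), lam.up_left_mem hi.le le_rfl h⟩
  · rw [mem_remBox hc]
    exact ⟨fun e => hj.ne (congrArg Prod.snd e), lam.up_left_mem le_rfl hj.le h⟩

theorem remBox_addBox {lam : YoungDiagram} {c : ℕ × ℕ} (hc : c ∈ outers lam) :
    remBox (addBox lam c) c = lam := by
  refine diagram_ext fun d => ?_
  rw [mem_remBox (mem_corners_addBox hc), mem_addBox hc]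
  constructor
  · tauto
  · intro h
    exact ⟨fun e => (mem_outers.1 hc).1 (e ▸ h), Or.inr h⟩

theorem addBox_remBox {lam : YoungDiagram} {c : ℕ × ℕ} (hc : c ∈ corners lam) :
    addBox (remBox lam c) c = lam := by
  refine diagram_ext fun d => ?_
  rw [mem_addBox (mem_outers_remBox hc), mem_remBox hc]
  constructor
  · rintro (rfl | h)
    · exact mem_of_mem_corners hc
    · exact h.2
  · intro h
    by_cases e : d = c
    · exact Or.inl e
    · exact Or.inr ⟨e, h⟩

/-- Either side rules out `y ≤ x` in the product order, and then the presence of one box does not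
affect whether the other can be moved. -/
theorem mem_exchange {lam : YoungDiagram} {x y : ℕ × ℕ} :
    (x ∈ outers lam ∧ y ∈ corners (addBox lam x) ∧ y ≠ x) ↔
      (y ∈ corners lam ∧ x ∈ outers (remBox lam y) ∧ x ≠ y) := by
  constructor
  · rintro ⟨hx, hy, hne⟩
    have hyl : y ∈ corners lam := by
      rw [mem_corners] at hy ⊢
      simp only [mem_addBox hx] at hy
      tauto
    refine ⟨hyl, ?_, hne.symm⟩
    have hcond : ∀ d, d ≤ x → d ≠ x → d ∈ remBox lam y := by
      intro d hd hdx
      rw [mem_remBox hyl]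
      refine ⟨?_, mem_of_mem_outers_of_lt hx hd hdx⟩
      rintro rfl
      exact hdx (eq_of_mem_corners_of_le hy ((mem_addBox hx).2 (Or.inl rfl)) hd).symm
    rw [mem_outers]
    refine ⟨?_, fun i hi => hcond _ ⟨hi.le, le_rfl⟩ fun e => hi.ne (congrArg Prod.fst e),
      fun j hj => hcond _ ⟨le_rfl, hj.le⟩ fun e => hj.ne (congrArg Prod.snd e)⟩
    rw [mem_remBox hyl]
    exact fun h => (mem_outers.1 hx).1 h.2
  · rintro ⟨hy, hx, hne⟩
    have hxl : x ∈ outers lam := by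
      rw [mem_outers] at hx ⊢
      simp only [mem_remBox hy] at hx
      exact ⟨fun h => hx.1 ⟨hne, h⟩, fun i hi => (hx.2.1 i hi).2, fun j hj => (hx.2.2 j hj).2⟩
    refine ⟨hxl, ?_, hne.symm⟩
    have hle : ∀ d, y ≤ d → d ≠ y → d ∉ addBox lam x := by
      intro d hd hdy hmem
      rw [mem_addBox hxl] at hmem
      rcases hmem with rfl | hmem
      · have := mem_of_mem_outers_of_lt hx hd hdy.symm
        rw [mem_remBox hy] at this
        exact this.1 rfl
      · exact hdy (eq_of_mem_corners_of_le hy hmem hd)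
    rw [mem_corners]
    refine ⟨(mem_addBox hxl).2 (Or.inr (mem_of_mem_corners hy)),
      hle _ ⟨Nat.le_succ _, le_rfl⟩ fun e => by simpa using congrArg Prod.fst e,
      hle _ ⟨le_rfl, Nat.le_succ _⟩ fun e => by simpa using congrArg Prod.snd e⟩

theorem remBox_addBox_comm {lam : YoungDiagram} {x y : ℕ × ℕ} (hx : x ∈ outers lam)
    (hy : y ∈ corners (addBox lam x)) (hne : y ≠ x) :
    remBox (addBox lam x) y = addBox (remBox lam y) x := by
  obtain ⟨hy', hx', -⟩ := mem_exchange.1 ⟨hx, hy, hne⟩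
  refine diagram_ext fun d => ?_
  rw [mem_remBox hy, mem_addBox hx, mem_addBox hx', mem_remBox hy']
  constructor
  · rintro ⟨h1, rfl | h2⟩
    · exact Or.inl rfl
    · exact Or.inr ⟨h1, h2⟩
  · rintro (rfl | h)
    · exact ⟨hne.symm, Or.inl rfl⟩
    · exact ⟨h.1, Or.inr h.2⟩

theorem mem_corners_iff_rowLen {lam : YoungDiagram} {c : ℕ × ℕ} :
    c ∈ corners lam ↔ c.2 + 1 = lam.rowLen c.1 ∧ lam.rowLen (c.1 + 1) < lam.rowLen c.1 := by
  obtain ⟨i, j⟩ := c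
  simp only [mem_corners, YoungDiagram.mem_iff_lt_rowLen]
  omega

theorem mem_outers_iff_rowLen {lam : YoungDiagram} {c : ℕ × ℕ} :
    c ∈ outers lam ↔ c.2 = lam.rowLen c.1 ∧ (c.1 = 0 ∨ lam.rowLen c.1 < lam.rowLen (c.1 - 1)) := by
  obtain ⟨i, j⟩ := c
  simp only [mem_outers, YoungDiagram.mem_iff_lt_rowLen]
  constructor
  · rintro ⟨h1, h2, h3⟩
    have hj : j = lam.rowLen i := by
      by_contra hne
      have := h3 (lam.rowLen i) (by omega)
      omega
    refine ⟨hj, ?_⟩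
    by_cases hi : i = 0
    · exact Or.inl hi
    · right
      have := h2 (i - 1) (by omega)
      omega
  · rintro ⟨rfl, h⟩
    refine ⟨lt_irrefl _, fun i' hi' => ?_, fun j hj => hj⟩
    rcases h with h | h
    · omega
    · have := lam.rowLen_anti i' (i - 1) (by omega)
      omega

/-- The top row can always be extended, and row `i + 1` can be extended exactly when row `i` ends in
a corner. -/
theorem card_outers (lam : YoungDiagram) : (outers lam).card = (corners lam).card + 1 := by
  have h : outers lam = insert (0, lam.rowLen 0)
      ((corners lam).image fun c => (c.1 + 1, lam.rowLen (c.1 + 1))) := by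
    ext ⟨i, j⟩
    simp only [mem_outers_iff_rowLen, Finset.mem_insert, Finset.mem_image, mem_corners_iff_rowLen,
      Prod.mk.injEq]
    constructor
    · rintro ⟨rfl, hi⟩
      by_cases h0 : i = 0
      · left; simp [h0]
      · right
        have hi' := hi.resolve_left h0
        refine ⟨(i - 1, lam.rowLen (i - 1) - 1), ⟨?_, ?_⟩, ?_⟩
        · simp only; omega
        · simp only; rwa [Nat.sub_add_cancel (by omega)]
        · simp only; rw [Nat.sub_add_cancel (by omega)]; exact ⟨rfl, rfl⟩
    · rintro (⟨rfl, rfl⟩ | ⟨⟨a, b⟩, ⟨h1, h2⟩, rfl, rfl⟩)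
      · exact ⟨rfl, Or.inl rfl⟩
      · exact ⟨rfl, Or.inr (by simpa using h2)⟩
  rw [h, Finset.card_insert_of_notMem (by simp), Finset.card_image_of_injOn]
  rintro ⟨a, b⟩ h1 ⟨a', b'⟩ h2 hab
  rw [Finset.mem_coe, mem_corners_iff_rowLen] at h1 h2
  simp only [Prod.mk.injEq, add_left_inj] at hab h1 h2 ⊢
  obtain ⟨rfl, -⟩ := hab
  exact ⟨rfl, by omega⟩

theorem content_eq_iff {c d : ℕ × ℕ} : content c = content d ↔ c.2 + d.1 = d.2 + c.1 := by
  rw [content, content, sub_eq_sub_iff_add_eq_add]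
  norm_cast

/-- Boxes on one diagonal are comparable in the product order, and distinct corners are not. The
same reason applies to addable boxes. -/
theorem content_injOn_corners (lam : YoungDiagram) : Set.InjOn content (corners lam) := by
  intro c hc d hd h
  rw [content_eq_iff] at h
  rw [Finset.mem_coe] at hc hd
  rcases le_total c.1 d.1 with hle | hle
  · exact (eq_of_mem_corners_of_le hc (mem_of_mem_corners hd) ⟨hle, by omega⟩).symm
  · exact eq_of_mem_corners_of_le hd (mem_of_mem_corners hc) ⟨hle, by omega⟩

theorem content_injOn_outers (lam : YoungDiagram) : Set.InjOn content (outers lam) := by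
  intro c hc d hd h
  rw [content_eq_iff] at h
  rw [Finset.mem_coe] at hc hd
  by_contra hne
  rcases le_total c.1 d.1 with hle | hle
  · exact (mem_outers.1 hc).1 (mem_of_mem_outers_of_lt hd ⟨hle, by omega⟩ hne)
  · exact (mem_outers.1 hd).1 (mem_of_mem_outers_of_lt hc ⟨hle, by omega⟩ (Ne.symm hne))

theorem corners_nonempty {lam : YoungDiagram} (h : lam.card ≠ 0) : (corners lam).Nonempty := by
  have hne : lam.cells.Nonempty := Finset.card_ne_zero.1 h
  obtain ⟨c, hc, hmax⟩ := lam.cells.exists_max_image (fun c => c.1 + c.2) hne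
  refine ⟨c, mem_corners.2 ⟨hc, fun h1 => ?_, fun h1 => ?_⟩⟩
  · have := hmax _ h1
    simp only at this
    omega
  · have := hmax _ h1
    simp only at this
    omega

/-- Exchanging the addition and the removal of boxes. -/
theorem sum_outers_corners {M : Type*} [AddCommGroup M] (lam : YoungDiagram)
    (D : YoungDiagram → M) :
    ∑ x ∈ outers lam, ∑ y ∈ corners (addBox lam x), D (remBox (addBox lam x) y) =
      D lam + ∑ y ∈ corners lam, ∑ x ∈ outers (remBox lam y), D (addBox (remBox lam y) x) := by
  -- The terms with `y = x` return to `lam`, once for each addable box on the left and once for each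
  -- removable box on the right; by `card_outers` the surplus is the single term `D lam`. The other
  -- terms match by exchanging the two moves.
  have h1 : ∀ x ∈ outers lam, ∑ y ∈ corners (addBox lam x), D (remBox (addBox lam x) y) =
      D lam + ∑ y ∈ (corners (addBox lam x)).erase x, D (remBox (addBox lam x) y) := by
    intro x hx
    rw [← Finset.add_sum_erase _ _ (mem_corners_addBox hx), remBox_addBox hx]
  have h2 : ∀ y ∈ corners lam, ∑ x ∈ outers (remBox lam y), D (addBox (remBox lam y) x) =
      D lam + ∑ x ∈ (outers (remBox lam y)).erase y, D (addBox (remBox lam y) x) := by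
    intro y hy
    rw [← Finset.add_sum_erase _ _ (mem_outers_remBox hy), addBox_remBox hy]
  rw [Finset.sum_congr rfl h1, Finset.sum_congr rfl h2, Finset.sum_add_distrib,
    Finset.sum_add_distrib, Finset.sum_const, Finset.sum_const, card_outers, succ_nsmul]
  have h3 : ∑ x ∈ outers lam, ∑ y ∈ (corners (addBox lam x)).erase x,
      D (remBox (addBox lam x) y) =
      ∑ y ∈ corners lam, ∑ x ∈ (outers (remBox lam y)).erase y, D (addBox (remBox lam y) x) := by
    rw [Finset.sum_comm' (t' := corners lam) (s' := fun y => (outers (remBox lam y)).erase y)]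
    · refine Finset.sum_congr rfl fun y hy => Finset.sum_congr rfl fun x hx => ?_
      rw [Finset.mem_erase] at hx
      obtain ⟨h4, h5, h6⟩ := mem_exchange.2 ⟨hy, hx.2, hx.1⟩
      rw [remBox_addBox_comm h4 h5 h6]
    · intro x y
      rw [Finset.mem_erase, Finset.mem_erase]
      constructor
      · rintro ⟨h1, h2, h3⟩
        obtain ⟨h4, h5, h6⟩ := mem_exchange.1 ⟨h1, h3, h2⟩
        exact ⟨⟨h6, h5⟩, h4⟩
      · rintro ⟨⟨h1, h2⟩, h3⟩
        obtain ⟨h4, h5, h6⟩ := mem_exchange.2 ⟨h3, h2, h1⟩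
        exact ⟨h4, h6, h5⟩
  rw [h3]
  abel

end

noncomputable section

open Equiv (Perm)

/-! ### The branching rule -/

section Branching

variable {α : Type} [Fintype α] [DecidableEq α]

theorem IsTableau.exists_perm {lam : YoungDiagram} {S T : α → ℕ × ℕ} (hS : IsTableau lam S)
    (hT : IsTableau lam T) : ∃ π : Perm α, T = S ∘ π := by
  obtain ⟨φ, rfl⟩ := hS.exists_equiv
  obtain ⟨ψ, rfl⟩ := hT.exists_equiv
  refine ⟨ψ.trans φ.symm, ?_⟩
  ext1 a
  simp

theorem IsTableau.extend {lam : YoungDiagram} {c : ℕ × ℕ} {S : α → ℕ × ℕ} (hc : c ∈ outers lam)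
    (hS : IsTableau lam S) : IsTableau (addBox lam c) (fun o : Option α => o.elim c S) where
  injective := by
    have h : ∀ a, S a ≠ c := fun a e => (mem_outers.1 hc).1 (e ▸ hS.mem a)
    rintro (_ | a) (_ | b) hab
    · rfl
    · exact absurd hab.symm (h b)
    · exact absurd hab (h a)
    · exact congrArg some (hS.injective hab)
  mem_iff d := by
    rw [mem_addBox hc, hS.mem_iff, Option.exists]
    simp [eq_comm]

theorem exists_corner_tableau {lam : YoungDiagram} (hcard : lam.card = Fintype.card α + 1)
    {c : ℕ × ℕ} (hc : c ∈ corners lam) :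
    ∃ T : Option α → ℕ × ℕ, IsTableau lam T ∧ IsTableau (remBox lam c) (T ∘ some) ∧
      T none = c := by
  have h1 := card_remBox hc
  obtain ⟨S, hS⟩ := IsTableau.exists_of_card (α := α) (lam := remBox lam c) (by omega)
  have hT := hS.extend (mem_outers_remBox hc)
  rw [addBox_remBox hc] at hT
  exact ⟨_, hT, hS, rfl⟩

theorem central_mul_of_mem {G : Type*} [Group G] [Fintype G] {e v z : MonoidAlgebra ℂ G} {c : ℂ}
    (hz : ∀ x, z * x = x * z) (h : z * e = c • e) (hv : v ∈ leftIdeal e) : z * v = c • v := by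
  obtain ⟨x, rfl⟩ := hv
  rw [LinearMap.mulRight_apply, ← mul_assoc, hz, mul_assoc, h, mul_smul_comm]

/-- The embedding of the module of `S` into that of `T₀`. -/
def branchMap (S : α → ℕ × ℕ) (T₀ : Option α → ℕ × ℕ) (π : Perm (Option α)) :
    leftIdeal (tabSymm S) →ₗ[ℂ] leftIdeal (tabSymm T₀) where
  toFun v := ⟨optionIncl (v : MonoidAlgebra ℂ (Perm α)) * MonoidAlgebra.single π 1 * tabSymm T₀,
    _, rfl⟩
  map_add' v w := by ext1; simp [add_mul]
  map_smul' c v := by ext1; simp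

/-- The symmetrizer is idempotent up to a nonzero factor, so it acts on its left ideal from the
right by that factor. -/
theorem mul_tabSymm_ne_zero {lam : YoungDiagram} {S : α → ℕ × ℕ} (hS : IsTableau lam S)
    {v : MonoidAlgebra ℂ (Perm α)} (hv : v ∈ leftIdeal (tabSymm S)) (h : v * tabSymm S = 0) :
    v = 0 := by
  obtain ⟨x, rfl⟩ := hv
  obtain ⟨c, hc, hcc⟩ := exists_tabSymm_mul_self hS
  rw [LinearMap.mulRight_apply] at h ⊢
  rw [mul_assoc, hcc, mul_smul_comm] at h
  exact (smul_eq_zero.1 h).resolve_left hc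

/-- Moving `π` past the symmetrizer turns the image of `v` into `optionIncl v * tabSymm T` times a
permutation; projecting to the stabilizer leaves `v * tabSymm (T ∘ some)`, which determines `v`. -/
theorem branchMap_injective {lam mu : YoungDiagram} {T T₀ : Option α → ℕ × ℕ}
    (hT : IsTableau lam T) (hS : IsTableau mu (T ∘ some)) {π : Perm (Option α)}
    (hπ : T₀ = T ∘ π) : Function.Injective (branchMap (T ∘ some) T₀ π) := by
  rw [← LinearMap.ker_eq_bot, LinearMap.ker_eq_bot']
  rintro ⟨v, hv⟩ h
  have h0 : optionIncl v * MonoidAlgebra.single π 1 * tabSymm T₀ = 0 := congrArg Subtype.val h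
  rw [mul_assoc, hπ, ← tabSymm_mul_single_perm, ← mul_assoc] at h0
  have h1 := congrArg (· * MonoidAlgebra.single π⁻¹ (1 : ℂ)) h0
  simp only [mul_assoc, MonoidAlgebra.single_mul_single, mul_inv_cancel, mul_one, zero_mul,
    ← MonoidAlgebra.one_def] at h1
  have h2 := congrArg optionProj h1
  rw [optionProj_mul, optionProj_tabSymm hT.injective] at h2
  have h3 : optionProj (0 : MonoidAlgebra ℂ (Perm (Option α))) = 0 := by ext; simp
  rw [h3] at h2
  ext1
  exact mul_tabSymm_ne_zero hS hv h2

variable (α) in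
/-- The data of the restriction of the module of `lam` to the stabilizer of a label. -/
theorem exists_branching {lam : YoungDiagram} (hcard : lam.card = Fintype.card α + 1) :
    ∃ (T₀ : Option α → ℕ × ℕ) (S : corners lam → α → ℕ × ℕ)
      (φ : ∀ c, leftIdeal (tabSymm (S c)) →ₗ[ℂ] leftIdeal (tabSymm T₀)),
      IsTableau lam T₀ ∧ (∀ c : corners lam, IsTableau (remBox lam c) (S c)) ∧
      (∀ c, Function.Injective (φ c)) ∧
      (∀ y c v, leftAction (tabSymm T₀) (optionIncl y) (φ c v) =
        φ c (leftAction (tabSymm (S c)) y v)) := by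
  obtain ⟨T₀, hT₀⟩ := IsTableau.exists_of_card (α := Option α) (lam := lam)
    (by rw [Fintype.card_option, hcard])
  choose T hT hS hnone using fun c : corners lam => exists_corner_tableau hcard c.2
  choose π hπ using fun c => (hT c).exists_perm hT₀
  refine ⟨T₀, fun c => T c ∘ some, fun c => branchMap (T c ∘ some) T₀ (π c), hT₀, hS,
    fun c => branchMap_injective (hT c) (hS c) (hπ c), fun y c v => ?_⟩
  ext1
  simp [branchMap, mul_assoc]

theorem diagCyc_two_remBox {lam : YoungDiagram} {c : ℕ × ℕ} (hc : c ∈ corners lam) :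
    diagCyc 2 lam = diagCyc 2 (remBox lam c) + content c := by
  obtain ⟨T, h1, h2, h3⟩ := exists_corner_tableau
    (α := {d : ℕ × ℕ // d ∈ (remBox lam c).cells}) (lam := lam) (by
      rw [← card_remBox hc, Fintype.card_coe]) hc
  rw [diagCyc_two_eq h1 h2, h3]

theorem diagCyc_two_addBox {lam : YoungDiagram} {c : ℕ × ℕ} (hc : c ∈ outers lam) :
    diagCyc 2 (addBox lam c) = diagCyc 2 lam + content c := by
  rw [diagCyc_two_remBox (mem_corners_addBox hc), remBox_addBox hc]

/-- The transpositions fixing `none` separate the pieces of the restriction: their eigenvalue on the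
piece of `c` is `diagCyc 2 lam` less the content of `c`, and corners have distinct contents. -/
theorem leftAction_cycSum_two_eigen {lam : YoungDiagram} {T₀ : Option α → ℕ × ℕ}
    {S : corners lam → α → ℕ × ℕ}
    {φ : ∀ c, leftIdeal (tabSymm (S c)) →ₗ[ℂ] leftIdeal (tabSymm T₀)}
    (hS : ∀ c : corners lam, IsTableau (remBox lam c) (S c))
    (hφ : ∀ y c v, leftAction (tabSymm T₀) (optionIncl y) (φ c v) =
        φ c (leftAction (tabSymm (S c)) y v)) (c : corners lam) (v) :
    leftAction (tabSymm T₀) (optionIncl (cycSum α 2)) (φ c v) =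
      diagCyc 2 (remBox lam c) • φ c v := by
  rw [hφ, ← map_smul]
  congr 1
  ext1
  rw [coe_leftAction, ← (hS c).cycScalar_eq]
  exact central_mul_of_mem (cycSum_central 2) (cycSum_mul_tabSymm (hS c) 2) v.2

theorem diagCyc_two_remBox_injective (lam : YoungDiagram) :
    Function.Injective fun c : corners lam => diagCyc 2 (remBox lam c) := by
  intro c d h
  have h1 := diagCyc_two_remBox c.2
  have h2 := diagCyc_two_remBox d.2
  refine Subtype.ext (content_injOn_corners lam c.2 d.2 ?_)
  simp only at h
  linear_combination h2 - h1 - h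

/-- The dimension is at least the sum of the dimensions for the diagrams with a box removed. -/
theorem sum_corners_le (lam : YoungDiagram) (h : lam.card ≠ 0) :
    ∑ c ∈ corners lam, diagDim (remBox lam c) ≤ diagDim lam := by
  obtain ⟨n, hn⟩ := Nat.exists_eq_succ_of_ne_zero h
  obtain ⟨T₀, S, φ, hT₀, hS, hinj, hφ⟩ := exists_branching (Fin n) (lam := lam) (by simp [hn])
  have := sum_finrank_le_of_eigen _ φ _ (diagCyc_two_remBox_injective lam) hinj
    (leftAction_cycSum_two_eigen hS hφ)
  rw [hT₀.finrank_eq] at this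
  rw [← Finset.sum_coe_sort]
  refine le_trans (le_of_eq (Finset.sum_congr rfl fun c _ => ?_)) this
  exact (hS c).finrank_eq.symm

/-- The induced module is spanned by the translates of the module. -/
theorem finrank_leftIdeal_optionIncl_le (e : MonoidAlgebra ℂ (Perm α)) :
    Module.finrank ℂ (leftIdeal (optionIncl e)) ≤
      (Fintype.card α + 1) * Module.finrank ℂ (leftIdeal e) := by
  -- The permutations `swap none j`, with the identity at `j = none`, represent the left cosets of
  -- the stabilizer of `none`; `g` lies in the coset of `j = g none`.
  let Ψ : (Option α → leftIdeal e) →ₗ[ℂ] MonoidAlgebra ℂ (Perm (Option α)) :=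
    ∑ j, (LinearMap.mulLeft ℂ (MonoidAlgebra.single (Equiv.swap none j) 1)).comp
      (optionIncl.toLinearMap.comp ((leftIdeal e).subtype.comp (LinearMap.proj j)))
  have hle : leftIdeal (optionIncl e) ≤ LinearMap.range Ψ := by
    rintro _ ⟨x, rfl⟩
    rw [LinearMap.mulRight_apply]
    induction x using MonoidAlgebra.induction_linear with
    | zero => simp
    | add x y hx hy => rw [add_mul]; exact Submodule.add_mem _ hx hy
    | single g c =>
      refine ⟨Pi.single (g none) ⟨MonoidAlgebra.single (Equiv.removeNone g) c * e, _, rfl⟩, ?_⟩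
      have hg : Equiv.swap none (g none) * optionHom (Equiv.removeNone g) = g := by
        change _ * (Equiv.removeNone g).optionCongr = g
        rw [map_equiv_removeNone]
        simp [← mul_assoc]
      rw [LinearMap.sum_apply, Finset.sum_eq_single (g none)]
      · simp [← mul_assoc, hg]
      · intro j _ hj
        simp [hj]
      · simp
  calc Module.finrank ℂ (leftIdeal (optionIncl e))
      ≤ Module.finrank ℂ (LinearMap.range Ψ) := Submodule.finrank_mono hle
    _ ≤ Module.finrank ℂ (Option α → leftIdeal e) := LinearMap.finrank_range_le Ψ
    _ = (Fintype.card α + 1) * Module.finrank ℂ (leftIdeal e) := by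
        rw [Module.finrank_pi_fintype, Finset.sum_const, Finset.card_univ, Fintype.card_option,
          smul_eq_mul]

/-- The projection to the stabilizer is the square of the symmetrizer of `T ∘ some`. -/
theorem tabSymm_mul_optionIncl_ne_zero {mu : YoungDiagram} {T : Option α → ℕ × ℕ}
    (hT : Function.Injective T) (hS : IsTableau mu (T ∘ some)) :
    tabSymm T * optionIncl (tabSymm (T ∘ some)) ≠ 0 := by
  intro h
  have h1 := congrArg optionProj h
  rw [optionProj_mul', optionProj_tabSymm hT] at h1
  have h3 : optionProj (0 : MonoidAlgebra ℂ (Perm (Option α))) = 0 := by ext; simp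
  exact tabSymm_mul_self_ne_zero hS (h1.trans h3)

/-- The sum of the dimensions for the diagrams with a box added is at most that of the induced
module. -/
theorem sum_outers_le (mu : YoungDiagram) :
    ∑ c ∈ outers mu, diagDim (addBox mu c) ≤ (mu.card + 1) * diagDim mu := by
  obtain ⟨S, hS⟩ := IsTableau.exists_of_card (α := Fin mu.card) (lam := mu) (by simp)
  let T : outers mu → Option (Fin mu.card) → ℕ × ℕ := fun c o => o.elim c.1 S
  have hT : ∀ c : outers mu, IsTableau (addBox mu c) (T c) := fun c => hS.extend c.2
  -- Right multiplication by `optionIncl (tabSymm S)` lands in the induced module. It is injective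
  -- by minimality of the left ideal of `T c`, and the sum of all transpositions distinguishes the
  -- images for different `c`.
  let φ : ∀ c : outers mu, leftIdeal (tabSymm (T c)) →ₗ[ℂ] leftIdeal (optionIncl (tabSymm S)) :=
    fun c => ((LinearMap.mulRight ℂ (optionIncl (tabSymm S))).comp
      (leftIdeal (tabSymm (T c))).subtype).codRestrict _ fun v => ⟨v, rfl⟩
  have hφ : ∀ c v, (φ c v : MonoidAlgebra ℂ (Perm (Option (Fin mu.card)))) =
      v * optionIncl (tabSymm S) := fun _ _ => rfl
  have h := sum_finrank_le_of_eigen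
    (leftAction (optionIncl (tabSymm S)) (cycSum (Option (Fin mu.card)) 2)) φ
    (fun c => diagCyc 2 (addBox mu c)) ?_ ?_ ?_
  · refine le_trans (le_of_eq ?_) (h.trans (finrank_leftIdeal_optionIncl_le _)) |>.trans
      (le_of_eq ?_)
    · rw [← Finset.sum_coe_sort]
      exact Finset.sum_congr rfl fun c _ => (hT c).finrank_eq.symm
    · rw [hS.finrank_eq, Fintype.card_fin]
  · intro c d hcd
    have h1 := diagCyc_two_addBox c.2
    have h2 := diagCyc_two_addBox d.2
    refine Subtype.ext (content_injOn_outers mu c.2 d.2 ?_)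
    simp only at hcd
    linear_combination h2 - h1 + hcd
  · intro c
    rw [← LinearMap.ker_eq_bot, LinearMap.ker_eq_bot']
    rintro ⟨v, hv⟩ h
    ext1
    exact eq_zero_of_mul_eq_zero (fun x => ⟨_, tabSymm_mul_mul_tabSymm (hT c) x⟩)
      (tabSymm_mul_optionIncl_ne_zero (hT c).injective hS) hv (congrArg Subtype.val h)
  · intro c v
    ext1
    rw [coe_leftAction, Submodule.coe_smul, hφ, ← mul_assoc, ← smul_mul_assoc,
      ← (hT c).cycScalar_eq]
    congr 1
    exact central_mul_of_mem (cycSum_central 2) (cycSum_mul_tabSymm (hT c) 2) v.2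

/-- Two inequalities are squeezed. By induction and `sum_outers_corners`, the dimensions summed over
adding and then removing a box give `(n + 1) * diagDim mu`. By `sum_corners_le` this is at most the
sum over the added boxes, which by `sum_outers_le` is at most `(n + 1) * diagDim mu`. So all are
equalities, also termwise, and every nonempty diagram arises by adding a box. -/
theorem diagDim_branching (n : ℕ) :
    (∀ lam : YoungDiagram, lam.card = n + 1 →
      diagDim lam = ∑ c ∈ corners lam, diagDim (remBox lam c)) ∧
    ∀ mu : YoungDiagram, mu.card = n →
      ∑ c ∈ outers mu, diagDim (addBox mu c) = (n + 1) * diagDim mu := by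
  induction n using Nat.strong_induction_on with
  | _ n ih =>
  have key : ∀ mu : YoungDiagram, mu.card = n →
      ∑ x ∈ outers mu, ∑ y ∈ corners (addBox mu x), diagDim (remBox (addBox mu x) y) =
        (n + 1) * diagDim mu := by
    intro mu hmu
    have h1 := sum_outers_corners mu fun lam => (diagDim lam : ℤ)
    have h2 : ∀ y ∈ corners mu,
        ∑ x ∈ outers (remBox mu y), (diagDim (addBox (remBox mu y) x) : ℤ) =
          n * diagDim (remBox mu y) := by
      intro y hy
      have h3 := card_remBox hy
      obtain ⟨m, rfl⟩ : ∃ m, n = m + 1 := ⟨(remBox mu y).card, by omega⟩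
      have := (ih m (by omega)).2 (remBox mu y) (by omega)
      exact_mod_cast this
    have h4 : (n : ℤ) * ∑ y ∈ corners mu, (diagDim (remBox mu y) : ℤ) = n * diagDim mu := by
      rcases n with _ | m
      · simp
      · congr 1
        exact_mod_cast ((ih m (by omega)).1 mu hmu).symm
    rw [Finset.sum_congr rfl h2, ← Finset.mul_sum, h4] at h1
    have h5 : (diagDim mu : ℤ) + n * diagDim mu = (n + 1) * diagDim mu := by ring
    rw [h5] at h1
    exact_mod_cast h1
  have hle : ∀ mu : YoungDiagram, mu.card = n → ∀ x ∈ outers mu,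
      ∑ y ∈ corners (addBox mu x), diagDim (remBox (addBox mu x) y) ≤ diagDim (addBox mu x) := by
    intro mu _ x hx
    exact sum_corners_le _ (by rw [card_addBox hx]; omega)
  have heq : ∀ mu : YoungDiagram, mu.card = n →
      ∑ c ∈ outers mu, diagDim (addBox mu c) = (n + 1) * diagDim mu := by
    intro mu hmu
    refine le_antisymm ?_ ?_
    · rw [← hmu]
      exact sum_outers_le mu
    · rw [← key mu hmu]
      exact Finset.sum_le_sum (hle mu hmu)
  refine ⟨fun lam hlam => ?_, heq⟩
  obtain ⟨c, hc⟩ := corners_nonempty (lam := lam) (by omega)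
  have hmu : (remBox lam c).card = n := by
    have := card_remBox hc
    omega
  have h := (Finset.sum_eq_sum_iff_of_le (hle _ hmu)).1 ((key _ hmu).trans (heq _ hmu).symm) c
    (mem_outers_remBox hc)
  rw [addBox_remBox hc] at h
  exact h.symm

theorem diagDim_eq_sum {lam : YoungDiagram} (h : lam.card ≠ 0) :
    diagDim lam = ∑ c ∈ corners lam, diagDim (remBox lam c) := by
  obtain ⟨n, hn⟩ := Nat.exists_eq_succ_of_ne_zero h
  exact (diagDim_branching n).1 lam hn

/-- The branching rule for characters, evaluated at the sum of the cycles of length `k`. -/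
theorem diagCyc_branching {lam : YoungDiagram} {n k : ℕ} (hk : 2 ≤ k) (hkn : k ≤ n)
    (hlam : lam.card = n + 1) :
    ((n + 1 - k : ℕ) : ℂ) * (diagCyc k lam * diagDim lam) =
      (n + 1) * ∑ c ∈ corners lam, diagCyc k (remBox lam c) * diagDim (remBox lam c) := by
  obtain ⟨T₀, S, φ, hT₀, hS, hinj, hφ⟩ := exists_branching (Fin n) (lam := lam) (by simp [hlam])
  have hdim : ∑ c, Module.finrank ℂ (leftIdeal (tabSymm (S c))) =
      Module.finrank ℂ (leftIdeal (tabSymm T₀)) := by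
    rw [hT₀.finrank_eq, diagDim_eq_sum (by omega), ← Finset.sum_coe_sort (corners lam)]
    exact Finset.sum_congr rfl fun c _ => (hS c).finrank_eq
  have htr : idealTrace (tabSymm T₀) (optionIncl (cycSum (Fin n) k)) =
      ∑ c, idealTrace (tabSymm (S c)) (cycSum (Fin n) k) :=
    trace_eq_sum_of_eigen _ φ _ (diagCyc_two_remBox_injective lam) hinj
      (leftAction_cycSum_two_eigen hS hφ) hdim _ (fun c => leftAction (tabSymm (S c)) _)
      fun c v => hφ _ c v
  have h1 : ∀ c, idealTrace (tabSymm (S c)) (cycSum (Fin n) k) =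
      diagCyc k (remBox lam c) * diagDim (remBox lam c) := by
    intro c
    rw [idealTrace_of_scalar (cycSum_central k) (cycSum_mul_tabSymm (hS c) k),
      (hS c).cycScalar_eq, (hS c).finrank_eq]
  have h2 : idealTrace (tabSymm T₀) (cycSum (Option (Fin n)) k) = diagCyc k lam * diagDim lam := by
    rw [idealTrace_of_scalar (cycSum_central k) (cycSum_mul_tabSymm hT₀ k),
      hT₀.cycScalar_eq, hT₀.finrank_eq]
  rw [Finset.sum_congr rfl fun c _ => h1 c] at htr
  rw [← Finset.sum_coe_sort (corners lam), ← htr, ← h2]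
  have hcardn : (cycles (Fin n) k).card = (k - 1).factorial * n.choose k := by
    have := Equiv.Perm.card_of_cycleType_singleton (α := Fin n) hk (by simpa using hkn)
    rwa [Fintype.card_fin] at this
  have hcardn1 : (cycles (Option (Fin n)) k).card = (k - 1).factorial * (n + 1).choose k := by
    have := Equiv.Perm.card_of_cycleType_singleton (α := Option (Fin n)) hk
      (by rw [Fintype.card_option, Fintype.card_fin]; omega)
    rwa [Fintype.card_option, Fintype.card_fin] at this
  have hne : (cycles (Fin n) k).Nonempty := by
    rw [← Finset.card_pos, hcardn]
    exact Nat.mul_pos (Nat.factorial_pos _) (Nat.choose_pos hkn)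
  obtain ⟨g, hg⟩ := hne
  rw [mem_cycles] at hg
  -- All `k`-cycles of the larger group are conjugate, so both class sums have trace a multiple of
  -- `t`. The multiples are the numbers of `k`-cycles on `n` and on `n + 1` labels, whose ratio is
  -- `(n + 1 - k) : (n + 1)`.
  set t := idealTrace (tabSymm T₀) (MonoidAlgebra.single (optionHom g) 1) with ht
  have hconj : ∀ h : Perm (Option (Fin n)), h.cycleType = {k} →
      idealTrace (tabSymm T₀) (MonoidAlgebra.single h 1) = t := by
    intro h hh
    refine idealTrace_conj _ (Equiv.Perm.isConj_iff_cycleType_eq.2 ?_)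
    rw [hh, cycleType_optionHom, hg]
  have h3 : idealTrace (tabSymm T₀) (optionIncl (cycSum (Fin n) k)) =
      ((cycles (Fin n) k).card : ℂ) * t := by
    rw [cycSum, map_sum, map_sum, Finset.sum_congr rfl fun h hh => ?_, Finset.sum_const,
      nsmul_eq_mul]
    rw [optionIncl_single]
    exact hconj _ (by rw [cycleType_optionHom, mem_cycles.1 hh])
  have h4 : idealTrace (tabSymm T₀) (cycSum (Option (Fin n)) k) =
      ((cycles (Option (Fin n)) k).card : ℂ) * t := by
    rw [cycSum, map_sum, Finset.sum_congr rfl fun h hh => hconj h (mem_cycles.1 hh),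
      Finset.sum_const, nsmul_eq_mul]
  rw [h3, h4, hcardn, hcardn1]
  have h5 : (n + 1 - k) * (n + 1).choose k = (n + 1) * n.choose k := by
    rw [mul_comm, ← Nat.choose_mul_succ_eq, mul_comm]
  have h6 : ((n + 1 - k : ℕ) : ℂ) * ((n + 1).choose k : ℂ) = (n + 1) * (n.choose k : ℂ) := by
    exact_mod_cast h5
  push_cast
  linear_combination ((k - 1).factorial : ℂ) * t * h6

end Branching

end

noncomputable section

open Equiv (Perm)

/-! ### Cycles of full length -/

section Full

variable {α : Type} [Fintype α] [DecidableEq α]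

/-- Multiplying by the transposition of `none` and `g none` cuts `none` out of the cycle. The length
is at least three, so a nontrivial cycle remains. -/
theorem exists_swap_mul_of_full_cycle (hα : 2 ≤ Fintype.card α) {g : Perm (Option α)}
    (hg : g.cycleType = {Fintype.card α + 1}) :
    ∃ a : α, ∃ h : Perm α, h.cycleType = {Fintype.card α} ∧
      Equiv.swap none (some a) * optionHom h = g := by
  have hcyc : g.IsCycle := by
    rw [← Equiv.Perm.card_cycleType_eq_one, hg, Multiset.card_singleton]
  have hcard : g.support.card = Fintype.card (Option α) := by
    rw [← Equiv.Perm.sum_cycleType, hg, Multiset.sum_singleton, Fintype.card_option]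
  have hsupp : g.support = Finset.univ := Finset.card_eq_iff_eq_univ _ |>.1 hcard
  have hmoves : ∀ x, g x ≠ x := fun x => by
    rw [← Equiv.Perm.mem_support, hsupp]
    exact Finset.mem_univ x
  have hgg : g (g none) ≠ none := by
    intro h
    have hsw := hcyc.eq_swap_of_apply_apply_eq_self (hmoves none) h
    have h2 : g.support.card = 2 := by
      rw [hsw]
      exact Equiv.Perm.card_support_swap (hmoves none).symm
    rw [Fintype.card_option] at hcard
    omega
  obtain ⟨a, ha⟩ := Option.ne_none_iff_exists'.1 (hmoves none)
  have h1 := hcyc.swap_mul (hmoves none) hgg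
  have h2 := Equiv.Perm.support_swap_mul_eq g none hgg
  rw [ha] at h1 h2
  obtain ⟨h, hh⟩ := exists_optionHom (g := Equiv.swap none (some a) * g) (by simp [ha])
  refine ⟨a, h, ?_, ?_⟩
  · rw [← cycleType_optionHom, hh, h1.cycleType, h2, hsupp, Finset.sdiff_singleton_eq_erase,
      Finset.card_erase_of_mem (Finset.mem_univ _), Finset.card_univ, Fintype.card_option]
    simp
  · rw [hh, ← mul_assoc]
    simp

theorem swap_mul_optionHom_injective :
    Function.Injective fun x : α × Perm α => Equiv.swap none (some x.1) * optionHom x.2 := by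
  rintro ⟨a, h⟩ ⟨b, k⟩ hab
  have h1 : a = b := by
    have := congrArg (fun g : Perm (Option α) => g none) hab
    simpa using this
  subst h1
  simp only [mul_right_inj] at hab
  rw [optionHom_injective hab]

/-- One inclusion suffices, because both sets have `n!` elements for `n = Fintype.card α`. -/
theorem cycles_option (hα : 2 ≤ Fintype.card α) :
    cycles (Option α) (Fintype.card α + 1) =
      (Finset.univ ×ˢ cycles α (Fintype.card α)).image
        fun x : α × Perm α => Equiv.swap none (some x.1) * optionHom x.2 := by
  refine Finset.eq_of_subset_of_card_le ?_ ?_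
  · intro g hg
    obtain ⟨a, h, hh, rfl⟩ := exists_swap_mul_of_full_cycle hα (mem_cycles.1 hg)
    exact Finset.mem_image.2 ⟨(a, h), by simpa using hh, rfl⟩
  · have h1 : (cycles α (Fintype.card α)).card =
        (Fintype.card α - 1).factorial * (Fintype.card α).choose (Fintype.card α) :=
      Equiv.Perm.card_of_cycleType_singleton hα le_rfl
    have h2 : (cycles (Option α) (Fintype.card α + 1)).card = (Fintype.card α + 1 - 1).factorial *
        (Fintype.card (Option α)).choose (Fintype.card α + 1) :=
      Equiv.Perm.card_of_cycleType_singleton (by omega) (by rw [Fintype.card_option])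
    rw [Finset.card_image_of_injective _ swap_mul_optionHom_injective, Finset.card_product, h1, h2,
      Fintype.card_option, Nat.choose_self, Nat.choose_self, Finset.card_univ, mul_one, mul_one,
      Nat.add_sub_cancel]
    exact (Nat.mul_factorial_pred (by omega)).le

theorem cycSum_option (hα : 2 ≤ Fintype.card α) :
    cycSum (Option α) (Fintype.card α + 1) =
      starSum α * optionIncl (cycSum α (Fintype.card α)) := by
  rw [cycSum, cycles_option hα, Finset.sum_image swap_mul_optionHom_injective.injOn,
    Finset.sum_product, starSum, cycSum, map_sum, Finset.sum_mul_sum]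
  simp [MonoidAlgebra.single_mul_single]

theorem diagCyc_full {lam : YoungDiagram} {n : ℕ} (hn : 2 ≤ n) (hlam : lam.card = n + 1)
    {c : ℕ × ℕ} (hc : c ∈ corners lam) :
    diagCyc (n + 1) lam = content c * diagCyc n (remBox lam c) := by
  obtain ⟨T, hT, hS, hnone⟩ := exists_corner_tableau (α := Fin n) (by simpa using hlam) hc
  -- A nonzero common eigenvector: class sums of the large group act on `w` with their eigenvalues
  -- for `lam`, those of the stabilizer with their eigenvalues for `remBox lam c`. Hence the star
  -- sum, a difference of sums of transpositions, acts by the content of `c`, and `cycSum_option`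
  -- can be evaluated on `w`.
  set w := optionIncl (tabSymm (T ∘ some)) * tabSymm T with hw
  have hwT : w ∈ leftIdeal (tabSymm T) := ⟨_, rfl⟩
  have hw0 : w ≠ 0 := by
    intro h
    have h1 := congrArg optionProj h
    rw [hw, optionProj_mul, optionProj_tabSymm hT.injective] at h1
    have h3 : optionProj (0 : MonoidAlgebra ℂ (Perm (Option (Fin n)))) = 0 := by ext; simp
    exact tabSymm_mul_self_ne_zero hS (h1.trans h3)
  have hbig : ∀ k, cycSum (Option (Fin n)) k * w = diagCyc k lam • w := by
    intro k
    rw [← hT.cycScalar_eq]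
    exact central_mul_of_mem (cycSum_central k) (cycSum_mul_tabSymm hT k) hwT
  have hsmall : ∀ k, optionIncl (cycSum (Fin n) k) * w = diagCyc k (remBox lam c) • w := by
    intro k
    rw [hw, ← mul_assoc, ← map_mul, cycSum_mul_tabSymm hS, hS.cycScalar_eq, map_smul,
      smul_mul_assoc]
  have hstar : starSum (Fin n) * w = content c • w := by
    have h1 := hbig 2
    rw [cycSum_two, add_mul, hsmall, diagCyc_two_remBox hc, add_smul] at h1
    exact add_left_cancel h1
  have h2 := hbig (n + 1)
  have h3 := cycSum_option (α := Fin n) (by simpa using hn)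
  rw [Fintype.card_fin] at h3
  rw [h3, mul_assoc, hsmall, mul_smul_comm, hstar, smul_smul] at h2
  have h4 : (diagCyc n (remBox lam c) * content c - diagCyc (n + 1) lam) • w = 0 := by
    rw [sub_smul, h2, sub_self]
  have h5 := (smul_eq_zero.1 h4).resolve_right hw0
  linear_combination -h5

theorem diagCyc_two_eq_zero {lam : YoungDiagram} (h : lam.card ≤ 1) : diagCyc 2 lam = 0 := by
  have : cycSum {c : ℕ × ℕ // c ∈ lam.cells} 2 = 0 := by
    rw [cycSum, Finset.sum_eq_zero]
    intro g hg
    have h1 := Equiv.Perm.sum_cycleType g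
    rw [mem_cycles.1 hg, Multiset.sum_singleton] at h1
    have h2 := g.support.card_le_univ
    rw [Fintype.card_coe] at h2
    change _ ≤ lam.card at h2
    omega
  rw [diagCyc, cycScalar, this, zero_mul]
  simp

/-- The sum of the cycles of full length acts by the product of the contents of the boxes other
than the first one. -/
theorem diagCyc_card {n : ℕ} (hn : 2 ≤ n) {lam : YoungDiagram} (hlam : lam.card = n) :
    diagCyc n lam = ∏ c ∈ lam.cells.erase (0, 0), content c := by
  induction n, hn using Nat.le_induction generalizing lam with
  | base =>
    obtain ⟨c, hc⟩ := corners_nonempty (lam := lam) (by omega)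
    have h1 := card_remBox hc
    rw [diagCyc_two_remBox hc, diagCyc_two_eq_zero (by omega), zero_add]
    have h0 : ((0, 0) : ℕ × ℕ) ∈ lam.cells :=
      lam.up_left_mem (Nat.zero_le _) (Nat.zero_le _) (mem_of_mem_corners hc)
    have hc0 : c ≠ (0, 0) := by
      rintro rfl
      have h2 : lam.cells ⊆ {(0, 0)} := fun d hd => by
        rw [Finset.mem_singleton]
        exact eq_of_mem_corners_of_le hc hd ⟨Nat.zero_le _, Nat.zero_le _⟩
      have h3 := Finset.card_le_card h2
      rw [Finset.card_singleton] at h3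
      change lam.card ≤ 1 at h3
      omega
    have h4 : lam.cells.erase (0, 0) = {c} := by
      refine (Finset.eq_of_subset_of_card_le ?_ ?_).symm
      · rw [Finset.singleton_subset_iff, Finset.mem_erase]
        exact ⟨hc0, mem_of_mem_corners hc⟩
      · rw [Finset.card_erase_of_mem h0, Finset.card_singleton]
        change lam.card - 1 ≤ 1
        omega
    rw [h4, Finset.prod_singleton]
  | succ n hn ih =>
    obtain ⟨c, hc⟩ := corners_nonempty (lam := lam) (by omega)
    have h1 := card_remBox hc
    rw [diagCyc_full hn hlam hc, ih (lam := remBox lam c) (by omega)]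
    have h0 : ((0, 0) : ℕ × ℕ) ∈ (remBox lam c) := by
      have hne : (remBox lam c).cells.Nonempty := by
        rw [← Finset.card_pos]
        change 0 < (remBox lam c).card
        omega
      obtain ⟨d, hd⟩ := hne
      exact (remBox lam c).up_left_mem (Nat.zero_le _) (Nat.zero_le _) hd
    have hc0 : c ≠ (0, 0) := by
      rintro rfl
      exact ((mem_remBox hc).1 h0).1 rfl
    have h2 : (remBox lam c).cells.erase (0, 0) = (lam.cells.erase (0, 0)).erase c := by
      ext d
      simp only [Finset.mem_erase, YoungDiagram.mem_cells, mem_remBox hc]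
      tauto
    rw [h2, Finset.mul_prod_erase]
    exact Finset.mem_erase.2 ⟨hc0, mem_of_mem_corners hc⟩

end Full

end

noncomputable section

/-! ### The determinantal formula for dimensions -/

/-- `1 / z!`, extended by zero to negative integers. -/
def invFact (z : ℤ) : ℂ := if 0 ≤ z then ((z.toNat.factorial : ℕ) : ℂ)⁻¹ else 0

theorem invFact_of_neg {z : ℤ} (h : z < 0) : invFact z = 0 := by
  rw [invFact, if_neg (by omega)]

theorem invFact_natCast (n : ℕ) : invFact n = ((n.factorial : ℕ) : ℂ)⁻¹ := by
  simp [invFact]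

/-- The extension by zero makes this hold without exception; at `z = 0` both sides vanish. -/
theorem invFact_sub_one (z : ℤ) : invFact (z - 1) = z * invFact z := by
  rcases lt_trichotomy z 0 with h | rfl | h
  · rw [invFact_of_neg h, invFact_of_neg (by omega), mul_zero]
  · rw [invFact_of_neg (by omega)]
    simp
  · obtain ⟨n, rfl⟩ : ∃ n : ℕ, z = n + 1 := ⟨(z - 1).toNat, by omega⟩
    have h1 : ((n : ℤ) + 1) = ((n + 1 : ℕ) : ℤ) := by push_cast; ring
    rw [add_sub_cancel_right, h1, invFact_natCast, invFact_natCast, Nat.factorial_succ]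
    have : (n.factorial : ℂ) ≠ 0 := by exact_mod_cast n.factorial_ne_zero
    have h2 : (n : ℂ) + 1 ≠ 0 := by exact_mod_cast n.succ_ne_zero
    push_cast
    field_simp

theorem invFact_sub (z : ℤ) (m : ℕ) :
    invFact (z - m) = (descPochhammer ℂ m).eval (z : ℂ) * invFact z := by
  induction m with
  | zero => simp
  | succ m ih =>
    have : z - ((m + 1 : ℕ) : ℤ) = z - m - 1 := by push_cast; ring
    rw [this, invFact_sub_one, ih, descPochhammer_succ_right, Polynomial.eval_mul]
    simp
    ring

variable {N : ℕ}

/-- The determinant of the inverse factorials of `l i - j`. -/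
def detInvFact (l : Fin N → ℤ) : ℂ := (Matrix.of fun i j : Fin N => invFact (l i - (j : ℕ))).det

/-- By `invFact_sub` each entry is a falling factorial of `l i` over `(l i)!`, and falling
factorials are monic polynomials of degree `j`. -/
theorem detInvFact_eq_vandermonde (l : Fin N → ℤ) :
    detInvFact l = (∏ i, invFact (l i)) * (Matrix.vandermonde fun i => (l i : ℂ)).det := by
  rw [Matrix.det_eval_matrixOfPolynomials_eq_det_vandermonde (fun i => (l i : ℂ))
    (fun j => descPochhammer ℂ j) (fun i => descPochhammer_natDegree ℂ i)
    (fun i => monic_descPochhammer ℂ i), ← Matrix.det_mul_column, detInvFact]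
  congr 1
  ext i j
  rw [Matrix.of_apply, Matrix.of_apply, Matrix.of_apply, invFact_sub, mul_comm]

theorem detInvFact_of_neg {l : Fin N → ℤ} {i : Fin N} (h : l i < 0) : detInvFact l = 0 :=
  Matrix.det_eq_zero_of_row_eq_zero i fun j => invFact_of_neg (by omega)

theorem detInvFact_of_eq {l : Fin N → ℤ} {i j : Fin N} (hij : i ≠ j) (h : l i = l j) :
    detInvFact l = 0 :=
  Matrix.det_zero_of_row_eq hij (by ext m; simp [h])

theorem detInvFact_swap (l : Fin N → ℤ) {i j : Fin N} (hij : i ≠ j) :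
    detInvFact (l ∘ Equiv.swap i j) = -detInvFact l := by
  have h := Matrix.det_permute (Equiv.swap i j)
    (Matrix.of fun i j : Fin N => invFact (l i - (j : ℕ)))
  rw [Equiv.Perm.sign_swap hij] at h
  refine Eq.trans ?_ (h.trans ?_)
  · rfl
  · simp [detInvFact]

/-- Lowering one entry. -/
def lower (l : Fin N → ℤ) (i : Fin N) (k : ℤ) : Fin N → ℤ := Function.update l i (l i - k)

@[simp] theorem lower_self (l : Fin N → ℤ) (i : Fin N) (k : ℤ) : lower l i k i = l i - k := by
  simp [lower]

theorem lower_of_ne (l : Fin N → ℤ) {i j : Fin N} (h : j ≠ i) (k : ℤ) : lower l i k j = l j := by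
  simp [lower, h]

theorem lower_comm (l : Fin N → ℤ) (i j : Fin N) (k m : ℤ) :
    lower (lower l i k) j m = lower (lower l j m) i k := by
  ext a
  by_cases h1 : a = i
  · subst h1
    by_cases h2 : a = j
    · subst h2
      simp only [lower_self]
      ring
    · rw [lower_of_ne _ h2, lower_self, lower_self, lower_of_ne _ h2]
  · rw [lower_of_ne (lower l j m) h1]
    by_cases h2 : a = j
    · subst h2
      rw [lower_self, lower_self, lower_of_ne _ h1]
    · rw [lower_of_ne _ h2, lower_of_ne _ h2, lower_of_ne _ h1]

/-- The total excess of the entries over `0, 1, …, N - 1`. -/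
def excess (l : Fin N → ℤ) : ℤ := ∑ i, l i - ∑ i : Fin N, ((i : ℕ) : ℤ)

theorem excess_lower (l : Fin N → ℤ) (i : Fin N) (k : ℤ) :
    excess (lower l i k) = excess l - k := by
  rw [excess, excess, lower, Finset.sum_update_of_mem (Finset.mem_univ i),
    ← Finset.add_sum_erase Finset.univ l (Finset.mem_univ i), Finset.sdiff_singleton_eq_erase]
  ring

/-- In the Leibniz term of `σ`, lowering entry `r` multiplies by `l r - σ⁻¹ r`; the sum of these
factors over `r` is `excess l` whatever `σ` is. -/
theorem sum_detInvFact_lower (l : Fin N → ℤ) :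
    ∑ i, detInvFact (lower l i 1) = excess l * detInvFact l := by
  have h : ∀ r, detInvFact (lower l r 1) = ∑ σ : Equiv.Perm (Fin N),
      ((Equiv.Perm.sign σ : ℤ) : ℂ) * (((l r : ℂ) - ((σ⁻¹ r : Fin N) : ℕ)) *
        ∏ i, invFact (l (σ i) - (i : ℕ))) := by
    intro r
    rw [detInvFact, Matrix.det_apply']
    refine Finset.sum_congr rfl fun σ _ => ?_
    congr 1
    rw [← Finset.mul_prod_erase _ _ (Finset.mem_univ (σ⁻¹ r)),
      ← Finset.mul_prod_erase Finset.univ (fun i => invFact (l (σ i) - (i : ℕ)))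
        (Finset.mem_univ (σ⁻¹ r)), ← mul_assoc]
    congr 1
    · have h1 : σ (σ⁻¹ r) = r := by simp
      rw [Matrix.of_apply, h1, lower_self, sub_right_comm, invFact_sub_one]
      push_cast
      ring
    · refine Finset.prod_congr rfl fun i hi => ?_
      rw [Matrix.of_apply, lower_of_ne]
      rintro rfl
      simp at hi
  rw [Finset.sum_congr rfl fun r _ => h r, Finset.sum_comm, detInvFact, Matrix.det_apply',
    Finset.mul_sum]
  refine Finset.sum_congr rfl fun σ _ => ?_
  rw [← Finset.mul_sum, ← Finset.sum_mul, mul_left_comm]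
  congr 2
  rw [Finset.sum_sub_distrib, Equiv.sum_comp σ⁻¹ fun i : Fin N => ((i : ℕ) : ℂ), excess]
  push_cast
  rfl

/-- The numerator of the Frobenius formula for `k`-cycles. -/
def cycleSum (k : ℤ) (l : Fin N → ℤ) : ℂ := ∑ i, detInvFact (lower l i k)

/-- Lowerings by `1` and by `k` commute, and the latter reduces the excess by `k`. This is the
determinantal counterpart of `diagCyc_branching`. -/
theorem sum_cycleSum_lower (k : ℤ) (l : Fin N → ℤ) :
    ∑ i, cycleSum k (lower l i 1) = (excess l - k) * cycleSum k l := by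
  simp only [cycleSum]
  rw [Finset.sum_comm, Finset.mul_sum]
  refine Finset.sum_congr rfl fun i _ => ?_
  simp only [lower_comm l _ i 1 k]
  rw [sum_detInvFact_lower, excess_lower]
  push_cast
  ring

theorem cycleSum_of_neg {k : ℤ} (hk : 0 ≤ k) {l : Fin N → ℤ} {i : Fin N} (h : l i < 0) :
    cycleSum k l = 0 := by
  refine Finset.sum_eq_zero fun j _ => detInvFact_of_neg (i := i) ?_
  by_cases hij : i = j
  · subst hij
    rw [lower_self]
    omega
  · rwa [lower_of_ne _ hij]

/-- The terms lowering `i` and `j` differ by a transposition of entries and cancel; every other term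
retains two equal entries. -/
theorem cycleSum_of_eq {k : ℤ} {l : Fin N → ℤ} {i j : Fin N} (hij : i ≠ j) (h : l i = l j) :
    cycleSum k l = 0 := by
  rw [cycleSum, ← Finset.add_sum_erase _ _ (Finset.mem_univ i),
    ← Finset.add_sum_erase _ _ (Finset.mem_erase.2 ⟨hij.symm, Finset.mem_univ j⟩),
    Finset.sum_eq_zero, add_zero]
  · have : lower l j k = lower l i k ∘ Equiv.swap i j := by
      ext a
      rw [Function.comp_apply]
      by_cases h1 : a = i
      · subst h1
        rw [Equiv.swap_apply_left, lower_of_ne _ hij, lower_of_ne _ hij.symm, h]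
      by_cases h2 : a = j
      · subst h2
        rw [Equiv.swap_apply_right, lower_self, lower_self, h]
      · rw [Equiv.swap_apply_of_ne_of_ne h1 h2, lower_of_ne _ h1, lower_of_ne _ h2]
    rw [this, detInvFact_swap _ hij, add_neg_cancel]
  · intro m hm
    rw [Finset.mem_erase, Finset.mem_erase] at hm
    exact detInvFact_of_eq hij
      (by rw [lower_of_ne _ hm.2.1.symm, lower_of_ne _ hm.1.symm, h])

/-- The shifted row lengths `λ_i + N - i`. -/
def shiftedRows (N : ℕ) (lam : YoungDiagram) (i : Fin N) : ℤ :=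
  lam.rowLen i + (N - 1 - (i : ℕ))

theorem sum_rowLen {lam : YoungDiagram} (h : lam.colLen 0 ≤ N) :
    ∑ i : Fin N, lam.rowLen i = lam.card := by
  rw [Fin.sum_univ_eq_sum_range (fun i => lam.rowLen i), YoungDiagram.card,
    Finset.card_eq_sum_card_fiberwise (f := Prod.fst) (t := Finset.range N)]
  · refine Finset.sum_congr rfl fun i _ => ?_
    rw [YoungDiagram.rowLen_eq_card]
    rfl
  · rintro ⟨i, j⟩ hc
    rw [Finset.mem_coe, Finset.mem_range]
    have h1 := lam.up_left_mem le_rfl (Nat.zero_le _) (i2 := i) (j2 := j) hc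
    exact lt_of_lt_of_le (YoungDiagram.mem_iff_lt_colLen.1 h1) h

theorem excess_shiftedRows {lam : YoungDiagram} (h : lam.colLen 0 ≤ N) :
    excess (shiftedRows N lam) = lam.card := by
  have h1 : ∑ i : Fin N, ((N : ℤ) - 1 - (i : ℕ)) = ∑ i : Fin N, ((i : ℕ) : ℤ) := by
    refine Fintype.sum_equiv Fin.revPerm _ _ fun i => ?_
    rw [Fin.revPerm_apply, Fin.val_rev]
    omega
  rw [excess]
  simp only [shiftedRows]
  rw [Finset.sum_add_distrib, h1, add_sub_cancel_right, ← sum_rowLen h]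
  push_cast
  rfl

theorem rowLen_remBox {lam : YoungDiagram} {c : ℕ × ℕ} (hc : c ∈ corners lam) (i : ℕ) :
    (remBox lam c).rowLen i = if i = c.1 then lam.rowLen i - 1 else lam.rowLen i := by
  have h := (mem_corners_iff_rowLen.1 hc).1
  refine eq_of_forall_lt_iff fun j => ?_
  rw [← YoungDiagram.mem_iff_lt_rowLen, mem_remBox hc, YoungDiagram.mem_iff_lt_rowLen]
  have h1 : ((i, j) : ℕ × ℕ) ≠ c ↔ ¬ (i = c.1 ∧ j = c.2) := by rw [Ne, Prod.ext_iff]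
  rw [h1]
  split_ifs with h2
  · subst h2
    omega
  · tauto

theorem colLen_remBox_le {lam : YoungDiagram} {c : ℕ × ℕ} (hc : c ∈ corners lam) :
    (remBox lam c).colLen 0 ≤ lam.colLen 0 := by
  by_contra! h
  have := YoungDiagram.mem_iff_lt_colLen.2 h
  exact lt_irrefl _ (YoungDiagram.mem_iff_lt_colLen.1 ((mem_remBox hc).1 this).2)

theorem shiftedRows_remBox {lam : YoungDiagram} {c : ℕ × ℕ} (hc : c ∈ corners lam)
    (hN : c.1 < N) : shiftedRows N (remBox lam c) = lower (shiftedRows N lam) ⟨c.1, hN⟩ 1 := by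
  have h := (mem_corners_iff_rowLen.1 hc).1
  ext i
  by_cases hi : i = ⟨c.1, hN⟩
  · subst hi
    rw [lower_self, shiftedRows, shiftedRows, rowLen_remBox hc, if_pos rfl]
    push_cast [show 1 ≤ lam.rowLen c.1 by omega]
    ring
  · rw [lower_of_ne _ hi, shiftedRows, shiftedRows, rowLen_remBox hc, if_neg]
    exact fun h => hi (Fin.ext h)

theorem fst_lt_of_mem_corners {lam : YoungDiagram} (h : lam.colLen 0 ≤ N) {c : ℕ × ℕ}
    (hc : c ∈ corners lam) : c.1 < N := by
  have h1 : (c.1, 0) ∈ lam := lam.up_left_mem le_rfl (Nat.zero_le _) (mem_of_mem_corners hc)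
  exact lt_of_lt_of_le (YoungDiagram.mem_iff_lt_colLen.1 h1) h

/-- A sum over the rows reduces to the corners. -/
theorem sum_lower_eq_sum_corners {lam : YoungDiagram} (h : lam.colLen 0 ≤ N)
    (D : (Fin N → ℤ) → ℂ) (hneg : ∀ l i, l i < 0 → D l = 0)
    (heq : ∀ l i j, i ≠ j → l i = l j → D l = 0) :
    ∑ i, D (lower (shiftedRows N lam) i 1) =
      ∑ c ∈ corners lam, D (shiftedRows N (remBox lam c)) := by
  symm
  refine Finset.sum_bij_ne_zero (fun c hc _ => ⟨c.1, fst_lt_of_mem_corners h hc⟩) ?_ ?_ ?_ ?_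
  · intros
    exact Finset.mem_univ _
  · intro c hc _ d hd _ hcd
    rw [mem_corners_iff_rowLen] at hc hd
    have h1 : c.1 = d.1 := congrArg Fin.val hcd
    rw [← h1] at hd
    exact Prod.ext h1 (by omega)
  · intro i _ hi
    -- If row `i` is no longer than the next one, lowering makes two entries equal or, in the last
    -- row, an entry negative; either kills `D`.
    have hlt : lam.rowLen (i + 1) < lam.rowLen i := by
      by_contra! hle
      have hle' := lam.rowLen_anti i (i + 1) (Nat.le_succ _)
      refine hi ?_
      by_cases hiN : (i : ℕ) + 1 < N
      · refine heq _ i ⟨i + 1, hiN⟩ (fun e => by simpa using congrArg Fin.val e) ?_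
        rw [lower_self, lower_of_ne _ (fun e => by simpa using congrArg Fin.val e)]
        simp only [shiftedRows]
        push_cast
        omega
      · refine hneg _ i ?_
        have h0 : lam.rowLen (i + 1) = 0 := rowLen_eq_zero (by omega)
        rw [lower_self, shiftedRows]
        omega
    have hc : (((i : ℕ), lam.rowLen i - 1) : ℕ × ℕ) ∈ corners lam := by
      rw [mem_corners_iff_rowLen]
      exact ⟨by simp only; omega, hlt⟩
    refine ⟨_, hc, ?_, rfl⟩
    rwa [shiftedRows_remBox hc i.2]
  · intro c hc _
    rw [shiftedRows_remBox hc (fst_lt_of_mem_corners h hc)]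

theorem eq_bot_of_card_eq_zero {lam : YoungDiagram} (h : lam.card = 0) : lam = ⊥ := by
  have : lam.cells = ∅ := Finset.card_eq_zero.1 h
  ext c
  rw [this, YoungDiagram.cells_bot]

theorem diagDim_bot : diagDim ⊥ = 1 := by
  have h := (diagDim_branching 0).2 ⊥ rfl
  have h1 : diagDim (⊥ : YoungDiagram) ≤ 1 := by
    have h2 : IsEmpty {c : ℕ × ℕ // c ∈ (⊥ : YoungDiagram).cells} := ⟨fun c => YoungDiagram.notMem_bot _ c.2⟩
    rw [diagDim]
    refine (Submodule.finrank_le _).trans ?_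
    rw [Module.finrank_eq_card_basis (MonoidAlgebra.basis _ ℂ)]
    simp
  have := diagDim_pos ⊥
  omega

theorem shiftedRows_nonneg (lam : YoungDiagram) (i : Fin N) : 0 ≤ shiftedRows N lam i := by
  rw [shiftedRows]
  omega

theorem shiftedRows_lt {lam : YoungDiagram} {i j : Fin N} (h : i < j) :
    shiftedRows N lam j < shiftedRows N lam i := by
  have h1 := lam.rowLen_anti i j h.le
  have h2 : (i : ℕ) < j := h
  rw [shiftedRows, shiftedRows]
  omega

theorem shiftedRows_injective (N : ℕ) (lam : YoungDiagram) :
    Function.Injective (shiftedRows N lam) :=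
  StrictAnti.injective fun _ _ h => shiftedRows_lt h

theorem invFact_ne_zero {z : ℤ} (h : 0 ≤ z) : invFact z ≠ 0 := by
  rw [invFact, if_pos h]
  exact inv_ne_zero (by exact_mod_cast Nat.factorial_ne_zero _)

theorem detInvFact_shiftedRows_ne_zero (N : ℕ) (lam : YoungDiagram) :
    detInvFact (shiftedRows N lam) ≠ 0 := by
  rw [detInvFact_eq_vandermonde]
  refine mul_ne_zero (Finset.prod_ne_zero_iff.2 fun i _ =>
    invFact_ne_zero (shiftedRows_nonneg lam i)) (Matrix.det_vandermonde_ne_zero_iff.2 ?_)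
  intro i j h
  exact shiftedRows_injective N lam (Int.cast_injective h)

/-- Both sides obey the same recursion over corners: `diagDim_eq_sum` on the left, and
`sum_detInvFact_lower` with excess `|λ|` on the right. The determinant of the empty diagram is the
normalisation. -/
theorem diagDim_eq {lam : YoungDiagram} (h : lam.colLen 0 ≤ N) :
    (diagDim lam : ℂ) * detInvFact (shiftedRows N ⊥) =
      lam.card.factorial * detInvFact (shiftedRows N lam) := by
  induction hn : lam.card generalizing lam with
  | zero =>
    rw [eq_bot_of_card_eq_zero hn, diagDim_bot]
    simp
  | succ n ih =>
    have h1 := sum_lower_eq_sum_corners h detInvFact (fun _ _ => detInvFact_of_neg)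
      (fun _ _ _ => detInvFact_of_eq)
    rw [sum_detInvFact_lower, excess_shiftedRows h, hn] at h1
    rw [diagDim_eq_sum (by omega), Nat.factorial_succ]
    have h2 : ∀ c ∈ corners lam, (diagDim (remBox lam c) : ℂ) * detInvFact (shiftedRows N ⊥) =
        n.factorial * detInvFact (shiftedRows N (remBox lam c)) := by
      intro c hc
      have := card_remBox hc
      exact ih ((colLen_remBox_le hc).trans h) (by omega)
    push_cast at h1 ⊢
    rw [Finset.sum_mul, Finset.sum_congr rfl h2, ← Finset.mul_sum, ← h1]
    ring

end

noncomputable section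

variable {N : ℕ}

/-! ### The Frobenius formula for cycles -/

/-- By Lagrange interpolation the new row is a combination of the old ones, and only the coefficient
of row `i`, a value of the Lagrange basis polynomial, matters. -/
theorem det_vandermonde_update {K : Type*} [Field K] {v : Fin N → K} (hv : Function.Injective v)
    (i : Fin N) (x : K) :
    (Matrix.vandermonde (Function.update v i x)).det =
      (∏ j ∈ Finset.univ.erase i, (v i - v j)⁻¹ * (x - v j)) * (Matrix.vandermonde v).det := by
  have h : Matrix.vandermonde (Function.update v i x) = (Matrix.vandermonde v).updateRow i
      (∑ j, (Lagrange.basis Finset.univ v j).eval x • Matrix.vandermonde v j) := by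
    ext a b
    by_cases ha : a = i
    · subst ha
      rw [Matrix.updateRow_self, Matrix.vandermonde_apply, Function.update_self, Finset.sum_apply]
      have h2 := Lagrange.eq_interpolate (s := Finset.univ) (v := v)
        (f := (Polynomial.X : Polynomial K) ^ (b : ℕ)) hv.injOn (by
          rw [Polynomial.degree_X_pow, Finset.card_univ, Fintype.card_fin]
          exact_mod_cast b.2)
      have h3 := congrArg (Polynomial.eval x) h2
      rw [Polynomial.eval_pow, Polynomial.eval_X, Lagrange.interpolate_apply,
        Polynomial.eval_finsetSum] at h3
      rw [h3]
      refine Finset.sum_congr rfl fun j _ => ?_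
      simp [Matrix.vandermonde_apply, mul_comm]
    · rw [Matrix.updateRow_ne ha, Matrix.vandermonde_apply, Matrix.vandermonde_apply,
        Function.update_of_ne ha]
  rw [h, Matrix.det_updateRow_sum, smul_eq_mul]
  congr 1
  rw [Lagrange.basis, Polynomial.eval_prod]
  refine Finset.prod_congr rfl fun j _ => ?_
  simp [Lagrange.basisDivisor]

theorem detInvFact_lower {l : Fin N → ℤ} (hl : Function.Injective l) (i : Fin N) (k : ℕ) :
    detInvFact (lower l i k) = (descPochhammer ℂ k).eval (l i : ℂ) *
      (∏ j ∈ Finset.univ.erase i, ((l i : ℂ) - l j)⁻¹ * ((l i : ℂ) - k - l j)) *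
        detInvFact l := by
  have h1 : (fun j => (lower l i k j : ℂ)) =
      Function.update (fun j => (l j : ℂ)) i ((l i : ℂ) - k) := by
    ext j
    by_cases hj : j = i
    · subst hj
      simp
    · rw [lower_of_ne _ hj, Function.update_of_ne hj]
  have h2 : ∏ j, invFact (lower l i k j) =
      (descPochhammer ℂ k).eval (l i : ℂ) * ∏ j, invFact (l j) := by
    rw [← Finset.mul_prod_erase _ _ (Finset.mem_univ i),
      ← Finset.mul_prod_erase Finset.univ (fun j => invFact (l j)) (Finset.mem_univ i),
      lower_self, invFact_sub, mul_assoc]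
    congr 2
    exact Finset.prod_congr rfl fun j hj => by rw [lower_of_ne _ (Finset.ne_of_mem_erase hj)]
  rw [detInvFact_eq_vandermonde, detInvFact_eq_vandermonde, h1, h2,
    det_vandermonde_update (fun a b h => hl (Int.cast_injective h))]
  ring

theorem rowLen_pos {lam : YoungDiagram} {i : ℕ} (h : i < lam.colLen 0) : 0 < lam.rowLen i :=
  YoungDiagram.mem_iff_lt_rowLen.1 (YoungDiagram.mem_iff_lt_colLen.2 h)

/-- Count row `i` and one box in each other row. -/
theorem colLen_add_rowLen_le {lam : YoungDiagram} {i : ℕ} (h : i < lam.colLen 0) :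
    lam.colLen 0 + lam.rowLen i ≤ lam.card + 1 := by
  have h1 := sum_rowLen (le_refl (lam.colLen 0))
  rw [Fin.sum_univ_eq_sum_range fun i => lam.rowLen i,
    ← Finset.add_sum_erase _ _ (Finset.mem_range.2 h)] at h1
  have h2 : ((Finset.range (lam.colLen 0)).erase i).card • 1 ≤
      ∑ j ∈ (Finset.range (lam.colLen 0)).erase i, lam.rowLen j :=
    Finset.card_nsmul_le_sum _ _ _ fun j hj =>
      rowLen_pos (Finset.mem_range.1 (Finset.mem_of_mem_erase hj))
  rw [Finset.card_erase_of_mem (Finset.mem_range.2 h), Finset.card_range, smul_eq_mul] at h2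
  omega

theorem colLen_add_rowLen_zero_le {lam : YoungDiagram} (h : (1, 1) ∈ lam) :
    lam.colLen 0 + lam.rowLen 0 ≤ lam.card := by
  have h01 : (1, 0) ∈ lam := lam.up_left_mem le_rfl zero_le_one h
  have hR := YoungDiagram.mem_iff_lt_colLen.1 h01
  have hr := YoungDiagram.mem_iff_lt_rowLen.1 h
  have h1 := sum_rowLen (le_refl (lam.colLen 0))
  have m0 : 0 ∈ Finset.range (lam.colLen 0) := Finset.mem_range.2 (by omega)
  have m1 : 1 ∈ (Finset.range (lam.colLen 0)).erase 0 := by simp [hR]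
  rw [Fin.sum_univ_eq_sum_range fun i => lam.rowLen i,
    ← Finset.add_sum_erase _ _ m0, ← Finset.add_sum_erase _ _ m1] at h1
  have h2 : (((Finset.range (lam.colLen 0)).erase 0).erase 1).card • 1 ≤
      ∑ j ∈ ((Finset.range (lam.colLen 0)).erase 0).erase 1, lam.rowLen j :=
    Finset.card_nsmul_le_sum _ _ _ fun j hj =>
      rowLen_pos (Finset.mem_range.1 (Finset.mem_of_mem_erase (Finset.mem_of_mem_erase hj)))
  rw [Finset.card_erase_of_mem m1, Finset.card_erase_of_mem m0, Finset.card_range,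
    smul_eq_mul] at h2
  omega

/-- If `|λ| ≤ k`, lowering an entry by `k` kills the determinant unless `λ` is a hook of size `k`
and the first entry is lowered. -/
theorem eq_of_detInvFact_lower_ne_zero {k : ℕ} (hk : 1 ≤ k) {lam : YoungDiagram}
    (hlam : lam.card ≤ k) {i : Fin N}
    (h : detInvFact (lower (shiftedRows N lam) i k) ≠ 0) :
    (i : ℕ) = 0 ∧ lam.card = k ∧ (1, 1) ∉ lam := by
  have hnn : 0 ≤ shiftedRows N lam i - k := by
    by_contra! hneg
    exact h (detInvFact_of_neg (i := i) (by rwa [lower_self]))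
  have hne : ∀ j, j ≠ i → shiftedRows N lam i - k ≠ shiftedRows N lam j := by
    intro j hj he
    exact h (detInvFact_of_eq hj (by rw [lower_self, lower_of_ne _ hj, he]))
  have hrow : lam.rowLen i ≤ lam.card := by
    by_cases hi : (i : ℕ) < lam.colLen 0
    · have := colLen_add_rowLen_le hi
      omega
    · rw [rowLen_eq_zero (by omega)]
      omega
  rw [shiftedRows] at hnn
  -- The lowered entry is `N - 1 - q` with `q = i + k - λ_i`, rows counted from `0`; this is the
  -- entry of row `q` when that row is empty. So row `q` is nonempty unless `q = i`, and the bounds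
  -- on `|λ|` then leave only `i = 0` and a hook of size `k`.
  have hq : (i : ℕ) + k - lam.rowLen i < N := by omega
  have key : (i : ℕ) + k - lam.rowLen i ≠ i → (i : ℕ) + k - lam.rowLen i < lam.colLen 0 := by
    intro hqi
    by_contra! hqR
    refine hne ⟨_, hq⟩ (fun e => hqi (congrArg Fin.val e)) ?_
    rw [shiftedRows, shiftedRows, rowLen_eq_zero hqR]
    push_cast [show lam.rowLen i ≤ (i : ℕ) + k by omega]
    ring
  have hi : (i : ℕ) < lam.colLen 0 := by
    by_contra! hi
    have := rowLen_eq_zero hi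
    have := key (by omega)
    omega
  have hqR : (i : ℕ) + k - lam.rowLen i < lam.colLen 0 := by
    by_cases e : (i : ℕ) + k - lam.rowLen i = i
    · rwa [e]
    · exact key e
  have h1 := colLen_add_rowLen_le hi
  have hi0 : (i : ℕ) = 0 := by omega
  refine ⟨hi0, by omega, fun h11 => ?_⟩
  have := colLen_add_rowLen_zero_le h11
  rw [hi0] at hqR
  omega

/-- For the hook with arm `a` and leg `r`, padded to `r + t + 1` rows, this evaluates the one
surviving term of `cycleSum`. The ratio of the two products does not depend on the padding after the
falling factorial is included, hence the induction on `t`. -/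
theorem hook_prod_identity (a r t : ℕ) :
    (((a + 1 + (r + t)).descFactorial (a + 1 + r) : ℕ) : ℂ) *
        ∏ j ∈ Finset.range (r + t), (if j < r then (j : ℂ) - r else (j : ℂ) - r + 1) =
      ((a + 1 + r : ℕ) : ℂ) * ((-1) ^ r * r.factorial * a.factorial) *
        ∏ j ∈ Finset.range (r + t), (if j < r then (a : ℂ) + 1 + j else (a : ℂ) + 2 + j) := by
  induction t with
  | zero =>
    have h1 : ∏ j ∈ Finset.range r, (if j < r then (j : ℂ) - r else (j : ℂ) - r + 1) =
        (-1) ^ r * r.factorial := by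
      rw [← Finset.prod_range_reflect, ← Finset.prod_range_add_one_eq_factorial, Nat.cast_prod]
      have hpow : (-1 : ℂ) ^ r = ∏ _j ∈ Finset.range r, (-1 : ℂ) := by simp
      rw [hpow, ← Finset.prod_mul_distrib]
      refine Finset.prod_congr rfl fun j hj => ?_
      rw [Finset.mem_range] at hj
      rw [if_pos (by omega), Nat.cast_sub (by omega), Nat.cast_sub (by omega)]
      push_cast
      ring
    have h2 : (a.factorial : ℂ) *
        ∏ j ∈ Finset.range r, (if j < r then (a : ℂ) + 1 + j else (a : ℂ) + 2 + j) =
        (a + r).factorial := by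
      rw [← Nat.factorial_mul_ascFactorial, Nat.ascFactorial_eq_prod_range]
      push_cast
      congr 1
      refine Finset.prod_congr rfl fun j hj => ?_
      rw [if_pos (Finset.mem_range.1 hj)]
    rw [add_zero, h1, Nat.descFactorial_self, show a + 1 + r = a + r + 1 by ring,
      Nat.factorial_succ, Nat.cast_mul, ← h2]
    ring
  | succ t ih =>
    rw [← add_assoc r t 1, Finset.prod_range_succ, Finset.prod_range_succ, if_neg (by omega),
      if_neg (by omega)]
    have h := Nat.succ_descFactorial (a + 1 + (r + t)) (a + 1 + r)
    rw [show a + 1 + (r + t) + 1 - (a + 1 + r) = t + 1 by omega] at h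
    have h' := congrArg (Nat.cast : ℕ → ℂ) h
    push_cast at h'
    rw [← add_assoc (a + 1) (r + t) 1]
    push_cast at ih ⊢
    linear_combination (a + 2 + (r + t) : ℂ) * ih +
      (∏ j ∈ Finset.range (r + t), (if j < r then (j : ℂ) - r else (j : ℂ) - r + 1)) * h'

theorem prod_content_hook {lam : YoungDiagram} (h0 : (0, 0) ∈ lam) (h : (1, 1) ∉ lam) :
    ∏ c ∈ lam.cells.erase (0, 0), content c =
      (-1) ^ (lam.colLen 0 - 1) * (lam.colLen 0 - 1).factorial *
        (lam.rowLen 0 - 1).factorial := by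
  have hR := YoungDiagram.mem_iff_lt_colLen.1 h0
  have hr := YoungDiagram.mem_iff_lt_rowLen.1 h0
  have hcells : lam.cells.erase (0, 0) =
      (Finset.range (lam.colLen 0 - 1)).image (fun i => (i + 1, 0)) ∪
        (Finset.range (lam.rowLen 0 - 1)).image (fun j => (0, j + 1)) := by
    ext ⟨i, j⟩
    simp only [Finset.mem_erase, Finset.mem_union, Finset.mem_image, Finset.mem_range,
      Prod.mk.injEq, ne_eq, YoungDiagram.mem_cells]
    constructor
    · rintro ⟨hne, hc⟩
      rcases Nat.eq_zero_or_pos i with rfl | hi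
      · have := YoungDiagram.mem_iff_lt_rowLen.1 hc
        exact Or.inr ⟨j - 1, by omega, rfl, by omega⟩
      · rcases Nat.eq_zero_or_pos j with rfl | hj
        · have := YoungDiagram.mem_iff_lt_colLen.1 hc
          exact Or.inl ⟨i - 1, by omega, by omega, rfl⟩
        · exact absurd (lam.up_left_mem hi hj hc) h
    · rintro (⟨m, hm, rfl, rfl⟩ | ⟨m, hm, rfl, rfl⟩)
      · exact ⟨by simp, YoungDiagram.mem_iff_lt_colLen.2 (by omega)⟩
      · exact ⟨by simp, YoungDiagram.mem_iff_lt_rowLen.2 (by omega)⟩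
  rw [hcells, Finset.prod_union, Finset.prod_image, Finset.prod_image]
  · have h1 : ∀ m : ℕ, ∏ i ∈ Finset.range m, content (i + 1, 0) = (-1) ^ m * m.factorial := by
      intro m
      induction m with
      | zero => simp
      | succ m ih =>
        rw [Finset.prod_range_succ, ih, content, Nat.factorial_succ]
        push_cast
        ring
    have h2 : ∀ m : ℕ, ∏ i ∈ Finset.range m, content (0, i + 1) = m.factorial := by
      intro m
      induction m with
      | zero => simp
      | succ m ih =>
        rw [Finset.prod_range_succ, ih, content, Nat.factorial_succ]
        push_cast
        ring
    rw [h1, h2]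
  · intro a _ b _ hab
    simpa using hab
  · intro a _ b _ hab
    simpa using hab
  · rw [Finset.disjoint_left]
    simp only [Finset.mem_image, not_exists, not_and]
    rintro _ ⟨a, _, rfl⟩ b _ hb
    simp at hb

/-- Off hooks both sides vanish, as the box `(1, 1)` has content `0`. On a hook only the lowering of
the first entry survives. -/
theorem cycleSum_of_card_eq {k : ℕ} (hk : 2 ≤ k) {lam : YoungDiagram} (hN : lam.colLen 0 ≤ N)
    (hlam : lam.card = k) :
    cycleSum k (shiftedRows N lam) =
      k * (∏ c ∈ lam.cells.erase (0, 0), content c) * detInvFact (shiftedRows N lam) := by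
  by_cases h11 : (1, 1) ∈ lam
  · rw [Finset.prod_eq_zero (i := (1, 1))]
    · rw [mul_zero, zero_mul]
      refine Finset.sum_eq_zero fun i _ => ?_
      by_contra h
      exact (eq_of_detInvFact_lower_ne_zero (by omega) hlam.le h).2.2 h11
    · rw [Finset.mem_erase]
      exact ⟨by simp, h11⟩
    · simp [content]
  have h00 : (0, 0) ∈ lam := by
    obtain ⟨c, hc⟩ : lam.cells.Nonempty := Finset.card_pos.1 (by rw [← YoungDiagram.card]; omega)
    exact lam.up_left_mem (Nat.zero_le _) (Nat.zero_le _) hc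
  have hR := YoungDiagram.mem_iff_lt_colLen.1 h00
  have hr := YoungDiagram.mem_iff_lt_rowLen.1 h00
  have hrow : ∀ j, lam.rowLen (j + 1) = if j < lam.colLen 0 - 1 then 1 else 0 := by
    intro j
    split_ifs with hj
    · have h1 := rowLen_pos (show j + 1 < lam.colLen 0 by omega)
      have h2 : ¬ 1 < lam.rowLen (j + 1) := fun hlt =>
        h11 (lam.up_left_mem (by omega) le_rfl (YoungDiagram.mem_iff_lt_rowLen.2 hlt))
      omega
    · exact rowLen_eq_zero (by omega)
  obtain ⟨M, rfl⟩ : ∃ M, N = M + 1 := ⟨N - 1, by omega⟩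
  obtain ⟨r, hr'⟩ : ∃ r, lam.colLen 0 = r + 1 := ⟨lam.colLen 0 - 1, by omega⟩
  obtain ⟨a, ha⟩ : ∃ a, lam.rowLen 0 = a + 1 := ⟨lam.rowLen 0 - 1, by omega⟩
  obtain ⟨t, rfl⟩ : ∃ t, M = r + t := ⟨M - r, by omega⟩
  rw [hr', Nat.add_sub_cancel] at hrow
  have hcard : k = a + 1 + r := by
    have h1 := sum_rowLen (le_refl (lam.colLen 0))
    rw [hr', Fin.sum_univ_succ] at h1
    simp only [Fin.val_succ, hrow, Fin.val_zero, ha] at h1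
    rw [Finset.sum_congr rfl fun (j : Fin r) _ => if_pos j.2] at h1
    simp at h1
    omega
  rw [prod_content_hook h00 h11, hr', ha, Nat.add_sub_cancel, Nat.add_sub_cancel, cycleSum,
    Finset.sum_eq_single (0 : Fin (r + t + 1)), detInvFact_lower (shiftedRows_injective _ _)]
  · congr 1
    have herase : (Finset.univ.erase (0 : Fin (r + t + 1))) =
        Finset.univ.map (Fin.succEmb (r + t)) := by
      ext j
      simp [Fin.exists_succ_eq]
    rw [herase, Finset.prod_map, Finset.prod_mul_distrib, Finset.prod_inv_distrib]
    have hl0 : shiftedRows (r + t + 1) lam 0 = ((a + 1 + (r + t) : ℕ) : ℤ) := by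
      simp only [shiftedRows, Fin.val_zero, ha]
      push_cast
      ring
    have hls : ∀ j : Fin (r + t), shiftedRows (r + t + 1) lam j.succ =
        (if (j : ℕ) < r then 1 else 0) + (r + t - 1 - (j : ℕ) : ℤ) := by
      intro j
      simp only [shiftedRows, Fin.val_succ, hrow]
      push_cast
      ring
    have hden : ∏ j : Fin (r + t), ((shiftedRows (r + t + 1) lam 0 : ℂ) -
        shiftedRows (r + t + 1) lam (Fin.succEmb (r + t) j)) =
        ∏ j ∈ Finset.range (r + t), (if j < r then (a : ℂ) + 1 + j else (a : ℂ) + 2 + j) := by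
      rw [← Fin.prod_univ_eq_prod_range]
      refine Finset.prod_congr rfl fun j _ => ?_
      rw [Fin.coe_succEmb, hls, hl0]
      split_ifs <;> push_cast <;> ring
    have hnum : ∏ j : Fin (r + t), ((shiftedRows (r + t + 1) lam 0 : ℂ) - k -
        shiftedRows (r + t + 1) lam (Fin.succEmb (r + t) j)) =
        ∏ j ∈ Finset.range (r + t), (if j < r then (j : ℂ) - r else (j : ℂ) - r + 1) := by
      rw [← Fin.prod_univ_eq_prod_range]
      refine Finset.prod_congr rfl fun j _ => ?_
      rw [Fin.coe_succEmb, hls, hl0, hcard]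
      split_ifs <;> push_cast <;> ring
    have hne : ∏ j ∈ Finset.range (r + t),
        (if j < r then (a : ℂ) + 1 + j else (a : ℂ) + 2 + j) ≠ 0 := by
      refine Finset.prod_ne_zero_iff.2 fun j _ => ?_
      split_ifs
      · exact_mod_cast (by omega : a + 1 + j ≠ 0)
      · exact_mod_cast (by omega : a + 2 + j ≠ 0)
    rw [hden, hnum, hl0, Int.cast_natCast, descPochhammer_eval_eq_descFactorial, hcard,
      mul_left_comm, hook_prod_identity, mul_comm, mul_assoc, mul_inv_cancel₀ hne, mul_one]
  · intro i _ hi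
    by_contra h
    exact hi (Fin.ext (eq_of_detInvFact_lower_ne_zero (by omega) hlam.le h).1)
  · intro h
    exact absurd (Finset.mem_univ _) h

theorem cycles_eq_empty {α : Type} [Fintype α] [DecidableEq α] {k : ℕ}
    (h : Fintype.card α < k) : cycles α k = ∅ := by
  refine Finset.eq_empty_of_forall_notMem fun g hg => ?_
  rw [mem_cycles] at hg
  have h1 := Equiv.Perm.sum_cycleType g
  rw [hg, Multiset.sum_singleton] at h1
  have := Finset.card_le_univ g.support
  omega

theorem diagCyc_eq_zero {k : ℕ} {lam : YoungDiagram} (h : lam.card < k) : diagCyc k lam = 0 := by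
  rw [diagCyc, cycScalar, cycSum, cycles_eq_empty]
  · simp
  · rwa [Fintype.card_coe]

/-- The Frobenius formula for the central character of `k`-cycles. -/
theorem diagCyc_mul_detInvFact {k : ℕ} (hk : 2 ≤ k) {lam : YoungDiagram}
    (h : lam.colLen 0 ≤ N) :
    k * diagCyc k lam * detInvFact (shiftedRows N lam) = cycleSum k (shiftedRows N lam) := by
  rcases lt_or_ge lam.card k with hlt | hge
  · rw [diagCyc_eq_zero hlt, mul_zero, zero_mul]
    symm
    refine Finset.sum_eq_zero fun i _ => ?_
    by_contra hne
    have := (eq_of_detInvFact_lower_ne_zero (by omega) hlt.le hne).2.1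
    omega
  obtain ⟨m, hm⟩ : ∃ m, lam.card = k + m := ⟨lam.card - k, by omega⟩
  -- In the step, `diagCyc_branching` and `sum_cycleSum_lower` express the two sides through the
  -- corners; both carry the nonzero factor `|λ| - k = m + 1`, and `diagDim_eq` converts dimensions
  -- into determinants.
  induction m generalizing lam with
  | zero => rw [diagCyc_card hk hm, cycleSum_of_card_eq hk h hm]
  | succ m ih =>
    have h1 := sum_lower_eq_sum_corners h (cycleSum k)
      (fun _ _ => cycleSum_of_neg (Int.natCast_nonneg k)) (fun _ _ _ => cycleSum_of_eq)
    rw [sum_cycleSum_lower, excess_shiftedRows h] at h1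
    have h2 := diagCyc_branching hk (show k ≤ k + m by omega) (show lam.card = k + m + 1 from hm)
    have h3 : ∀ c ∈ corners lam, ((k : ℂ) * detInvFact (shiftedRows N ⊥)) *
        (diagCyc k (remBox lam c) * diagDim (remBox lam c)) =
          (k + m).factorial * cycleSum k (shiftedRows N (remBox lam c)) := by
      intro c hc
      have hcc := card_remBox hc
      have hN := (colLen_remBox_le hc).trans h
      have e := diagDim_eq hN
      rw [show (remBox lam c).card = k + m by omega] at e
      rw [← ih hN (by omega) (by omega)]
      linear_combination (k * diagCyc k (remBox lam c)) * e
    have e := diagDim_eq h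
    rw [hm, ← add_assoc, Nat.factorial_succ] at e
    have h4 := congrArg (fun x => ((k : ℂ) * detInvFact (shiftedRows N ⊥)) * x) h2
    rw [mul_left_comm _ ((k + m : ℕ) + 1 : ℂ), Finset.mul_sum, Finset.sum_congr rfl h3,
      ← Finset.mul_sum, ← h1, hm, show k + m + 1 - k = m + 1 by omega] at h4
    have hf : ((k + m).factorial : ℂ) ≠ 0 := by exact_mod_cast Nat.factorial_ne_zero _
    have hkm : ((k : ℂ) + m + 1) ≠ 0 := by exact_mod_cast (by omega : k + m + 1 ≠ 0)
    have hm1 : ((m : ℂ) + 1) ≠ 0 := by exact_mod_cast (by omega : m + 1 ≠ 0)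
    refine mul_left_cancel₀ (mul_ne_zero (mul_ne_zero hm1 hkm) hf) ?_
    push_cast at h4 e ⊢
    linear_combination h4 - ((m : ℂ) + 1) * k * diagCyc k lam * e

end

noncomputable section

open Equiv (Perm)

/-! ### The central character of the class of `k`-cycles -/

theorem mem_specht_iff {lam : YoungDiagram} {v : MonoidAlgebra ℂ (BoxPerm lam)} :
    v ∈ Specht lam ↔ v ∈ leftIdeal (tabSymm (boxTab lam)) := by
  have h : youngSymmetrizer lam = tabSymm (boxTab lam) := rfl
  rw [Submodule.mem_span_singleton, mem_leftIdeal, h]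
  rfl

/-- The Specht module as a left ideal. -/
def spechtEquiv (lam : YoungDiagram) : Specht lam ≃ₗ[ℂ] leftIdeal (tabSymm (boxTab lam)) where
  toFun v := ⟨v, mem_specht_iff.1 v.2⟩
  invFun v := ⟨v, mem_specht_iff.2 v.2⟩
  map_add' _ _ := rfl
  map_smul' _ _ := rfl
  left_inv _ := rfl
  right_inv _ := rfl

theorem chi_eq_idealTrace (lam : YoungDiagram) (g : BoxPerm lam) :
    chi lam g = idealTrace (tabSymm (boxTab lam)) (MonoidAlgebra.single g 1) := by
  have h : leftAction (tabSymm (boxTab lam)) (MonoidAlgebra.single g 1) =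
      (spechtEquiv lam).conj (spechtRep lam g) := by
    ext v : 2
    rfl
  change LinearMap.trace ℂ _ (spechtRep lam g) = LinearMap.trace ℂ _ (leftAction _ _)
  rw [h, LinearMap.trace_conj']

theorem chi_one (lam : YoungDiagram) : chi lam 1 = diagDim lam := by
  rw [chi_eq_idealTrace, ← MonoidAlgebra.one_def,
    idealTrace_of_scalar (c := 1) (fun x => by simp) (by simp), one_mul, diagDim]

/-- Class size times character value is the trace of the class sum, which acts by a scalar; dividing
by the dimension leaves the scalar. If there are no such cycles the class sum is empty. -/
theorem fCycle_eq_diagCyc (k : ℕ) (lam : YoungDiagram) :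
    fCycle k lam = diagCyc k lam := by
  classical
  rw [fCycle]
  split_ifs with h
  · have hg := h.choose_spec
    set g := h.choose
    have hcar : ∀ x, x ∈ (ConjClasses.mk g).carrier ↔ x.cycleType = {k} := by
      intro x
      rw [ConjClasses.mem_carrier_iff_mk_eq, ConjClasses.mk_eq_mk_iff_isConj,
        Equiv.Perm.isConj_iff_cycleType_eq, hg]
    have hcard : Nat.card (ConjClasses.mk g).carrier = (cycles _ k : Finset (BoxPerm lam)).card := by
      rw [← Set.ncard_coe_finset, Set.ncard]
      congr 2
      ext x
      rw [hcar, Finset.mem_coe, mem_cycles]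
    have hout : (Quotient.out (ConjClasses.mk g) : BoxPerm lam).cycleType = {k} := by
      rw [← hcar, ConjClasses.mem_carrier_iff_mk_eq]
      exact Quotient.out_eq _
    have hsum : (Nat.card (ConjClasses.mk g).carrier : ℂ) *
        chi lam (Quotient.out (ConjClasses.mk g)) =
        idealTrace (tabSymm (boxTab lam)) (cycSum _ k) := by
      rw [cycSum, map_sum, hcard, ← nsmul_eq_mul, ← Finset.sum_const]
      refine Finset.sum_congr rfl fun x hx => ?_
      rw [chi_eq_idealTrace]
      refine idealTrace_conj _ ?_
      rw [Equiv.Perm.isConj_iff_cycleType_eq, hout, mem_cycles.1 hx]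
    rw [centralCharacter, hsum, idealTrace_of_scalar (cycSum_central k)
      (cycSum_mul_tabSymm (isTableau_boxTab lam) k), chi_one, ← diagDim,
      mul_div_assoc, div_self (by exact_mod_cast (diagDim_pos lam).ne'), mul_one, diagCyc]
  · rw [diagCyc, cycScalar, cycSum, Finset.sum_eq_zero]
    · simp
    · intro g hg
      exact absurd ⟨g, mem_cycles.1 hg⟩ h

end

noncomputable section

open PowerSeries (coeff constantCoeff derivative)

/-! ### Exponentials of power series -/

section ExpSeries

variable {R S : Type*} [CommRing R] [Algebra ℂ R] [CommRing S] [Algebra ℂ S]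

/-- The exponential of a power series without constant term. -/
def expSeries (A : PowerSeries R) : PowerSeries R := (PowerSeries.exp ℂ).subst A

theorem constantCoeff_expSeries {A : PowerSeries R} (hA : constantCoeff A = 0) :
    constantCoeff (expSeries A) = 1 := by
  rw [← PowerSeries.coeff_zero_eq_constantCoeff_apply, expSeries,
    PowerSeries.coeff_subst' (PowerSeries.HasSubst.of_constantCoeff_zero' hA),
    finsum_eq_single _ 0]
  · simp
  · intro n hn
    simp [hA, hn]

theorem derivative_expSeries {A : PowerSeries R} (hA : constantCoeff A = 0) :
    derivative R (expSeries A) = derivative R A * expSeries A := by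
  -- `PowerSeries.exp R` needs a rational structure on `R`; taking it through `ℂ` makes the two
  -- exponentials agree coefficientwise.
  let _ : Algebra ℚ R := Algebra.compHom R (algebraMap ℚ ℂ)
  have hs := PowerSeries.HasSubst.of_constantCoeff_zero' hA
  have h : expSeries A = (PowerSeries.exp R).subst A := by
    ext n
    rw [expSeries, PowerSeries.coeff_subst' hs, PowerSeries.coeff_subst' hs]
    refine finsum_congr fun d => ?_
    rw [PowerSeries.coeff_exp, PowerSeries.coeff_exp,
      show (algebraMap ℚ R) (1 / d.factorial) = algebraMap ℂ R (algebraMap ℚ ℂ (1 / d.factorial))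
        from rfl, smul_eq_mul, ← Algebra.smul_def]
  rw [h, PowerSeries.derivative_subst hs, PowerSeries.derivative_exp, mul_comm]

theorem natCast_mul_right_injective {n : ℕ} {x y : R} (h : x * (n + 1) = y * (n + 1)) :
    x = y := by
  have h1 : ((n : R) + 1) * algebraMap ℂ R ((n : ℂ) + 1)⁻¹ = 1 := by
    have h2 : ((n : R) + 1) = algebraMap ℂ R ((n : ℂ) + 1) := by simp
    have h3 : (n : ℂ) + 1 ≠ 0 := by exact_mod_cast n.succ_ne_zero
    rw [h2, ← map_mul, mul_inv_cancel₀ h3, map_one]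
  calc x = x * (n + 1) * algebraMap ℂ R ((n : ℂ) + 1)⁻¹ := by rw [mul_assoc, h1, mul_one]
    _ = y := by rw [h, mul_assoc, h1, mul_one]

/-- The equation determines `n + 1` times coefficient `n + 1` from the earlier ones, and `n + 1` is
invertible in a complex algebra. -/
theorem eq_of_derivative_eq_mul {B E F : PowerSeries R} (hE : derivative R E = B * E)
    (hF : derivative R F = B * F) (h0 : constantCoeff E = constantCoeff F) : E = F := by
  ext n
  induction n using Nat.strong_induction_on with
  | _ n ih =>
    rcases n with _ | n
    · simpa using h0
    · have h1 := congrArg (coeff n) hE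
      have h2 := congrArg (coeff n) hF
      rw [PowerSeries.coeff_derivative, PowerSeries.coeff_mul] at h1 h2
      refine natCast_mul_right_injective (n := n) ?_
      rw [h1, h2]
      refine Finset.sum_congr rfl fun p hp => ?_
      have := Finset.HasAntidiagonal.mem_antidiagonal.1 hp
      rw [ih p.2 (by omega)]

theorem eq_expSeries {A E : PowerSeries R} (hA : constantCoeff A = 0)
    (h0 : constantCoeff E = 1) (h : derivative R E = derivative R A * E) : E = expSeries A :=
  eq_of_derivative_eq_mul h (derivative_expSeries hA) (by rw [h0, constantCoeff_expSeries hA])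

theorem expSeries_zero : expSeries (0 : PowerSeries R) = 1 :=
  (eq_expSeries (map_zero _) (map_one _) (by simp)).symm

theorem expSeries_add {A B : PowerSeries R} (hA : constantCoeff A = 0)
    (hB : constantCoeff B = 0) : expSeries (A + B) = expSeries A * expSeries B := by
  symm
  refine eq_expSeries (by rw [map_add, hA, hB, add_zero]) ?_ ?_
  · rw [map_mul, constantCoeff_expSeries hA, constantCoeff_expSeries hB, one_mul]
  · rw [Derivation.leibniz, derivative_expSeries hA, derivative_expSeries hB, map_add,
      smul_eq_mul, smul_eq_mul]
    ring

theorem expSeries_sum {ι : Type*} (s : Finset ι) {A : ι → PowerSeries R}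
    (hA : ∀ i, constantCoeff (A i) = 0) :
    expSeries (∑ i ∈ s, A i) = ∏ i ∈ s, expSeries (A i) := by
  classical
  induction s using Finset.induction_on with
  | empty => simp [expSeries_zero]
  | insert a s ha ih =>
    rw [Finset.sum_insert ha, Finset.prod_insert ha, expSeries_add (hA a), ih]
    simp [hA]

theorem expSeries_nsmul (n : ℕ) {A : PowerSeries R} (hA : constantCoeff A = 0) :
    expSeries (n • A) = expSeries A ^ n := by
  have := expSeries_sum (Finset.range n) (A := fun _ => A) fun _ => hA
  simpa using this

theorem map_expSeries (φ : R →+* S) {A : PowerSeries R} (hA : constantCoeff A = 0) :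
    PowerSeries.map φ (expSeries A) = expSeries (PowerSeries.map φ A) := by
  have hd : ∀ E : PowerSeries R, derivative S (PowerSeries.map φ E) =
      PowerSeries.map φ (derivative R E) := by
    intro E
    ext n
    simp [PowerSeries.coeff_derivative]
  refine eq_expSeries ?_ ?_ ?_
  · rw [← PowerSeries.coeff_zero_eq_constantCoeff_apply, PowerSeries.coeff_map,
      PowerSeries.coeff_zero_eq_constantCoeff_apply, hA, map_zero]
  · rw [← PowerSeries.coeff_zero_eq_constantCoeff_apply, PowerSeries.coeff_map,
      PowerSeries.coeff_zero_eq_constantCoeff_apply, constantCoeff_expSeries hA, map_one]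
  · rw [hd, hd, derivative_expSeries hA, map_mul]

/-- The logarithm of `1 - a z`. -/
def logFactor (a : R) : PowerSeries R :=
  -- The convention `0⁻¹ = 0` makes the constant term vanish.
  PowerSeries.mk fun n => -((n : ℂ)⁻¹ • a ^ n)

theorem constantCoeff_logFactor (a : R) : constantCoeff (logFactor a) = 0 := by
  simp [logFactor, ← PowerSeries.coeff_zero_eq_constantCoeff_apply]

theorem coeff_succ_one_sub_mul (a : R) (f : PowerSeries R) (n : ℕ) :
    coeff (n + 1) ((1 - PowerSeries.C a * PowerSeries.X) * f) =
      coeff (n + 1) f - a * coeff n f := by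
  rw [sub_mul, one_mul, map_sub, mul_assoc, PowerSeries.coeff_C_mul,
    PowerSeries.coeff_succ_X_mul]

theorem coeff_zero_one_sub_mul (a : R) (f : PowerSeries R) :
    coeff 0 ((1 - PowerSeries.C a * PowerSeries.X) * f) = coeff 0 f := by
  simp

theorem expSeries_logFactor (a : R) :
    expSeries (logFactor a) = 1 - PowerSeries.C a * PowerSeries.X := by
  symm
  refine eq_expSeries (constantCoeff_logFactor a) (by simp) ?_
  have h : ∀ n, coeff n (derivative R (logFactor a)) = -a ^ (n + 1) := by
    intro n
    rw [PowerSeries.coeff_derivative, logFactor, PowerSeries.coeff_mk]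
    have h2 : ((n : R) + 1) = algebraMap ℂ R ((n : ℂ) + 1) := by simp
    have h3 : (n : ℂ) + 1 ≠ 0 := by exact_mod_cast n.succ_ne_zero
    rw [h2, mul_comm, ← Algebra.smul_def, smul_neg, smul_smul]
    push_cast
    rw [mul_inv_cancel₀ h3, one_smul]
  rw [mul_comm (derivative R (logFactor a))]
  ext n
  rcases n with _ | n
  · rw [coeff_zero_one_sub_mul, h]
    simp
  · rw [coeff_succ_one_sub_mul, h, h, PowerSeries.coeff_derivative, map_sub,
      PowerSeries.coeff_C_mul, PowerSeries.coeff_X, PowerSeries.coeff_one]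
    simp
    ring

end ExpSeries

/-! ### Divided differences and geometric series -/

section Geometric

/-- The series `∑ a ^ n z ^ n`. -/
def geomSeries (a : ℂ) : PowerSeries ℂ := PowerSeries.mk fun n => a ^ n

theorem one_sub_mul_geomSeries (a : ℂ) :
    (1 - PowerSeries.C a * PowerSeries.X) * geomSeries a = 1 := by
  ext n
  rcases n with _ | n
  · rw [coeff_zero_one_sub_mul]
    simp [geomSeries]
  · rw [coeff_succ_one_sub_mul, geomSeries, PowerSeries.coeff_mk, PowerSeries.coeff_mk,
      PowerSeries.coeff_one]
    simp
    ring

/-- A factor `1 - b z` subtracts `b` times the previous coefficient, which turns `u ^ (n + 1)` into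
`u ^ n * (u - b)`. -/
theorem coeff_prod_mul_geomSeries {ι : Type*} (s : Finset ι) (a : ι → ℂ) (u : ℂ) (n : ℕ) :
    coeff (n + s.card) ((∏ i ∈ s, (1 - PowerSeries.C (a i) * PowerSeries.X)) * geomSeries u) =
      u ^ n * ∏ i ∈ s, (u - a i) := by
  classical
  induction s using Finset.induction_on generalizing n with
  | empty => simp [geomSeries]
  | insert b s hb ih =>
    have h := ih (n + 1)
    rw [add_right_comm] at h
    rw [Finset.prod_insert hb, Finset.prod_insert hb, Finset.card_insert_of_notMem hb, mul_assoc,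
      ← add_assoc, coeff_succ_one_sub_mul, h, ih]
    ring

/-- This is the partial fraction expansion of `z ^ n / ∏ (1 - u i z)`. Up to degree `n` the
coefficients of the sum come from Lagrange interpolation of monomials; above degree `n` the product
has none, as each term contains the factor `u i - u i`. -/
theorem prod_mul_sum_geomSeries {n : ℕ} {u : Fin (n + 1) → ℂ} (hu : Function.Injective u) :
    (∏ i, (1 - PowerSeries.C (u i) * PowerSeries.X)) *
      ∑ i, PowerSeries.C (∏ j ∈ Finset.univ.erase i, (u i - u j))⁻¹ * geomSeries (u i) =
        PowerSeries.X ^ n := by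
  set Ψ := ∑ i, PowerSeries.C (∏ j ∈ Finset.univ.erase i, (u i - u j))⁻¹ * geomSeries (u i)
    with hΨ
  have hlow : ∀ m ≤ n, coeff m Ψ = if m = n then 1 else 0 := by
    intro m hm
    have h := Lagrange.coeff_eq_sum (s := Finset.univ) (v := u) hu.injOn
      (P := (Polynomial.X : Polynomial ℂ) ^ m) (by
        rw [Polynomial.degree_X_pow, Finset.card_univ, Fintype.card_fin]
        exact_mod_cast Nat.lt_succ_of_le hm)
    rw [Finset.card_univ, Fintype.card_fin, Nat.add_sub_cancel, Polynomial.coeff_X_pow] at h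
    rw [hΨ, map_sum]
    simp only [eq_comm (a := m), h]
    refine Finset.sum_congr rfl fun i _ => ?_
    rw [PowerSeries.coeff_C_mul, geomSeries, PowerSeries.coeff_mk, Polynomial.eval_pow,
      Polynomial.eval_X, div_eq_inv_mul]
  ext m
  rcases le_or_gt m n with hm | hm
  · obtain ⟨Θ, hΘ⟩ : (PowerSeries.X : PowerSeries ℂ) ^ n ∣ Ψ :=
      PowerSeries.X_pow_dvd_iff.2 fun m hm => by rw [hlow m hm.le, if_neg hm.ne]
    have hΘ0 : constantCoeff Θ = 1 := by
      have := hlow n le_rfl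
      rw [hΘ, if_pos rfl, mul_comm] at this
      simpa [PowerSeries.coeff_mul_X_pow'] using this
    rw [hΘ, mul_left_comm, PowerSeries.coeff_X_pow_mul', PowerSeries.coeff_X_pow]
    rcases hm.eq_or_lt with rfl | hlt
    · simp [hΘ0]
    · rw [if_neg (by omega), if_neg (by omega)]
  · rw [PowerSeries.coeff_X_pow, if_neg (by omega), hΨ, Finset.mul_sum, map_sum]
    refine Finset.sum_eq_zero fun i _ => ?_
    obtain ⟨q, rfl⟩ : ∃ q, m = q + (n + 1) := ⟨m - (n + 1), by omega⟩
    have h := coeff_prod_mul_geomSeries Finset.univ u (u i) q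
    rw [Finset.card_univ, Fintype.card_fin] at h
    rw [mul_left_comm, PowerSeries.coeff_C_mul, h,
      Finset.prod_eq_zero (Finset.mem_univ i) (sub_self _), mul_zero, mul_zero]

/-- Divided differences of a product of linear factors. -/
theorem sum_prod_div_eq_coeff {ι : Type*} {n m : ℕ} {u : Fin n → ℂ} (hu : Function.Injective u)
    (s : Finset ι) (a : ι → ℂ) (hs : s.card + 1 = m + n) :
    ∑ i, (∏ j ∈ s, (u i - a j)) / ∏ j ∈ Finset.univ.erase i, (u i - u j) =
      coeff m ((∏ j ∈ s, (1 - PowerSeries.C (a j) * PowerSeries.X)) *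
        ∏ i, geomSeries (u i)) := by
  -- Without nodes the left side is an empty sum, and on the right a product of `s.card` linear
  -- factors has no term of degree `m = s.card + 1`.
  rcases n with _ | n
  · have h := coeff_prod_mul_geomSeries s a 0 1
    have h0 : geomSeries 0 = 1 := by
      have := one_sub_mul_geomSeries 0
      simpa using this
    rw [h0, pow_one, zero_mul, mul_one, show 1 + s.card = m by omega] at h
    simp [h]
  · have h1 : ∑ i, PowerSeries.C (∏ j ∈ Finset.univ.erase i, (u i - u j))⁻¹ * geomSeries (u i) =
        PowerSeries.X ^ n * ∏ i, geomSeries (u i) := by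
      rw [← prod_mul_sum_geomSeries hu, mul_right_comm, ← Finset.prod_mul_distrib]
      simp [one_sub_mul_geomSeries]
    have h2 : coeff (m + n) ((∏ j ∈ s, (1 - PowerSeries.C (a j) * PowerSeries.X)) *
        (PowerSeries.X ^ n * ∏ i, geomSeries (u i))) =
        coeff m ((∏ j ∈ s, (1 - PowerSeries.C (a j) * PowerSeries.X)) *
          ∏ i, geomSeries (u i)) := by
      rw [mul_left_comm, PowerSeries.coeff_X_pow_mul]
    rw [← h2, ← h1, Finset.mul_sum, map_sum]
    refine Finset.sum_congr rfl fun i _ => ?_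
    have h := coeff_prod_mul_geomSeries s a (u i) 0
    rw [mul_left_comm, PowerSeries.coeff_C_mul, show m + n = 0 + s.card by omega, h, pow_zero,
      one_mul, div_eq_inv_mul]

end Geometric

end

noncomputable section

open PowerSeries (coeff constantCoeff)

/-! ### The generating series of the central characters of cycles -/

section CycleSeries

variable {R S : Type*} [CommRing R] [Algebra ℂ R] [CommRing S] [Algebra ℂ S]

/-- The coefficient of `y ^ m` in `((y + k / 2) ^ j - (y - k / 2) ^ j) / j`. -/
def cycLogCoeff (k j m : ℕ) : ℂ :=
  (j : ℂ)⁻¹ * (j.choose m * (((k : ℂ) / 2) ^ (j - m) - (-((k : ℂ) / 2)) ^ (j - m)))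

/-- The logarithm of the generating series of `k`-cycles, in terms of power sums `P`. -/
def cycLog (k : ℕ) (P : ℕ → R) : PowerSeries R :=
  PowerSeries.mk fun j => -∑ m ∈ Finset.Ico 1 j, cycLogCoeff k j m • P m

theorem constantCoeff_cycLog (k : ℕ) (P : ℕ → R) : constantCoeff (cycLog k P) = 0 := by
  simp [cycLog, ← PowerSeries.coeff_zero_eq_constantCoeff_apply]

theorem map_cycLog (φ : R →ₐ[ℂ] S) (k : ℕ) (P : ℕ → R) :
    PowerSeries.map (φ : R →+* S) (cycLog k P) = cycLog k (fun m => φ (P m)) := by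
  ext j
  simp [cycLog]

variable (R) in
/-- The product of the factors `1 - (m - (k - 1) / 2) z`, `m < k`. -/
def centralFactor (k : ℕ) : PowerSeries R :=
  ∏ m ∈ Finset.range k, (1 - PowerSeries.C (algebraMap ℂ R (m - k / 2 + 1 / 2)) * PowerSeries.X)

theorem map_centralFactor (φ : R →ₐ[ℂ] S) (k : ℕ) :
    PowerSeries.map (φ : R →+* S) (centralFactor R k) = centralFactor S k := by
  simp [centralFactor, map_prod]

variable (R) in
theorem constantCoeff_centralFactor (k : ℕ) : constantCoeff (centralFactor R k) = 1 := by
  simp [centralFactor, map_prod]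

variable (R) in
-- The numbers `m - k / 2 + 1 / 2` with `m < k` are symmetric about `0`, so they sum to zero. The
-- induction runs over partial products, with the partial sums in closed form.
theorem coeff_one_centralFactor (k : ℕ) : coeff 1 (centralFactor R k) = 0 := by
  have h : ∀ n : ℕ, constantCoeff (∏ m ∈ Finset.range n,
      (1 - PowerSeries.C (algebraMap ℂ R (m - k / 2 + 1 / 2)) * PowerSeries.X)) = 1 ∧
      coeff 1 (∏ m ∈ Finset.range n,
      (1 - PowerSeries.C (algebraMap ℂ R (m - k / 2 + 1 / 2)) * PowerSeries.X)) =
      algebraMap ℂ R (n * (k - n) / 2) := by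
    intro n
    induction n with
    | zero => simp [PowerSeries.coeff_one]
    | succ n ih =>
      have h1 := coeff_succ_one_sub_mul (algebraMap ℂ R (n - k / 2 + 1 / 2)) (∏ m ∈ Finset.range n,
        (1 - PowerSeries.C (algebraMap ℂ R (m - k / 2 + 1 / 2)) * PowerSeries.X)) 0
      rw [zero_add, PowerSeries.coeff_zero_eq_constantCoeff_apply, ih.1, ih.2, mul_one,
        ← map_sub] at h1
      rw [Finset.prod_range_succ, mul_comm]
      refine ⟨by rw [map_mul, ih.1]; simp, h1.trans ?_⟩
      congr 1
      push_cast
      ring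
  rw [centralFactor, (h k).2]
  simp

end CycleSeries

/-- Both sides run over the progression of step one from `-N - k / 2 + 1 / 2` to `k / 2 - 1 / 2`,
cut at different places. This trades the factors from the falling factorial, which depend on `N`,
for `centralFactor`. -/
theorem prod_shift_centralFactor {k : ℕ} (hk : 1 ≤ k) (N : ℕ) :
    (∏ i ∈ Finset.range N, (1 - PowerSeries.C (-((i : ℂ) + 1) + 1 / 2 - k / 2) * PowerSeries.X)) *
      centralFactor ℂ k =
    (∏ m ∈ Finset.range k, (1 - PowerSeries.C ((m : ℂ) - k / 2 - N + 1 / 2) * PowerSeries.X)) *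
      ∏ i ∈ Finset.range N,
        (1 - PowerSeries.C (-((i : ℂ) + 1) + 1 / 2 + k / 2) * PowerSeries.X) := by
  obtain ⟨k, rfl⟩ : ∃ q, k = q + 1 := ⟨k - 1, by omega⟩
  induction N with
  | zero => simp [centralFactor]
  | succ N ih =>
    rw [Finset.prod_range_succ, mul_right_comm, ih, Finset.prod_range_succ _ N,
      Finset.prod_range_succ, Finset.prod_range_succ' _ k]
    have h1 : ∀ m : ℕ, ((m + 1 : ℕ) : ℂ) - (k + 1 : ℕ) / 2 - (N + 1 : ℕ) + 1 / 2 =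
        m - (k + 1 : ℕ) / 2 - N + 1 / 2 := by
      intro m
      push_cast
      ring
    have h2 : (k : ℂ) - (k + 1 : ℕ) / 2 - N + 1 / 2 = -((N : ℂ) + 1) + 1 / 2 + (k + 1 : ℕ) / 2 := by
      push_cast
      ring
    have h3 : ((0 : ℕ) : ℂ) - (k + 1 : ℕ) / 2 - (N + 1 : ℕ) + 1 / 2 =
        -((N : ℂ) + 1) + 1 / 2 - (k + 1 : ℕ) / 2 := by
      push_cast
      ring
    simp only [h1, h2, h3]
    ring

/-- In the binomial expansion of `(y + k/2)^j - (y - k/2)^j` the term `m = j` cancels, and the term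
`m = 0` is the same for `y` and `z`. Only the differences `y^m - z^m` with `1 ≤ m < j` remain. -/
theorem sum_logFactor_eq (k : ℕ) {ι : Type*} (s : Finset ι) (y z : ι → ℂ) :
    ∑ i ∈ s, (logFactor (y i + k / 2) + logFactor (z i - k / 2)) =
      cycLog k (fun m => ∑ i ∈ s, (y i ^ m - z i ^ m)) +
        ∑ i ∈ s, (logFactor (y i - k / 2) + logFactor (z i + k / 2)) := by
  have hexp : ∀ (j : ℕ) (a b : ℂ),
      (j : ℂ)⁻¹ * (((a + k / 2) ^ j - (a - k / 2) ^ j) - ((b + k / 2) ^ j - (b - k / 2) ^ j)) =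
      ∑ m ∈ Finset.Ico 1 j, cycLogCoeff k j m * (a ^ m - b ^ m) := by
    intro j a b
    rw [Finset.sum_subset (s₂ := Finset.range (j + 1))]
    · rw [sub_eq_add_neg a, sub_eq_add_neg b, add_pow, add_pow, add_pow, add_pow,
        ← Finset.sum_sub_distrib, ← Finset.sum_sub_distrib, ← Finset.sum_sub_distrib,
        Finset.mul_sum]
      refine Finset.sum_congr rfl fun m _ => ?_
      rw [cycLogCoeff]
      ring
    · intro m hm
      rw [Finset.mem_Ico] at hm
      rw [Finset.mem_range]
      omega
    · intro m hm hm'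
      rw [Finset.mem_Ico] at hm'
      rw [Finset.mem_range] at hm
      rcases Nat.eq_zero_or_pos m with rfl | hpos
      · simp
      · obtain rfl : m = j := by omega
        simp [cycLogCoeff]
  ext j
  rw [map_add, map_sum, map_sum, cycLog, PowerSeries.coeff_mk, neg_add_eq_sub, eq_sub_iff_add_eq]
  have h : ∑ m ∈ Finset.Ico 1 j, cycLogCoeff k j m • ∑ i ∈ s, (y i ^ m - z i ^ m) =
      ∑ i ∈ s, (j : ℂ)⁻¹ * (((y i + k / 2) ^ j - (y i - k / 2) ^ j) -
        ((z i + k / 2) ^ j - (z i - k / 2) ^ j)) := by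
    simp only [hexp, smul_eq_mul, Finset.mul_sum]
    exact Finset.sum_comm
  rw [h, ← Finset.sum_add_distrib]
  refine Finset.sum_congr rfl fun i _ => ?_
  simp only [map_add, logFactor, PowerSeries.coeff_mk, smul_eq_mul]
  ring

theorem prod_linear_eq_expSeries (k : ℕ) {ι : Type*} (s : Finset ι) (y z : ι → ℂ) :
    (∏ i ∈ s, (1 - PowerSeries.C (y i + k / 2) * PowerSeries.X)) *
      ∏ i ∈ s, (1 - PowerSeries.C (z i - k / 2) * PowerSeries.X) =
    expSeries (cycLog k fun m => ∑ i ∈ s, (y i ^ m - z i ^ m)) *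
      ((∏ i ∈ s, (1 - PowerSeries.C (y i - k / 2) * PowerSeries.X)) *
        ∏ i ∈ s, (1 - PowerSeries.C (z i + k / 2) * PowerSeries.X)) := by
  have h := congrArg expSeries (sum_logFactor_eq k s y z)
  have h0 : ∀ a b : ℂ, constantCoeff (logFactor a + logFactor b) = 0 := fun a b => by
    rw [map_add, constantCoeff_logFactor, constantCoeff_logFactor, add_zero]
  rw [expSeries_add (constantCoeff_cycLog _ _) (by rw [map_sum]; simp [h0]),
    expSeries_sum _ fun i => h0 _ _, expSeries_sum _ fun i => h0 _ _] at h
  simp only [expSeries_add (constantCoeff_logFactor _) (constantCoeff_logFactor _),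
    expSeries_logFactor, Finset.prod_mul_distrib] at h
  exact h

/-- The central character of `k`-cycles as a coefficient of a power series. -/
theorem diagCyc_eq_coeff {k : ℕ} (hk : 2 ≤ k) (lam : YoungDiagram) :
    -((k : ℂ) ^ 2) * diagCyc k lam = coeff (k + 1) (centralFactor ℂ k *
      expSeries (cycLog k fun m => ∑ i ∈ Finset.range (lam.colLen 0),
        (((lam.rowLen i : ℂ) - (i + 1) + 1 / 2) ^ m - (-((i : ℂ) + 1) + 1 / 2) ^ m))) := by
  set N := lam.colLen 0 with hN
  set y : ℕ → ℂ := fun i => (lam.rowLen i : ℂ) - (i + 1) + 1 / 2 with hy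
  -- The shifted rows up to a common translation, chosen so that the nodes `u i` and the zeros `u i
  -- + k` lie symmetrically about the `y i`.
  set u : Fin N → ℂ := fun i => y i - k / 2 with hu
  have hlu : ∀ i : Fin N, (shiftedRows N lam i : ℂ) = u i + (k / 2 + N - 1 / 2) := by
    intro i
    simp only [shiftedRows, hu, hy]
    push_cast
    ring
  have hinj : Function.Injective u := by
    intro i j hij
    refine shiftedRows_injective N lam (Int.cast_injective (α := ℂ) ?_)
    rw [hlu, hlu, hij]
  have h1 : (k : ℂ) * diagCyc k lam = ∑ i : Fin N, (descPochhammer ℂ k).eval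
      (shiftedRows N lam i : ℂ) * ∏ j ∈ Finset.univ.erase i,
        ((u i - u j)⁻¹ * (u i - (u j + k))) := by
    refine mul_right_cancel₀ (detInvFact_shiftedRows_ne_zero N lam) ?_
    rw [diagCyc_mul_detInvFact hk le_rfl, cycleSum, Finset.sum_mul]
    refine Finset.sum_congr rfl fun i _ => ?_
    rw [detInvFact_lower (shiftedRows_injective N lam)]
    congr 2
    refine Finset.prod_congr rfl fun j _ => ?_
    rw [hlu, hlu]
    congr 1
    · congr 1
      ring
    · ring
  -- The zeros are the `k` of the falling factorial and the `N` numbers `u j + k`; with `N` nodes,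
  -- `k + N` zeros give the coefficient of degree `k + 1`.
  have h2 := sum_prod_div_eq_coeff hinj (Finset.univ : Finset (Fin k ⊕ Fin N))
    (Sum.elim (fun m => ((m : ℕ) : ℂ) - k / 2 - N + 1 / 2) fun j => u j + k) (m := k + 1)
    (by simp; ring)
  simp only [Fintype.prod_sum_type, Sum.elim_inl, Sum.elim_inr] at h2
  -- Including `j = i` in the product adds the factor `u i - (u i + k) = -k`, whence `-k ^ 2`.
  have h3 : -((k : ℂ) ^ 2) * diagCyc k lam = ∑ i : Fin N,
      ((∏ m : Fin k, (u i - (((m : ℕ) : ℂ) - k / 2 - N + 1 / 2))) * ∏ j, (u i - (u j + k))) /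
        ∏ j ∈ Finset.univ.erase i, (u i - u j) := by
    rw [show -((k : ℂ) ^ 2) * diagCyc k lam = -k * (k * diagCyc k lam) by ring, h1,
      Finset.mul_sum]
    refine Finset.sum_congr rfl fun i _ => ?_
    rw [descPochhammer_eval_eq_prod_range,
      Fin.prod_univ_eq_prod_range (fun m => u i - ((m : ℂ) - k / 2 - N + 1 / 2)) k,
      ← Finset.mul_prod_erase Finset.univ (fun j => u i - (u j + k)) (Finset.mem_univ i),
      Finset.prod_mul_distrib, Finset.prod_inv_distrib]
    have h4 : ∏ j ∈ Finset.range k, ((shiftedRows N lam i : ℂ) - j) =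
        ∏ m ∈ Finset.range k, (u i - ((m : ℂ) - k / 2 - N + 1 / 2)) := by
      refine Finset.prod_congr rfl fun m _ => ?_
      rw [hlu]
      ring
    rw [h4, div_eq_mul_inv]
    ring
  rw [h3, h2]
  congr 1
  rw [Fin.prod_univ_eq_prod_range
    (fun m => (1 - PowerSeries.C ((m : ℂ) - k / 2 - N + 1 / 2) * PowerSeries.X)) k]
  -- `h5` compares the factors of `lam` with those of the empty diagram and leaves an exponential in
  -- the power sums; `h6` turns the remaining factors into `centralFactor`, so that `N` disappears.
  have h5 := prod_linear_eq_expSeries k (Finset.range N) y fun i => -((i : ℂ) + 1) + 1 / 2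
  have h6 := prod_shift_centralFactor (show 1 ≤ k by omega) N
  have huk : ∀ j : Fin N, u j + k = y j + k / 2 := by
    intro j
    simp only [hu]
    ring
  simp only [huk]
  have hgeom : (∏ i ∈ Finset.range N, (1 - PowerSeries.C (y i - k / 2) * PowerSeries.X)) *
      ∏ i, geomSeries (u i) = 1 := by
    rw [← Fin.prod_univ_eq_prod_range
      (fun i => (1 - PowerSeries.C (y i - k / 2) * PowerSeries.X)) N, ← Finset.prod_mul_distrib]
    exact Finset.prod_eq_one fun i _ => one_sub_mul_geomSeries (u i)
  rw [Fin.prod_univ_eq_prod_range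
    (fun i => (1 - PowerSeries.C (y i + k / 2) * PowerSeries.X)) N]
  have hne : ∏ i ∈ Finset.range N,
      (1 - PowerSeries.C (-((i : ℂ) + 1) + 1 / 2 + k / 2) * PowerSeries.X) ≠ 0 :=
    Finset.prod_ne_zero_iff.2 fun i _ h => by
      have := congrArg constantCoeff h
      simp at this
  refine mul_right_cancel₀ hne ?_
  set Y := ∏ i ∈ Finset.range N, (1 - PowerSeries.C (y i + k / 2) * PowerSeries.X)
  set G := ∏ i, geomSeries (u i)
  set Z := ∏ i ∈ Finset.range N,
    (1 - PowerSeries.C (-((i : ℂ) + 1) + 1 / 2 + k / 2) * PowerSeries.X)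
  set E := expSeries (cycLog k fun m => ∑ i ∈ Finset.range N,
    (y i ^ m - (-((i : ℂ) + 1) + 1 / 2) ^ m))
  linear_combination -(Y * G) * h6 + (centralFactor ℂ k * G) * h5 +
    (centralFactor ℂ k * E * Z) * hgeom

end

noncomputable section

open PowerSeries (coeff constantCoeff)

/-! ### The exponential of a power series as a sum over partitions -/

section Multisets

/-- The product of the factorials of the multiplicities. -/
def multFactorial (s : Multiset ℕ) : ℕ := ∏ i ∈ s.toFinset, (s.count i).factorial

theorem multFactorial_cons (a : ℕ) (s : Multiset ℕ) :
    multFactorial (a ::ₘ s) = (s.count a + 1) * multFactorial s := by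
  have h : multFactorial s = ∏ i ∈ insert a s.toFinset, (s.count i).factorial := by
    refine Finset.prod_subset (Finset.subset_insert _ _) fun i _ hi => ?_
    rw [Multiset.mem_toFinset] at hi
    rw [Multiset.count_eq_zero_of_notMem hi, Nat.factorial_zero]
  rw [h, multFactorial, Multiset.toFinset_cons,
    ← Finset.mul_prod_erase _ _ (Finset.mem_insert_self a _),
    ← Finset.mul_prod_erase _ (fun i => (s.count i).factorial) (Finset.mem_insert_self a _),
    Multiset.count_cons_self, Nat.factorial_succ, mul_assoc]
  congr 2
  refine Finset.prod_congr rfl fun i hi => ?_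
  rw [Multiset.count_cons_of_ne (Finset.ne_of_mem_erase hi)]

/-- The pairs of an integer and a partition of it, of total weight `w`. -/
def weightPartitions (w : ℕ) : Finset (Σ n : ℕ, n.Partition) :=
  (Finset.range (w + 1)).sigma fun _ => Finset.univ.filter fun mu => wt mu = w

/-- The multisets of parts of the partitions of weight `w`. -/
def weightMultisets (w : ℕ) : Finset (Multiset ℕ) :=
  (weightPartitions w).image fun x => x.2.parts

theorem mem_weightMultisets {w : ℕ} {s : Multiset ℕ} :
    s ∈ weightMultisets w ↔ (∀ i ∈ s, 0 < i) ∧ s.sum + s.card = w := by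
  have hmem : ∀ x : Σ n : ℕ, n.Partition, x ∈ weightPartitions w ↔ wt x.2 = w := by
    intro x
    simp only [weightPartitions, Finset.mem_sigma, Finset.mem_range, Finset.mem_filter_univ]
    refine ⟨fun h => h.2, fun h => ⟨?_, h⟩⟩
    rw [wt] at h
    omega
  simp only [weightMultisets, Finset.mem_image, hmem]
  constructor
  · rintro ⟨⟨n, mu⟩, h, rfl⟩
    exact ⟨fun i hi => mu.parts_pos hi, by rw [mu.parts_sum]; exact h⟩
  · rintro ⟨h1, h2⟩
    exact ⟨⟨s.sum, ⟨s, fun hi => h1 _ hi, rfl⟩⟩, h2, rfl⟩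

theorem sum_weightMultisets {M : Type*} [AddCommMonoid M] (w : ℕ) (f : Multiset ℕ → M) :
    ∑ s ∈ weightMultisets w, f s = ∑ n ∈ Finset.range (w + 1),
      ∑ mu ∈ (Finset.univ : Finset n.Partition).filter (fun mu => wt mu = w), f mu.parts := by
  rw [weightMultisets, Finset.sum_image, weightPartitions, Finset.sum_sigma]
  rintro ⟨n, mu⟩ _ ⟨m, nu⟩ _ h
  obtain rfl : n = m := by rw [← mu.parts_sum, ← nu.parts_sum]; exact congrArg _ h
  obtain rfl : mu = nu := Nat.Partition.ext h
  rfl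

theorem sum_count_mul_succ (s : Multiset ℕ) :
    ∑ m ∈ s.toFinset, s.count m * (m + 1) = s.sum + s.card := by
  have h := Finset.sum_multiset_count s
  have h2 := Multiset.toFinset_sum_count_eq s
  simp only [mul_add, mul_one, Finset.sum_add_distrib, smul_eq_mul] at h ⊢
  rw [← h, h2]

variable {R : Type*} [CommRing R] [Algebra ℂ R]

/-- The monomial of a multiset of indices divided by the factorials of the multiplicities. -/
def multTerm (q : ℕ → R) (s : Multiset ℕ) : R :=
  ((multFactorial s : ℕ) : ℂ)⁻¹ • (s.map q).prod

theorem count_mul_multTerm_cons (q : ℕ → R) (a : ℕ) (s : Multiset ℕ) :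
    (((a ::ₘ s).count a : ℕ) : R) * multTerm q (a ::ₘ s) = q a * multTerm q s := by
  have h1 : ((s.count a : ℂ) + 1) ≠ 0 := by exact_mod_cast (s.count a).succ_ne_zero
  have h2 : (((a ::ₘ s).count a : ℕ) : R) = algebraMap ℂ R (s.count a + 1) := by
    simp
  rw [h2, ← Algebra.smul_def, multTerm, multTerm, multFactorial_cons, smul_smul, Nat.cast_mul,
    Nat.cast_add, Nat.cast_one, mul_inv, ← mul_assoc, mul_inv_cancel₀ h1, one_mul,
    Multiset.map_cons, Multiset.prod_cons, mul_smul_comm]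

/-- The right sides form a series satisfying the differential equation of the exponential: the
weight of a multiset is the sum of `m + 1` over its parts, and deleting a part `m` cancels its
multiplicity against the factorials. -/
theorem coeff_expSeries_eq_sum (q : ℕ → R) (w : ℕ) :
    coeff w (expSeries (PowerSeries.mk fun j => if 2 ≤ j then q (j - 1) else 0)) =
      ∑ s ∈ weightMultisets w, multTerm q s := by
  set A : PowerSeries R := PowerSeries.mk fun j => if 2 ≤ j then q (j - 1) else 0
  have hA : constantCoeff A = 0 := by
    simp [A, ← PowerSeries.coeff_zero_eq_constantCoeff_apply]
  suffices h : PowerSeries.mk (fun w => ∑ s ∈ weightMultisets w, multTerm q s) = expSeries A by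
    rw [← h, PowerSeries.coeff_mk]
  refine eq_expSeries hA ?_ ?_
  · have h0 : weightMultisets 0 = {0} := by
      ext s
      rw [mem_weightMultisets, Finset.mem_singleton]
      constructor
      · rintro ⟨-, h⟩
        exact Multiset.card_eq_zero.1 (by omega)
      · rintro rfl
        simp
    rw [← PowerSeries.coeff_zero_eq_constantCoeff_apply, PowerSeries.coeff_mk, h0,
      Finset.sum_singleton]
    simp [multTerm, multFactorial]
  · ext n
    have hA' : ∀ i, coeff i (PowerSeries.derivative R A) = if 1 ≤ i then q i * (i + 1) else 0 := by
      intro i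
      rw [PowerSeries.coeff_derivative, PowerSeries.coeff_mk, Nat.add_sub_cancel]
      by_cases h : 1 ≤ i
      · rw [if_pos h, if_pos (by omega)]
      · rw [if_neg h, if_neg (by omega), zero_mul]
    rw [PowerSeries.coeff_derivative, PowerSeries.coeff_mul, PowerSeries.coeff_mk]
    simp only [hA', PowerSeries.coeff_mk, ite_mul, zero_mul]
    rw [← Finset.sum_filter, Finset.sum_mul]
    have hL : ∀ s ∈ weightMultisets (n + 1), multTerm q s * ((n : R) + 1) =
        ∑ m ∈ s.toFinset, (s.count m : R) * multTerm q s * (m + 1) := by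
      intro s hs
      have h1 := sum_count_mul_succ s
      rw [(mem_weightMultisets.1 hs).2] at h1
      have h2 := congrArg (Nat.cast : ℕ → R) h1
      push_cast at h2
      rw [← h2, Finset.mul_sum]
      exact Finset.sum_congr rfl fun m _ => by ring
    rw [Finset.sum_congr rfl hL]
    simp only [Finset.mul_sum]
    rw [Finset.sum_sigma', Finset.sum_sigma']
    refine Finset.sum_bij' (fun x _ => ⟨(x.2, n - x.2), x.1.erase x.2⟩)
      (fun x _ => ⟨x.1.1 ::ₘ x.2, x.1.1⟩) ?_ ?_ ?_ ?_ ?_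
    · rintro ⟨s, m⟩ h
      rw [Finset.mem_sigma, mem_weightMultisets, Multiset.mem_toFinset] at h
      obtain ⟨⟨hs1, hs2⟩, hm⟩ := h
      dsimp only at hs1 hs2 hm
      obtain ⟨t, rfl⟩ := Multiset.exists_cons_of_mem hm
      simp only [Multiset.sum_cons, Multiset.card_cons] at hs2
      simp only [Finset.mem_sigma, Finset.mem_filter, Finset.HasAntidiagonal.mem_antidiagonal,
        Multiset.erase_cons_head, mem_weightMultisets]
      exact ⟨⟨by omega, hs1 m hm⟩, fun i hi => hs1 i (Multiset.mem_cons_of_mem hi), by omega⟩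
    · rintro ⟨⟨a, b⟩, t⟩ h
      simp only [Finset.mem_sigma, Finset.mem_filter, Finset.HasAntidiagonal.mem_antidiagonal,
        mem_weightMultisets] at h
      obtain ⟨⟨hab, ha⟩, ht1, ht2⟩ := h
      simp only [Finset.mem_sigma, mem_weightMultisets, Multiset.mem_toFinset,
        Multiset.mem_cons_self, and_true, Multiset.sum_cons, Multiset.card_cons,
        Multiset.mem_cons, forall_eq_or_imp]
      exact ⟨⟨ha, ht1⟩, by omega⟩
    · rintro ⟨s, m⟩ h
      rw [Finset.mem_sigma, Multiset.mem_toFinset] at h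
      simp only [Multiset.cons_erase h.2]
    · rintro ⟨⟨a, b⟩, t⟩ h
      simp only [Finset.mem_sigma, Finset.mem_filter,
        Finset.HasAntidiagonal.mem_antidiagonal] at h
      simp only [Multiset.erase_cons_head]
      obtain rfl : b = n - a := by omega
      rfl
    · rintro ⟨s, m⟩ h
      rw [Finset.mem_sigma, Multiset.mem_toFinset] at h
      obtain ⟨t, ht⟩ := Multiset.exists_cons_of_mem h.2
      simp only at ht ⊢
      rw [ht, count_mul_multTerm_cons, Multiset.erase_cons_head]
      ring

end Multisets

/-! ### The weight filtration -/

theorem weightFiltration_mono {a b : ℕ} (h : a ≤ b) : weightFiltration a ≤ weightFiltration b :=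
  Submodule.span_mono fun _ ⟨n, mu, hmu, hF⟩ => ⟨n, mu, hmu.trans h, hF⟩

theorem one_mem_weightFiltration : (1 : Lam) ∈ weightFiltration 0 :=
  Submodule.subset_span ⟨0, ⟨0, by simp, rfl⟩, by simp [wt], by simp [pPart]⟩

theorem p_mem_weightFiltration {m : ℕ} (hm : 1 ≤ m) : p m ∈ weightFiltration (m + 1) :=
  Submodule.subset_span ⟨m, ⟨{m}, by simp; omega, by simp⟩, by simp [wt], by simp [pPart]⟩

theorem mul_mem_weightFiltration {a b : ℕ} {x y : Lam} (hx : x ∈ weightFiltration a)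
    (hy : y ∈ weightFiltration b) : x * y ∈ weightFiltration (a + b) := by
  have h := Submodule.mul_mem_mul hx hy
  rw [weightFiltration, weightFiltration, Submodule.span_mul_span] at h
  refine Submodule.span_mono ?_ h
  rintro _ ⟨_, ⟨n, mu, hmu, rfl⟩, _, ⟨m, nu, hnu, rfl⟩, rfl⟩
  refine ⟨n + m, ⟨mu.parts + nu.parts, ?_, ?_⟩, ?_, ?_⟩
  · intro i hi
    rcases Multiset.mem_add.1 hi with hi | hi
    · exact mu.parts_pos hi
    · exact nu.parts_pos hi
  · rw [Multiset.sum_add, mu.parts_sum, nu.parts_sum]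
  · rw [wt] at hmu hnu ⊢
    rw [Multiset.card_add]
    omega
  · simp [pPart]

/-- The weight filtration extended by zero to negative indices. -/
def intWeightFiltration (z : ℤ) : Submodule ℂ Lam :=
  if 0 ≤ z then weightFiltration z.toNat else ⊥

theorem intWeightFiltration_natCast (n : ℕ) : intWeightFiltration n = weightFiltration n := by
  simp [intWeightFiltration]

theorem intWeightFiltration_mono {a b : ℤ} (h : a ≤ b) :
    intWeightFiltration a ≤ intWeightFiltration b := by
  rw [intWeightFiltration, intWeightFiltration]
  by_cases ha : 0 ≤ a
  · rw [if_pos ha, if_pos (by omega)]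
    exact weightFiltration_mono (by omega)
  · rw [if_neg ha]
    exact bot_le

theorem mul_mem_intWeightFiltration {a b : ℤ} {x y : Lam} (hx : x ∈ intWeightFiltration a)
    (hy : y ∈ intWeightFiltration b) : x * y ∈ intWeightFiltration (a + b) := by
  rw [intWeightFiltration] at hx hy
  split_ifs at hx hy with ha hb
  · rw [intWeightFiltration, if_pos (by omega), Int.toNat_add ha hb]
    exact mul_mem_weightFiltration hx hy
  · rw [(Submodule.mem_bot ℂ).1 hy, mul_zero]
    exact zero_mem _
  all_goals
    rw [(Submodule.mem_bot ℂ).1 hx, zero_mul]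
    exact zero_mem _

theorem algebraMap_mem_intWeightFiltration (c : ℂ) {z : ℤ} (hz : 0 ≤ z) :
    algebraMap ℂ Lam c ∈ intWeightFiltration z := by
  rw [intWeightFiltration, if_pos hz, Algebra.algebraMap_eq_smul_one]
  exact Submodule.smul_mem _ _ (weightFiltration_mono (Nat.zero_le _) one_mem_weightFiltration)

/-- The differential equation of the exponential gives only `n + 1` times the next coefficient. -/
theorem mem_of_mul_natCast_mem {M : Submodule ℂ Lam} {x : Lam} {n : ℕ}
    (h : x * ((n : Lam) + 1) ∈ M) : x ∈ M := by
  have h3 : (n : ℂ) + 1 ≠ 0 := by exact_mod_cast n.succ_ne_zero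
  have h1 : x * ((n : Lam) + 1) = ((n : ℂ) + 1) • x := by
    rw [Algebra.smul_def, mul_comm]
    simp
  rw [h1] at h
  simpa [smul_smul, inv_mul_cancel₀ h3] using M.smul_mem ((n : ℂ) + 1)⁻¹ h

/-- The coefficient of `z ^ n` has weight at most `n - d`. -/
def HasWeight (d : ℤ) (A : PowerSeries Lam) : Prop :=
  ∀ n : ℕ, coeff n A ∈ intWeightFiltration (n - d)

theorem HasWeight.add {d : ℤ} {A B : PowerSeries Lam} (hA : HasWeight d A) (hB : HasWeight d B) :
    HasWeight d (A + B) := fun n => by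
  rw [map_add]
  exact add_mem (hA n) (hB n)

theorem HasWeight.mono {d e : ℤ} {A : PowerSeries Lam} (hA : HasWeight d A) (h : e ≤ d) :
    HasWeight e A := fun n => intWeightFiltration_mono (by omega) (hA n)

theorem HasWeight.mul {d e : ℤ} {A B : PowerSeries Lam} (hA : HasWeight d A)
    (hB : HasWeight e B) : HasWeight (d + e) (A * B) := fun n => by
  rw [PowerSeries.coeff_mul]
  refine sum_mem fun x hx => ?_
  rw [Finset.HasAntidiagonal.mem_antidiagonal] at hx
  have := mul_mem_intWeightFiltration (hA x.1) (hB x.2)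
  rwa [show (x.1 : ℤ) - d + (x.2 - e) = n - (d + e) by omega] at this

/-- In `E' = A' E` the weights of the two factors add up to the degree, so the bound passes to the
next coefficient. -/
theorem HasWeight.expSeries {A : PowerSeries Lam} (hA : HasWeight 0 A)
    (h0 : constantCoeff A = 0) : HasWeight 0 (expSeries A) := by
  intro n
  induction n using Nat.strong_induction_on with
  | _ n ih =>
    rcases n with _ | n
    · rw [PowerSeries.coeff_zero_eq_constantCoeff_apply, constantCoeff_expSeries h0,
        ← map_one (algebraMap ℂ Lam)]
      exact algebraMap_mem_intWeightFiltration _ (by simp)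
    · refine mem_of_mul_natCast_mem (n := n) ?_
      rw [← PowerSeries.coeff_derivative, derivative_expSeries h0, PowerSeries.coeff_mul]
      refine sum_mem fun x hx => ?_
      rw [Finset.HasAntidiagonal.mem_antidiagonal] at hx
      have := mul_mem_intWeightFiltration (hA (x.1 + 1)) (ih x.2 (by omega))
      rw [show ((x.1 + 1 : ℕ) : ℤ) - 0 + (x.2 - 0) = (n + 1 : ℕ) - 0 by omega] at this
      have h := Submodule.smul_mem _ ((x.1 : ℂ) + 1) this
      rw [PowerSeries.coeff_derivative]
      convert h using 1
      rw [Algebra.smul_def]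
      simp
      ring

/-- The same recursion: each term has one factor from `A`, which brings the drop `d`. Only the
constant term lacks it. -/
theorem HasWeight.expSeries_sub_one {d : ℤ} (hd : 0 ≤ d) {A : PowerSeries Lam}
    (hA : HasWeight d A) (h0 : constantCoeff A = 0) :
    HasWeight d (ShiftedSym.expSeries A - 1) := by
  intro n
  rcases n with _ | n
  · rw [map_sub, PowerSeries.coeff_zero_eq_constantCoeff_apply, constantCoeff_expSeries h0]
    simp
  · refine mem_of_mul_natCast_mem (n := n) ?_
    rw [map_sub, PowerSeries.coeff_one, if_neg (Nat.succ_ne_zero n), sub_zero,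
      ← PowerSeries.coeff_derivative, derivative_expSeries h0, PowerSeries.coeff_mul]
    refine sum_mem fun x hx => ?_
    rw [Finset.HasAntidiagonal.mem_antidiagonal] at hx
    have := mul_mem_intWeightFiltration (hA (x.1 + 1)) ((hA.mono hd).expSeries h0 x.2)
    rw [show ((x.1 + 1 : ℕ) : ℤ) - d + (x.2 - 0) = (n + 1 : ℕ) - d by omega] at this
    have h := Submodule.smul_mem _ ((x.1 : ℂ) + 1) this
    rw [PowerSeries.coeff_derivative]
    convert h using 1
    rw [Algebra.smul_def]
    simp
    ring

/-! ### The central characters of cycles as shifted symmetric functions -/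

/-- The constant `(1 - 2⁻ᵐ) ζ(-m)`. -/
def zetaConst (m : ℕ) : ℂ := (1 - (2 ^ m)⁻¹) * riemannZeta (-(m : ℂ))

/-- The power sums without the zeta constants. -/
def powerSum (m : ℕ) : Lam := p m - algebraMap ℂ Lam (zetaConst m)

/-- The shifted symmetric function of `k`-cycles. -/
def cycleFun (k : ℕ) : Lam :=
  (-((k : ℂ) ^ 2)⁻¹) • coeff (k + 1) (centralFactor Lam k * expSeries (cycLog k powerSum))

/-- Evaluation at a diagram. -/
def evalAt (lam : YoungDiagram) : Lam →ₐ[ℂ] ℂ :=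
  (Pi.evalAlgHom ℂ (fun _ : YoungDiagram => ℂ) lam).comp Lam.val

theorem evalAt_powerSum (lam : YoungDiagram) (m : ℕ) :
    evalAt lam (powerSum m) = ∑ i ∈ Finset.range (lam.colLen 0),
      (((lam.rowLen i : ℂ) - (i + 1) + 1 / 2) ^ m - (-((i : ℂ) + 1) + 1 / 2) ^ m) := by
  rw [powerSum, map_sub, AlgHom.commutes, sub_eq_iff_eq_add]
  rfl

theorem cycleFun_apply {k : ℕ} (hk : 2 ≤ k) (lam : YoungDiagram) :
    (cycleFun k : YoungDiagram → ℂ) lam = fCycle k lam := by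
  have h1 : (cycleFun k : YoungDiagram → ℂ) lam = evalAt lam (cycleFun k) := rfl
  have h2 : ∀ A, evalAt lam (coeff (k + 1) A) =
      coeff (k + 1) (PowerSeries.map (evalAt lam : Lam →+* ℂ) A) := by
    intro A
    rw [PowerSeries.coeff_map]
    rfl
  rw [h1, cycleFun, map_smul, h2, map_mul, map_centralFactor,
    map_expSeries _ (constantCoeff_cycLog _ _), map_cycLog]
  simp only [evalAt_powerSum]
  rw [← diagCyc_eq_coeff hk, fCycle_eq_diagCyc, smul_eq_mul]
  have : (k : ℂ) ≠ 0 := by exact_mod_cast (by omega : k ≠ 0)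
  field_simp

/-- The logarithm of `P(z)`. -/
def logP : PowerSeries Lam := -PowerSeries.mk fun j => if 2 ≤ j then p (j - 1) else 0

theorem constantCoeff_logP : constantCoeff logP = 0 := by
  rw [logP, map_neg, ← PowerSeries.coeff_zero_eq_constantCoeff_apply, PowerSeries.coeff_mk,
    if_neg (by norm_num), neg_zero]

theorem genP_pow (k : ℕ) : genP ^ k = expSeries (k • logP) :=
  (expSeries_nsmul k constantCoeff_logP).symm

theorem hasWeight_logP (k : ℕ) : HasWeight 0 (k • logP) := by
  intro n
  rw [map_nsmul, logP, map_neg, PowerSeries.coeff_mk]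
  refine nsmul_mem (neg_mem ?_) k
  split_ifs with h
  · rw [sub_zero, intWeightFiltration_natCast]
    have := p_mem_weightFiltration (show 1 ≤ n - 1 by omega)
    rwa [show n - 1 + 1 = n by omega] at this
  · exact zero_mem _

/-- In degree `n ≥ 2` the term with `p (n - 1)` is the same in both series up to the zeta constant,
which has weight `0`. The term with `p (n - 2)` has coefficient zero, since `(k/2)^2` and `(-k/2)^2`
cancel; this parity gains the second unit of weight. -/
theorem hasWeight_cycLog_sub (k : ℕ) : HasWeight 2 (cycLog k powerSum - k • logP) := by
  intro n
  rw [map_sub, map_nsmul, logP, map_neg, PowerSeries.coeff_mk, cycLog, PowerSeries.coeff_mk]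
  by_cases hn : 2 ≤ n
  · obtain ⟨n, rfl⟩ : ∃ q, n = q + 2 := ⟨n - 2, by omega⟩
    have hz : ((n + 2 : ℕ) : ℤ) - 2 = n := by push_cast; ring
    rw [if_pos hn, hz, show n + 2 - 1 = n + 1 by omega,
      Finset.sum_Ico_succ_top (show 1 ≤ n + 1 by omega)]
    have hc : cycLogCoeff k (n + 2) (n + 1) = k := by
      have h2 : (n : ℂ) + 1 + 1 ≠ 0 := by exact_mod_cast Nat.succ_ne_zero (n + 1)
      rw [cycLogCoeff, show n + 2 = n + 1 + 1 from rfl, Nat.choose_succ_self_right,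
        Nat.add_sub_cancel_left]
      push_cast
      field_simp
      ring
    have hk : (cycLogCoeff k (n + 2) (n + 1) • powerSum (n + 1) : Lam) =
        k • p (n + 1) - algebraMap ℂ Lam (k * zetaConst (n + 1)) := by
      rw [hc, powerSum, smul_sub, map_mul, ← Algebra.smul_def, Nat.cast_smul_eq_nsmul]
    rw [hk, smul_neg, show ∀ a b c : Lam, -(a + (b - c)) - -b = -a + c by intros; ring]
    refine add_mem (neg_mem (sum_mem fun m hm => ?_))
      (algebraMap_mem_intWeightFiltration _ (Int.natCast_nonneg n))
    rw [Finset.mem_Ico] at hm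
    rcases (show m ≤ n by omega).eq_or_lt with rfl | hlt
    · have h0 : cycLogCoeff k (m + 2) m = 0 := by
        rw [cycLogCoeff, Nat.add_sub_cancel_left]
        ring
      rw [h0, zero_smul]
      exact zero_mem _
    · refine Submodule.smul_mem _ _ (sub_mem ?_
        (algebraMap_mem_intWeightFiltration _ (Int.natCast_nonneg n)))
      rw [intWeightFiltration_natCast]
      exact weightFiltration_mono (by omega) (p_mem_weightFiltration hm.1)
  · rw [if_neg hn, Finset.Ico_eq_empty (by omega)]
    simp

/-- The coefficients are constants, of weight `0`, and those in degrees `0` and `1` vanish. -/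
theorem hasWeight_centralFactor_sub_one (k : ℕ) : HasWeight 2 (centralFactor Lam k - 1) := by
  intro n
  rcases n with _ | _ | n
  · rw [map_sub, PowerSeries.coeff_zero_eq_constantCoeff_apply, constantCoeff_centralFactor]
    simp
  · rw [map_sub, zero_add, coeff_one_centralFactor, PowerSeries.coeff_one]
    simp
  · rw [map_sub, PowerSeries.coeff_one, if_neg (by omega), sub_zero,
      ← map_centralFactor (Algebra.ofId ℂ Lam), PowerSeries.coeff_map]
    exact algebraMap_mem_intWeightFiltration _ (by push_cast; omega)

/-- `centralFactor` differs from `1`, and the logarithm from `k • logP`, by series of weight two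
below the degree. Multiplicativity passes this on to the product, whose coefficient of degree `k +
1` therefore changes only by weight `k - 1`. -/
theorem cycleFun_sub_mem {k : ℕ} (hk : 1 ≤ k) :
    cycleFun k - (-((k : ℂ) ^ 2)⁻¹) • coeff (k + 1) (genP ^ k) ∈ weightFiltration (k - 1) := by
  set B := cycLog k powerSum with hB
  set C := B - k • logP with hC
  have hC2 : HasWeight 2 C := hasWeight_cycLog_sub k
  have hL0 : constantCoeff (k • logP) = 0 := by rw [map_nsmul, constantCoeff_logP, smul_zero]
  have hC0 : constantCoeff C = 0 := by
    rw [hC, map_sub, hL0, constantCoeff_cycLog, sub_zero]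
  have hBC : B = k • logP + C := by rw [hC]; ring
  have hB0 : HasWeight 0 B := by
    rw [hBC]
    exact (hasWeight_logP k).add (hC2.mono (by norm_num))
  have h1 : centralFactor Lam k * expSeries B - genP ^ k =
      (centralFactor Lam k - 1) * expSeries B + (expSeries C - 1) * expSeries (k • logP) := by
    rw [genP_pow, hBC, expSeries_add hL0 hC0]
    ring
  have h2 : HasWeight 2 (centralFactor Lam k * expSeries B - genP ^ k) := by
    rw [h1]
    exact ((hasWeight_centralFactor_sub_one k).mul
      (hB0.expSeries (constantCoeff_cycLog _ _))).add
      ((hC2.expSeries_sub_one (by norm_num) hC0).mul ((hasWeight_logP k).expSeries hL0))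
  have h3 := h2 (k + 1)
  rw [show ((k + 1 : ℕ) : ℤ) - 2 = (k - 1 : ℕ) by omega, intWeightFiltration_natCast,
    map_sub] at h3
  rw [cycleFun, ← smul_sub]
  exact Submodule.smul_mem _ _ h3

/-- In the expansion of `genP ^ k` a partition with `r` parts carries `(-k) ^ r`, and the factor `-1
/ k ^ 2` turns this into `k⁻¹ * (-k) ^ (r - 1)`. -/
theorem topTerm_eq {k : ℕ} (hk : 1 ≤ k) :
    topTerm k = (-((k : ℂ) ^ 2)⁻¹) • coeff (k + 1) (genP ^ k) := by
  have hkc : (k : ℂ) ≠ 0 := by exact_mod_cast (by omega : k ≠ 0)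
  have hser : k • logP =
      PowerSeries.mk fun j => if 2 ≤ j then (fun m => algebraMap ℂ Lam (-k) * p m) (j - 1)
        else 0 := by
    ext1 j
    rw [map_nsmul, logP, map_neg, PowerSeries.coeff_mk, PowerSeries.coeff_mk]
    split_ifs
    · simp only [map_neg, map_natCast, nsmul_eq_mul]
      ring
    · simp
  rw [genP_pow, hser, coeff_expSeries_eq_sum fun m => algebraMap ℂ Lam (-k) * p m, sum_weightMultisets, topTerm]
  simp only [Finset.smul_sum]
  refine Finset.sum_congr rfl fun n _ => Finset.sum_congr rfl fun mu hmu => ?_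
  -- Positive weight forces a part, so the natural subtraction in the exponent is not truncated.
  have hcard : mu.parts.card ≠ 0 := by
    intro h
    have h0 := Multiset.card_eq_zero.1 h
    have hs := mu.parts_sum
    have hw := (Finset.mem_filter.1 hmu).2
    rw [wt, h] at hw
    rw [h0, Multiset.sum_zero] at hs
    omega
  obtain ⟨r, hr⟩ := Nat.exists_eq_succ_of_ne_zero hcard
  have hprod : (mu.parts.map fun m => algebraMap ℂ Lam (-k) * p m).prod =
      (-(k : ℂ)) ^ mu.parts.card • pPart mu := by
    rw [Multiset.prod_map_mul, Multiset.map_const', Multiset.prod_replicate, ← map_pow,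
      ← Algebra.smul_def, pPart]
  rw [multTerm, hprod, smul_smul, smul_smul, smul_smul,
    show multFactorial mu.parts = kappaFactorial mu from rfl, hr, Nat.succ_sub_one]
  congr 1
  rw [Nat.succ_eq_add_one, pow_succ]
  field_simp
  ring

end

end ShiftedSym

theorem theorem4p4 (k : ℕ) (hk : 2 ≤ k) :
    ∃ F : ShiftedSym.Lam,
      (∀ lam : YoungDiagram, (F : YoungDiagram → ℂ) lam = ShiftedSym.fCycle k lam) ∧
      F - ShiftedSym.topTerm k ∈ ShiftedSym.weightFiltration (k - 1) ∧
      F - (-((k : ℂ) ^ 2)⁻¹) • PowerSeries.coeff (k + 1) (ShiftedSym.genP ^ k) ∈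
        ShiftedSym.weightFiltration (k - 1) := by
  have h := ShiftedSym.cycleFun_sub_mem (show 1 ≤ k by omega)
  refine ⟨ShiftedSym.cycleFun k, ShiftedSym.cycleFun_apply hk, ?_, h⟩
  rwa [ShiftedSym.topTerm_eq (show 1 ≤ k by omega)]
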